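/- **Setting.** Let $k\ge 1$, $0=x_0<x_1<\dots<x_k<x_{k+1}=1$ and $0=q_0\le q_1<\dots<q_{k+1}=1$. For $0<x<1$, a REM($x$) is a Poisson point process on $(0,\infty)$ with intensity $x s^{-x-1}ds$, its points listed in decreasing order. Let $\zeta^{v}$, $v\in\mathbb N^{l}$, $0\le l<k$, be independent, $\zeta^v$ being a REM($x_{l+1}$) for $v\in\mathbb N^l$. For $\alpha=(\alpha_1,\dots,\alpha_k)\in\mathbb N^k$ write $\alpha(l)=(\alpha_1,\dots,\alpha_l)$ and put $$\xi_\alpha=\prod_{l=1}^k\big(\zeta^{\alpha(l-1)}\big)_{\alpha_l},\qquad q_{\alpha,\alpha'}=\max\{q_{l+1}:0\le l\le k,\ \alpha(l)=\alpha'(l)\}.$$ Let $g\in C^1([0,1])$ be strictly increasing with $g(0)=0$, and let $\kappa=(\kappa_\alpha(r))_{\alpha\in\mathbb N^k,\,r\in[0,1]}$ be a centered Gaussian process, independent of the $\zeta^v$, with $\mathrm{Cov}(\kappa_\alpha(r),\kappa_{\alpha'}(r'))=g(r\wedge r'\wedge q_{\alpha,\alpha'})$. Let $\psi\in C^2(\mathbb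 R)$ have bounded $\psi',\psi''$ and $E[e^{\psi(Y)}]<\infty$ for every Gaussian $Y$. Put $\psi_{q_{k+1}}=\psi$ and, with $z$ standard Gaussian, $$\psi_{q_l}(y)=\frac1{m_l}\log E_z\Big[e^{m_l\psi_{q_{l+1}}\left(y+z\sqrt{g(q_{l+1})-g(q_l)}\right)}\Big],\qquad m_l=x_l\ (1\le l\le k),\quad m_0=1 .$$ Let $\tilde\xi_\alpha=\xi_\alpha e^{\psi(\kappa_\alpha(1))}$. Let $\phi,\tilde\phi:\mathbb N\to\mathbb N^k$ be the bijections that list $(\xi_\alpha)$, respectively $(\tilde\xi_\alpha)$, in strictly decreasing order. Put $\kappa_i=\kappa_{\phi(i)}$, $\tilde\kappa_i=\kappa_{\tilde\phi(i)}$ and $\tilde\xi_i=\tilde\xi_{\tilde\phi(i)}$, and let $Q=(q_{\phi(i),\phi(j)})_{i,j\in\mathbb N}$ and $\tilde Q=(q_{\tilde\phi(i),\tilde\phi(j)})_{i,j\in\mathbb N}$ be the overlap matrices of the points so ordered. For an overlap matrix $M$ and $0\le l\le k$ write $i\sim_l j$ if $M_{ij}\ge q_{l+1}$; for $M=Q$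 this means $[\phi(i)](l)=[\phi(j)](l)$, and likewise for $\tilde Q$ and $\tilde\phi$. **Proposition (backward distribution of the field).** Almost surely $\phi$ and $\tilde\phi$ exist and $\sum_\alpha\tilde\xi_\alpha<\infty$, and $\tilde Q$ has the same law as $Q$. For every $n$ there are a regular conditional law $\mu^{(n)}_{M}$ of $(\kappa_1,\dots,\kappa_n)$ given $Q=M$ and a regular conditional law $\tilde\mu^{(n)}_{M}$ of $(\tilde\kappa_1,\dots,\tilde\kappa_n)$ given $\tilde Q=M$ (on $(\mathbb R^{[0,1]})^n$ with the product $\sigma$-algebra) such that, for almost every $M$ under the law of $Q$, $\tilde\mu^{(n)}_{M}$ is absolutely continuous with respect to $\mu^{(n)}_{M}$ and $$\frac{d\tilde\mu^{(n)}_{M}}{d\mu^{(n)}_{M}}(p_1,\dots,p_n)=\prod_{l=0}^{k}\ \prod_{\bar i\in\{1,\dots,n\}/\sim_l}\frac{e^{x_l\psi_{q_{l+1}}(p_i(q_{l+1}))}}{e^{x_l\psi_{q_l}(p_i(q_l))}}\qquad\mu^{(n)}_{M}\text{-a.e.},$$ where $i$ is any representative of the class $\bar i$ (the paths of equivalent points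 agree almost surely at $q_l$ and $q_{l+1}$). Moreover, $\tilde\mu^{(n)}$ is also the conditional law of $(\tilde\kappa_1,\dots,\tilde\kappa_n)$ given $\tilde Q$ and the weights $\big(\tilde\xi_i\,e^{-\psi_{q_1}(\tilde\kappa_i(q_1))}\big)_{i\in\mathbb N}$; that is, given $\tilde Q$, the field $\tilde\kappa$ is independent of the shifted weights divided by their common factor ($\tilde\kappa_i(q_1)$ is almost surely the same for all $i$). Finally, $(\tilde\kappa,\tilde Q)$ is independent of the normalized shifted weights $\big(\tilde\xi_i/\sum_\alpha\tilde\xi_\alpha\big)_{i\in\mathbb N}$. -/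

import Mathlib

open MeasureTheory ProbabilityTheory Set
open scoped ENNReal NNReal

noncomputable section

namespace GREM

/-! ### Parameters -/

/-- The data `0 = x 0 < x 1 < ... < x (k+1) = 1` and `0 = q 0 ≤ q 1 < ... < q (k+1) = 1` of an
atomic probability measure on `[0,1]` with `k + 1` atoms `q 1, ..., q (k+1)`, one of them at `1`,
whose distribution function takes the value `x l` at `q l`.
Only the indices `0, ..., k+1` matter. -/
structure IsAtomic (k : ℕ) (x : ℕ → ℝ) (q : ℕ → unitInterval) : Prop where
  one_le : 1 ≤ k
  x_zero : x 0 = 0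
  x_last : x (k + 1) = 1
  x_lt : ∀ l, l ≤ k → x l < x (l + 1)
  q_zero : q 0 = 0
  q_last : q (k + 1) = 1
  q_lt : ∀ l, 1 ≤ l → l ≤ k → q l < q (l + 1)

/-- The covariance function of the field: strictly increasing, `C¹` on `[0,1]`, `g 0 = 0`. -/
structure IsCovFun (g : ℝ → ℝ) : Prop where
  contDiffOn : ContDiffOn ℝ 1 g (Icc 0 1)
  strictMonoOn : StrictMonoOn g (Icc 0 1)
  map_zero : g 0 = 0

/-- The class of `C²` functions with bounded first and second derivatives and
with `e ^ ψ(Y)` integrable for every Gaussian variable `Y`. -/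
structure IsShiftFun (ψ : ℝ → ℝ) : Prop where
  contDiff : ContDiff ℝ 2 ψ
  deriv_bdd : ∃ C : ℝ, ∀ y, |deriv ψ y| ≤ C
  deriv2_bdd : ∃ C : ℝ, ∀ y, |deriv (deriv ψ) y| ≤ C
  integrable_exp : ∀ (m : ℝ) (v : ℝ≥0), Integrable (fun y => Real.exp (ψ y)) (gaussianReal m v)

/-- `psiDown j` is `ψ_{q_{k+1-j}}`: start with `ψ_{q_{k+1}} = ψ_1 = ψ`, and go from level `l + 1`
to level `l = k - j` by
`ψ_{q_l}(y) = (1/m) log E_z exp (m ψ_{q_{l+1}}(y + z √(g(q_{l+1}) - g(q_l))))`,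
`z` standard Gaussian, with `m = x l` for `l ≥ 1` and `m = 1` for `l = 0`. -/
def psiDown (k : ℕ) (x : ℕ → ℝ) (q : ℕ → unitInterval) (g ψ : ℝ → ℝ) : ℕ → ℝ → ℝ
  | 0 => ψ
  | j + 1 => fun y =>
      let l := k - j
      let m : ℝ := if l = 0 then 1 else x l
      (1 / m) * Real.log (∫ z, Real.exp (m * psiDown k x q g ψ j
        (y + z * Real.sqrt (g (q (l + 1)) - g (q l)))) ∂(gaussianReal 0 1))

/-- The function `ψ_{q_l}`, for `0 ≤ l ≤ k + 1`. -/
def psiLevel (k : ℕ) (x : ℕ → ℝ) (q : ℕ → unitInterval) (g ψ : ℝ → ℝ) (l : ℕ) : ℝ → ℝ :=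
  psiDown k x q g ψ (k + 1 - l)

/-! ### The tree and the overlap -/

/-- `α(l) = α'(l)`: the first `l` coordinates of `α` and `α'` agree. -/
def Agree {k : ℕ} (l : ℕ) (α α' : Fin k → ℕ) : Prop :=
  ∀ i : Fin k, (i : ℕ) < l → α i = α' i

open Classical in
/-- `q_{α,α'} = max {q_{l+1} : 0 ≤ l ≤ k, α(l) = α'(l)}`. -/
def overlap {k : ℕ} (q : ℕ → unitInterval) (α α' : Fin k → ℕ) : unitInterval :=
  ((Finset.range (k + 1)).filter (fun l => Agree l α α')).sup (fun l => q (l + 1))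

/-- The relation `i ∼_l j` read off from an overlap matrix, see `levelRel_overlap_iff`. -/
def levelRel (q : ℕ → unitInterval) (M : ℕ → ℕ → unitInterval) (l i j : ℕ) : Prop :=
  q (l + 1) ≤ M i j

/-- For the overlaps of the points `φ 0, φ 1, ...`, the relation `levelRel` at level `l` is
`[φ i](l) = [φ j](l)`. -/
theorem levelRel_overlap_iff {k : ℕ} {x : ℕ → ℝ} {q : ℕ → unitInterval} (h : IsAtomic k x q)
    (φ : ℕ → Fin k → ℕ) {l : ℕ} (hl : l ≤ k) (i j : ℕ) :
    levelRel q (fun i j => overlap q (φ i) (φ j)) l i j ↔ Agree l (φ i) (φ j) := by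
  classical
  have hmono : ∀ a b, 1 ≤ a → a < b → b ≤ k + 1 → q a < q b := by
    intro a b ha hab hb
    induction b, hab using Nat.le_induction with
    | base => exact h.q_lt a ha (by omega)
    | succ n hn ih => exact (ih (by omega)).trans (h.q_lt n (by omega) (by omega))
  unfold levelRel overlap
  constructor
  · intro hle
    have hne : ((Finset.range (k + 1)).filter
        (fun l => Agree l (φ i) (φ j))).Nonempty :=
      ⟨0, Finset.mem_filter.2 ⟨by simp, fun a ha => absurd ha (Nat.not_lt_zero _)⟩⟩
    obtain ⟨m, hm, hme⟩ := Finset.exists_mem_eq_sup _ hne (fun l => q (l + 1))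
    simp only [Finset.mem_filter, Finset.mem_range] at hm
    simp only [hme] at hle
    have hlm : l ≤ m := by
      by_contra hc
      exact absurd hle (not_le.mpr (hmono _ _ (by omega) (by omega) (by omega)))
    exact fun a ha => hm.2 a (by omega)
  · intro hA
    exact Finset.le_sup (f := fun l => q (l + 1))
      (Finset.mem_filter.2 ⟨Finset.mem_range.2 (by omega), hA⟩)

/-! ### The point processes -/

/-- The intensity `x s ^ (-x-1) ds` on `(0, ∞)`. -/
def remIntensity (x : ℝ) : Measure ℝ :=
  (volume.restrict (Ioi 0)).withDensity (fun s => ENNReal.ofReal (x * s ^ (-x - 1)))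

/-- The number of points in `A`. -/
def pointCount {Ω : Type*} (ζ : ℕ → Ω → ℝ) (A : Set ℝ) (ω : Ω) : ℕ∞ :=
  {j | ζ j ω ∈ A}.encard

/-- `ζ 0 > ζ 1 > ...` is the decreasing enumeration of a REM(`x`), i.e. of a Poisson point process
on `(0, ∞)` with intensity `x s ^ (-x-1) ds`. -/
structure IsREM {Ω : Type*} [MeasurableSpace Ω] (P : Measure Ω) (x : ℝ) (ζ : ℕ → Ω → ℝ) :
    Prop where
  measurable : ∀ j, Measurable (ζ j)
  pos : ∀ᵐ ω ∂P, ∀ j, 0 < ζ j ω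
  strictAnti : ∀ᵐ ω ∂P, StrictAnti (fun j => ζ j ω)
  poisson : ∀ A : Set ℝ, MeasurableSet A → remIntensity x A ≠ ∞ → ∀ m : ℕ,
    P {ω | pointCount ζ A ω = m} = poissonMeasure (remIntensity x A).toNNReal {m}
  indep : ∀ (m : ℕ) (A : Fin m → Set ℝ), (∀ i, MeasurableSet (A i)) →
    Pairwise (fun i j => Disjoint (A i) (A j)) → iIndepFun (fun i => pointCount ζ (A i)) P

/-- The inner vertices of the tree: `⟨l, v⟩` with `v ∈ ℕ^l` and `0 ≤ l < k`. -/
abbrev Vertex (k : ℕ) : Type := Σ l : Fin k, (Fin l → ℕ)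

/-- The vertex `α(l)`, for `0 ≤ l < k`. -/
def vertex {k : ℕ} (α : Fin k → ℕ) (l : Fin k) : Vertex k :=
  ⟨l, fun i => α (Fin.castLE l.is_lt.le i)⟩

/-- The weights `ξ_α = ∏_{1 ≤ l ≤ k} (ζ^{α(l-1)})_{α_l}` of the cascade. -/
def weight {Ω : Type*} {k : ℕ} (ζ : Vertex k → ℕ → Ω → ℝ) (ω : Ω) (α : Fin k → ℕ) : ℝ :=
  ∏ l : Fin k, ζ (vertex α l) (α l) ω

/-- The shifted weights `ξ_α e^{ψ(κ_α(1))}`. -/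
def shiftedWeight {Ω : Type*} {k : ℕ} (ζ : Vertex k → ℕ → Ω → ℝ)
    (κ : (Fin k → ℕ) → unitInterval → Ω → ℝ) (ψ : ℝ → ℝ) (ω : Ω) (α : Fin k → ℕ) : ℝ :=
  weight ζ ω α * Real.exp (ψ (κ α 1 ω))

/-- The cascade of a GREM with `k` levels: independent REM's, the one attached to `α(l)` having
parameter `x_{l+1}`, together with an independent centered Gaussian field `κ` with
`Cov(κ_α(r), κ_α'(r')) = g(r ∧ r' ∧ q_{α,α'})`. -/
structure IsGREMWithField {Ω : Type*} [MeasurableSpace Ω] (P : Measure Ω) (k : ℕ) (x : ℕ → ℝ)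
    (q : ℕ → unitInterval) (g : ℝ → ℝ) (ζ : Vertex k → ℕ → Ω → ℝ)
    (κ : (Fin k → ℕ) → unitInterval → Ω → ℝ) : Prop where
  rem : ∀ v : Vertex k, IsREM P (x ((v.1 : ℕ) + 1)) (ζ v)
  indep_rem : iIndepFun (fun (v : Vertex k) (ω : Ω) (j : ℕ) => ζ v j ω) P
  measurable_field : ∀ α r, Measurable (κ α r)
  gaussian : IsGaussianProcess (fun p : (Fin k → ℕ) × unitInterval => κ p.1 p.2) P
  centered : ∀ α r, ∫ ω, κ α r ω ∂P = 0
  covariance : ∀ α α' r r',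
    covariance (κ α r) (κ α' r') P = g ((r ⊓ r' ⊓ overlap q α α' : unitInterval) : ℝ)
  indep_field : IndepFun (fun (ω : Ω) (v : Vertex k) (j : ℕ) => ζ v j ω)
    (fun (ω : Ω) (α : Fin k → ℕ) (r : unitInterval) => κ α r ω) P

/-! ### Ordering the points -/

/-- `e` enumerates the family `w` in strictly decreasing order. -/
def IsDecEnum {A : Type*} (w : A → ℝ) (e : ℕ → A) : Prop :=
  Function.Bijective e ∧ StrictAnti (fun i => w (e i))

open Classical in
/-- The (unique) enumeration of the family `w` in strictly decreasing order, if there is one. -/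
def decEnum {A : Type*} [Inhabited A] (w : A → ℝ) : ℕ → A :=
  if h : ∃ e, IsDecEnum w e then h.choose else fun _ => default

/-- The overlap matrix of the points of the family `w`, taken in decreasing order. -/
def orderedOverlap {k : ℕ} (q : ℕ → unitInterval) (w : (Fin k → ℕ) → ℝ) (i j : ℕ) :
    unitInterval :=
  overlap q (decEnum w i) (decEnum w j)

/-- The field at the points of the family `w`, taken in decreasing order of `w`.
For `w = ξ` this is `i ↦ κ_i`, for `w` the shifted weights it is `i ↦ κ̃_i`. -/
def orderedField {Ω : Type*} {k : ℕ} (κ : (Fin k → ℕ) → unitInterval → Ω → ℝ)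
    (w : (Fin k → ℕ) → ℝ) (ω : Ω) (i : ℕ) (r : unitInterval) : ℝ :=
  κ (decEnum w i) r ω

/-! ### The density -/

/-- The factor `V = e^{x_l ψ_{q_{l+1}}(p(q_{l+1}))} / e^{x_l ψ_{q_l}(p(q_l))}` of a path `p`. -/
def factorV (k : ℕ) (x : ℕ → ℝ) (q : ℕ → unitInterval) (g ψ : ℝ → ℝ) (l : ℕ)
    (p : unitInterval → ℝ) : ℝ :=
  Real.exp (x l * psiLevel k x q g ψ (l + 1) (p (q (l + 1)))) /
    Real.exp (x l * psiLevel k x q g ψ l (p (q l)))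

/-- `∏_{l=0}^k ∏_{classes of ∼_l on the first n points} V`, the relations `∼_l` being
those of the overlap matrix `M`, as a function of the paths of the first `n` points.
Each class contributes the factor of one representative. -/
def density (k : ℕ) (x : ℕ → ℝ) (q : ℕ → unitInterval) (g ψ : ℝ → ℝ) (n : ℕ)
    (M : ℕ → ℕ → unitInterval) (p : Fin n → unitInterval → ℝ) : ℝ :=
  ∏ l ∈ Finset.range (k + 1),
    ∏ᶠ c : Quot (fun i j : Fin n => levelRel q M l i j), factorV k x q g ψ l (p (Quot.out c))

end GREM

end

/-! Everything rests on the scaling of the intensity `x s^(-x-1) ds`: multiplication of the points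
by `a` multiplies it by `a^x` (`map_mul_remIntensity`). Hence, if the points of a REM carry
independent marks with law `ν` and each point is multiplied by a function `W > 0` of its mark with
`∫ W^x dν = 1`, the result is a Poisson process with intensity `x s^(-x-1) ds ⊗ W^x ν`. In
decreasing order this is a REM with the same law, independent of its marks, which are now i.i.d.
with the tilted law `W^x ν` (`map_sortMarks`).

The shift is brought to this form level by level. The field is a branching Markov chain on the tree
(`IsGREMWithField.map_field`), and `e^{ψ(κ_α(1))}` telescopes into `e^{ψ_{q_1}(κ_α(q_1))}` times one
factor for each depth (`prod_shiftWt`). The recursion defining `ψ_{q_l}` says precisely that the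
factor at depth `l`, raised to the power `x_{l+1}`, is a probability density for the step of the
chain at that depth (`IsGREMWithField.tiltData`). Induction on the depth, which reorders the
subtrees before the process at the root, shows that the shifted cascade is, up to a tree
automorphism and a common factor, a cascade with the original law together with an independent field
that follows the tilted chain (`exists_reorder`, `IsGREMWithField.exists_shift`). Automorphisms
preserve overlaps and the common factor preserves the order. Therefore the overlap matrix keeps its
law, and the shifted field is the tilted field read at the sorted leaves of an independent cascade.

The law of either field at finitely many leaves depends only on their overlaps, so the conditional
law given the overlap matrix is the law at any leaves realizing it (`overlapKernel`). The density of
the tilted field with respect to the original one contains one factor for each depth and each class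
of leaves sharing that step (`lintegral_treeLaw_tilt`, `ofReal_density`). The cascade with its
divided weights is independent of the tilted field, so these weights add nothing to the
conditioning.

For the normalized weights, condition on all levels but the last. The leaf weights form a
superposition of scaled REMs whose intensity is a product. Once sorted they are a constant multiple
of a REM, independent of the parents of the leaves, which are i.i.d. (`map_sorted_lastWt`).
Normalization removes the constant, and the overlaps are a function of the parents alone; this gives
`indepFun_overlap_normWt`.

Laws of point processes are handled through the functional `PoissonFun`, which is stable under maps,
independent marks and superposition. Its void probabilities determine the law of a strictly
decreasing marked sequence (`ext_of_voidSet`). -/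

namespace GREM

/-! ### Poisson functionals -/

section PoissonFunctional

variable {A X Ω : Type*}

/-- The infinite product of a family with values in `[0,1]`. -/
noncomputable def infProd (f : A → ℝ≥0∞) : ℝ≥0∞ := ⨅ F : Finset A, ∏ a ∈ F, f a

/-- The function `a ↦ e ^ (-a)` on `[0,∞]`. -/
noncomputable def expNeg (a : ℝ≥0∞) : ℝ≥0∞ := EReal.exp (-(a : EReal))

@[simp] lemma expNeg_zero : expNeg 0 = 1 := by simp [expNeg]

@[simp] lemma expNeg_top : expNeg ∞ = 0 := by simp [expNeg]

lemma expNeg_ofReal {r : ℝ} (hr : 0 ≤ r) :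
    expNeg (ENNReal.ofReal r) = ENNReal.ofReal (Real.exp (-r)) := by
  rw [expNeg, EReal.coe_ennreal_ofReal, max_eq_left hr, ← EReal.coe_neg, EReal.exp_coe]

lemma expNeg_add (a b : ℝ≥0∞) : expNeg (a + b) = expNeg a * expNeg b := by
  induction a with
  | top => simp
  | coe a =>
    induction b with
    | top => simp
    | coe b =>
      rw [← ENNReal.ofReal_coe_nnreal, ← ENNReal.ofReal_coe_nnreal, ← ENNReal.ofReal_add
        (by positivity) (by positivity), expNeg_ofReal (by positivity),
        expNeg_ofReal (by positivity), expNeg_ofReal (by positivity),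
        ← ENNReal.ofReal_mul (by positivity), ← Real.exp_add]
      congr 2; ring

lemma antitone_expNeg : Antitone expNeg := fun a b h => by
  rw [expNeg, expNeg, EReal.exp_le_exp_iff, EReal.neg_le_neg_iff]
  exact_mod_cast h

lemma expNeg_le_one (a : ℝ≥0∞) : expNeg a ≤ 1 := by
  simpa using antitone_expNeg (zero_le (a := a))

lemma continuous_expNeg : Continuous expNeg :=
  ENNReal.continuous_exp.comp (continuous_neg.comp continuous_coe_ennreal_ereal)

lemma expNeg_iSup {ι : Type*} [Nonempty ι] (f : ι → ℝ≥0∞) :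
    expNeg (⨆ i, f i) = ⨅ i, expNeg (f i) :=
  Antitone.map_ciSup_of_continuousAt continuous_expNeg.continuousAt antitone_expNeg
    (OrderTop.bddAbove _)

lemma expNeg_sum (F : Finset A) (f : A → ℝ≥0∞) :
    expNeg (∑ a ∈ F, f a) = ∏ a ∈ F, expNeg (f a) := by
  classical
  induction F using Finset.induction with
  | empty => simp
  | insert a F ha ih => rw [Finset.sum_insert ha, Finset.prod_insert ha, expNeg_add, ih]

lemma expNeg_tsum (f : A → ℝ≥0∞) : expNeg (∑' a, f a) = infProd fun a => expNeg (f a) := by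
  rw [ENNReal.tsum_eq_iSup_sum, expNeg_iSup]
  simp_rw [expNeg_sum]; rfl

lemma expNeg_tendsto_one {ι : Type*} {l : Filter ι} {f : ι → ℝ≥0∞}
    (h : Filter.Tendsto f l (nhds 0)) : Filter.Tendsto (fun i => expNeg (f i)) l (nhds 1) := by
  have := (continuous_expNeg.tendsto 0).comp h
  rwa [expNeg_zero] at this

lemma infProd_le_one (f : A → ℝ≥0∞) : infProd f ≤ 1 :=
  (iInf_le _ (∅ : Finset A)).trans_eq Finset.prod_empty

lemma infProd_le (f : A → ℝ≥0∞) (F : Finset A) : infProd f ≤ ∏ a ∈ F, f a := iInf_le _ F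

lemma infProd_congr_of_support {f : A → ℝ≥0∞} (hf : ∀ a, f a ≤ 1) {F : Finset A}
    (hF : ∀ a, a ∉ F → f a = 1) : infProd f = ∏ a ∈ F, f a := by
  classical
  refine le_antisymm (infProd_le f F) (le_iInf fun G => ?_)
  calc ∏ a ∈ F, f a = ∏ a ∈ F ∪ G, f a :=
        Finset.prod_subset Finset.subset_union_left fun a _ ha => hF a ha
    _ ≤ ∏ a ∈ G, f a := Finset.prod_anti_set_of_le_one' hf Finset.subset_union_right

lemma infProd_mono {f g : A → ℝ≥0∞} (h : ∀ a, f a ≤ g a) : infProd f ≤ infProd g :=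
  iInf_mono fun _ => Finset.prod_le_prod' fun a _ => h a

lemma directed_prod {f : A → Ω → ℝ≥0∞} (hf : ∀ a ω, f a ω ≤ 1) :
    Directed (· ≥ ·) fun (F : Finset A) (ω : Ω) => ∏ a ∈ F, f a ω := by
  classical
  exact fun F G => ⟨F ∪ G,
    fun ω => Finset.prod_anti_set_of_le_one' (fun a => hf a ω) Finset.subset_union_left,
    fun ω => Finset.prod_anti_set_of_le_one' (fun a => hf a ω) Finset.subset_union_right⟩

variable [MeasurableSpace X] [MeasurableSpace Ω]

lemma measurable_infProd [Countable A] {f : A → Ω → ℝ≥0∞} (hf : ∀ a, Measurable (f a)) :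
    Measurable fun ω => infProd fun a => f a ω :=
  .iInf fun F => Finset.measurable_fun_prod F fun a _ => hf a

lemma lintegral_infProd [Countable A] {m : Measure Ω} [IsProbabilityMeasure m]
    {f : A → Ω → ℝ≥0∞} (hf : ∀ a, Measurable (f a)) (hle : ∀ a ω, f a ω ≤ 1) :
    ∫⁻ ω, infProd (fun a => f a ω) ∂m = ⨅ F : Finset A, ∫⁻ ω, ∏ a ∈ F, f a ω ∂m := by
  refine lintegral_iInf_directed_of_measurable (IsProbabilityMeasure.ne_zero m)
    (fun F => Finset.measurable_fun_prod F fun a _ => hf a) (fun F => ?_) (directed_prod hle)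
  refine ne_top_of_le_ne_top ENNReal.one_ne_top ?_
  calc ∫⁻ ω, ∏ a ∈ F, f a ω ∂m ≤ ∫⁻ _, 1 ∂m :=
        lintegral_mono fun ω => Finset.prod_le_one' fun a _ => hle a ω
    _ = 1 := by simp

/-- An infinite product of independent factors. -/
lemma lintegral_infProd_infinitePi [Countable A] {Y : A → Type*} [∀ a, MeasurableSpace (Y a)]
    (ν : ∀ a, Measure (Y a)) [∀ a, IsProbabilityMeasure (ν a)] {f : ∀ a, Y a → ℝ≥0∞}
    (hf : ∀ a, Measurable (f a)) (hle : ∀ a y, f a y ≤ 1) :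
    ∫⁻ y, infProd (fun a => f a (y a)) ∂(Measure.infinitePi ν) =
      infProd fun a => ∫⁻ y, f a y ∂(ν a) := by
  have hf' : ∀ a, Measurable fun y : ∀ a, Y a => f a (y a) := fun a =>
    (hf a).comp (measurable_pi_apply a)
  rw [lintegral_infProd hf' (fun a ω => hle a _)]
  refine iInf_congr fun F => ?_
  refine (lintegral_prod_eq_prod_lintegral_of_indepFun F (fun a (y : ∀ a, Y a) => f a (y a))
    (iIndepFun_infinitePi hf) hf').trans ?_
  refine Finset.prod_congr rfl fun a _ => ?_
  rw [← lintegral_map (hf a) (measurable_pi_apply a), Measure.infinitePi_map_eval]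

/-- The points `z a` form a Poisson process with intensity `Λ`, expressed by the multiplicative
functional `E ∏ H(z a) = exp (-∫ (1 - H) dΛ)`. -/
def PoissonFun (m : Measure Ω) (z : A → Ω → X) (Λ : Measure X) : Prop :=
  ∀ H : X → ℝ≥0∞, Measurable H → (∀ p, H p ≤ 1) →
    ∫⁻ ω, infProd (fun a => H (z a ω)) ∂m = expNeg (∫⁻ p, (1 - H p) ∂Λ)

lemma PoissonFun.map {Y : Type*} [MeasurableSpace Y] {m : Measure Ω} {z : A → Ω → X}
    {Λ : Measure X} (h : PoissonFun m z Λ) {T : X → Y} (hT : Measurable T) :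
    PoissonFun m (fun a ω => T (z a ω)) (Λ.map T) := fun H hH hle => by
  rw [lintegral_map (hH.const_sub 1) hT]
  exact h (H ∘ T) (hH.comp hT) fun p => hle _

/-- Independent marks. -/
lemma PoissonFun.mark {D : Type*} [MeasurableSpace D] [Countable A] {m : Measure Ω}
    [IsProbabilityMeasure m] {z : A → Ω → X} (hz : ∀ a, Measurable (z a)) {Λ : Measure X}
    [SFinite Λ] (h : PoissonFun m z Λ) (ν : Measure D) [IsProbabilityMeasure ν] :
    PoissonFun (m.prod (Measure.infinitePi fun _ : A => ν))
      (fun a p => (z a p.1, p.2 a)) (Λ.prod ν) := fun H hH hle => by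
  have hm : Measurable fun p : Ω × (A → D) => infProd fun a => H (z a p.1, p.2 a) :=
    measurable_infProd fun a => hH.comp (((hz a).comp measurable_fst).prodMk
      ((measurable_pi_apply a).comp measurable_snd))
  rw [lintegral_prod _ hm.aemeasurable]
  have h1 : ∀ ω, ∫⁻ y, infProd (fun a => H (z a ω, y a)) ∂(Measure.infinitePi fun _ : A => ν) =
      infProd fun a => ∫⁻ y, H (z a ω, y) ∂ν := fun ω =>
    lintegral_infProd_infinitePi (fun _ => ν) (f := fun a y => H (z a ω, y))
      (fun a => hH.comp measurable_prodMk_left) fun a y => hle _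
  simp_rw [h1]
  have hle' : ∀ p, ∫⁻ y, H (p, y) ∂ν ≤ 1 := fun p =>
    (lintegral_mono fun y => hle (p, y)).trans (by simp)
  rw [h (fun p => ∫⁻ y, H (p, y) ∂ν) hH.lintegral_prod_right' hle',
    lintegral_prod _ (hH.const_sub 1).aemeasurable]
  congr 1
  refine lintegral_congr fun p => ?_
  have hHp : Measurable fun y => H (p, y) := hH.comp measurable_prodMk_left
  rw [lintegral_sub hHp
    (ne_top_of_le_ne_top ENNReal.one_ne_top (hle' p)) (Filter.Eventually.of_forall fun y => hle _)]
  simp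

/-- With factors at most `1`, partial products decrease along finite sets. A finite product of
infima is thus the infimum of the products, by uniqueness of limits in `[0,1]`, and finite
rectangles are cofinal among the finite subsets of `A × B`. -/
lemma infProd_prod {B : Type*} {f : A × B → ℝ≥0∞} (hf : ∀ p, f p ≤ 1) :
    infProd f = infProd fun a => infProd fun b => f (a, b) := by
  have h : ∀ g : A → B → ℝ≥0∞, (∀ a b, g a b ≤ 1) → ∀ F : Finset A,
      ∏ a ∈ F, infProd (g a) = ⨅ G : Finset B, ∏ a ∈ F, ∏ b ∈ G, g a b := fun g hg F => by
    classical
    induction F using Finset.induction with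
    | empty => simp
    | insert a F ha ih =>
      have anti : ∀ a, Antitone fun G : Finset B => ∏ b ∈ G, g a b := fun a =>
        Finset.prod_anti_set_of_le_one' (hg a)
      have anti' : Antitone fun G : Finset B => ∏ a ∈ F, ∏ b ∈ G, g a b := fun G G' h =>
        Finset.prod_le_prod' fun a _ => anti a h
      simp_rw [Finset.prod_insert ha]
      rw [ih, infProd]
      have hne : ∀ a, (⨅ G : Finset B, ∏ b ∈ G, g a b) ≠ ∞ := fun a =>
        ne_top_of_le_ne_top ENNReal.one_ne_top (infProd_le_one (g a))
      have hne' : (⨅ G : Finset B, ∏ a ∈ F, ∏ b ∈ G, g a b) ≠ ∞ :=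
        ne_top_of_le_ne_top ENNReal.one_ne_top ((iInf_le _ ∅).trans (by simp))
      exact tendsto_nhds_unique (ENNReal.Tendsto.mul (tendsto_atTop_iInf (anti a)) (Or.inr hne')
        (tendsto_atTop_iInf anti') (Or.inr (hne a)))
        (tendsto_atTop_iInf ((anti a).mul' anti'))
  rw [infProd, infProd]
  simp_rw [h (fun a b => f (a, b)) fun a b => hf _]
  classical
  refine le_antisymm (le_iInf₂ fun F G => ?_) (le_iInf fun F => ?_)
  · exact (iInf_le _ (F ×ˢ G)).trans_eq (Finset.prod_product _ _ _)
  · refine (iInf₂_le (F.image Prod.fst) (F.image Prod.snd)).trans ?_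
    rw [← Finset.prod_product]
    exact Finset.prod_anti_set_of_le_one' hf fun p hp => Finset.mem_product.2
      ⟨Finset.mem_image_of_mem _ hp, Finset.mem_image_of_mem _ hp⟩

/-- Superposition of independent processes. -/
lemma PoissonFun.superpose [Countable A] {B : Type*} [Countable B] {Y : A → Type*}
    [∀ a, MeasurableSpace (Y a)] (ν : ∀ a, Measure (Y a)) [∀ a, IsProbabilityMeasure (ν a)]
    {z : ∀ a, B → Y a → X} (hz : ∀ a b, Measurable (z a b)) {Λ : A → Measure X}
    (h : ∀ a, PoissonFun (ν a) (z a) (Λ a)) :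
    PoissonFun (Measure.infinitePi ν) (fun (p : A × B) y => z p.1 p.2 (y p.1))
      (Measure.sum Λ) := fun H hH hle => by
  have h1 : ∀ y : ∀ a, Y a, infProd (fun p : A × B => H (z p.1 p.2 (y p.1))) =
      infProd fun a => infProd fun b => H (z a b (y a)) := fun y => infProd_prod fun p => hle _
  simp_rw [h1]
  rw [lintegral_infProd_infinitePi ν (f := fun a y => infProd fun b => H (z a b y))
    (fun a => measurable_infProd fun b => hH.comp (hz a b)) fun a y => infProd_le_one _,
    lintegral_sum_measure, expNeg_tsum]
  congr 1
  funext a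
  exact h a H hH hle

end PoissonFunctional
end GREM

namespace GREM

/-! ### The intensity of a REM -/

section Intensity

lemma remIntensity_Iic_zero (x : ℝ) : remIntensity x (Iic 0) = 0 := by
  rw [remIntensity]
  refine withDensity_absolutelyContinuous _ _ ?_
  rw [Measure.restrict_apply measurableSet_Iic]
  simp [Iic_inter_Ioi]

lemma remIntensity_Ioi {x : ℝ} (hx : 0 < x) {t : ℝ} (ht : 0 < t) :
    remIntensity x (Ioi t) = ENNReal.ofReal (t ^ (-x)) := by
  rw [remIntensity, withDensity_apply _ measurableSet_Ioi, Measure.restrict_restrict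
    measurableSet_Ioi, inter_eq_left.2 (Ioi_subset_Ioi ht.le), ← ofReal_integral_eq_lintegral_ofReal]
  · rw [integral_const_mul, integral_Ioi_rpow_of_lt (by linarith) ht]
    congr 1
    rw [show -x - 1 + 1 = -x by ring]
    field_simp
  · exact (integrableOn_Ioi_rpow_of_lt (by linarith) ht).const_mul x
  · filter_upwards [self_mem_ae_restrict measurableSet_Ioi] with s hs
    have : 0 < s := ht.trans hs
    positivity

instance sfinite_remIntensity (x : ℝ) : SFinite (remIntensity x) := by
  unfold remIntensity; infer_instance

/-- The scaling property behind every tilt in the proof: the factor `a^x` here becomes the density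
`W^x` of the marks, and later the factors of the Radon–Nikodym derivative. -/
lemma map_mul_remIntensity (x : ℝ) {a : ℝ} (ha : 0 < a) :
    (remIntensity x).map (a * ·) = ENNReal.ofReal (a ^ x) • remIntensity x := by
  have hm : Measurable fun s : ℝ => ENNReal.ofReal (x * s ^ (-x - 1)) := by fun_prop
  refine Measure.ext_of_lintegral _ fun f hf => ?_
  have key : ∀ f : ℝ → ℝ≥0∞, Measurable f → ∫⁻ s, f s ∂(remIntensity x) =
      ∫⁻ s, (Ioi 0).indicator (fun s => ENNReal.ofReal (x * s ^ (-x - 1)) * f s) s := fun f hf => by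
    rw [remIntensity, lintegral_withDensity_eq_lintegral_mul _ hm hf,
      lintegral_indicator measurableSet_Ioi]; rfl
  rw [lintegral_map hf (measurable_const_mul a), lintegral_smul_measure,
    key (fun s => f (a * s)) (hf.comp (measurable_const_mul a)), key f hf]
  have h1 : ∀ s, (Ioi 0).indicator (fun s => ENNReal.ofReal (x * s ^ (-x - 1)) * f (a * s)) s =
      ENNReal.ofReal (a ^ (x + 1)) *
        (Ioi 0).indicator (fun s => ENNReal.ofReal (x * s ^ (-x - 1)) * f s) (a * s) := fun s => by
    by_cases hs : 0 < s
    · rw [indicator_of_mem (mem_Ioi.2 hs), indicator_of_mem (mem_Ioi.2 (mul_pos ha hs)),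
        ← mul_assoc, ← ENNReal.ofReal_mul (by positivity), Real.mul_rpow ha.le hs.le]
      congr 2
      have : a ^ (x + 1) * a ^ (-x - 1) = 1 := by rw [← Real.rpow_add ha]; simp
      linear_combination (-x * s ^ (-x - 1)) * this
    · rw [indicator_of_notMem (by simpa using hs), indicator_of_notMem, mul_zero]
      simpa using mul_nonpos_of_nonneg_of_nonpos ha.le (not_lt.1 hs)
  have hF : Measurable ((Ioi (0 : ℝ)).indicator
      (fun s => ENNReal.ofReal (x * s ^ (-x - 1)) * f s)) :=
    (hm.mul hf).indicator measurableSet_Ioi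
  simp_rw [h1]
  have hFa : Measurable fun s => (Ioi (0 : ℝ)).indicator
      (fun s => ENNReal.ofReal (x * s ^ (-x - 1)) * f s) (a * s) :=
    hF.comp (measurable_const_mul a)
  rw [lintegral_const_mul _ hFa,
    ← lintegral_map hF (measurable_const_mul a), Real.map_volume_mul_left ha.ne',
    lintegral_smul_measure, smul_eq_mul, smul_eq_mul, ← mul_assoc,
    ← ENNReal.ofReal_mul (by positivity)]
  congr 2
  rw [abs_of_pos (inv_pos.2 ha), Real.rpow_add ha, Real.rpow_one]
  field_simp

end Intensity

/-! ### The points of a REM -/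

section REM

lemma pointCount_eq_coe {Ω : Type*} {ζ : ℕ → Ω → ℝ} {A : Set ℝ} {ω : Ω} {n : ℕ} :
    pointCount ζ A ω = n ↔ ∃ F : Finset ℕ, F.card = n ∧ ∀ j, j ∈ F ↔ ζ j ω ∈ A := by
  constructor
  · intro h
    have hf : {j | ζ j ω ∈ A}.Finite := finite_of_encard_eq_coe h
    refine ⟨hf.toFinset, ?_, fun j => by simp⟩
    rw [pointCount, hf.encard_eq_coe_toFinset_card] at h
    exact_mod_cast h
  · rintro ⟨F, hF, h⟩
    have : {j | ζ j ω ∈ A} = F := by ext j; simp [h]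
    rw [pointCount, this, encard_coe_eq_coe_finsetCard, hF]

variable {Ω : Type*} [MeasurableSpace Ω] {P : Measure Ω}

lemma measurableSet_pointCount_eq {ζ : ℕ → Ω → ℝ} (hζ : ∀ j, Measurable (ζ j)) {A : Set ℝ}
    (hA : MeasurableSet A) (n : ℕ) : MeasurableSet {ω | pointCount ζ A ω = n} := by
  simp_rw [pointCount_eq_coe]
  have : {ω | ∃ F : Finset ℕ, F.card = n ∧ ∀ j, j ∈ F ↔ ζ j ω ∈ A} =
      ⋃ F : Finset ℕ, ⋃ _ : F.card = n, ⋂ j, {ω | j ∈ F ↔ ζ j ω ∈ A} := by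
    ext; simp
  rw [this]
  refine .iUnion fun F => .iUnion fun _ => .iInter fun j => ?_
  exact MeasurableSet.iff (.const _) (hζ j hA)

lemma measurable_pointCount {ζ : ℕ → Ω → ℝ} (hζ : ∀ j, Measurable (ζ j)) {A : Set ℝ}
    (hA : MeasurableSet A) : Measurable (pointCount ζ A) := by
  refine measurable_to_countable' fun n => ?_
  induction n with
  | top =>
    have : pointCount ζ A ⁻¹' {⊤} = (⋃ n : ℕ, {ω | pointCount ζ A ω = n})ᶜ := by
      ext ω
      simp only [mem_preimage, mem_singleton_iff, mem_compl_iff, mem_iUnion, mem_ofPred_eq]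
      generalize pointCount ζ A ω = a
      constructor
      · rintro rfl ⟨n, hn⟩; exact ENat.top_ne_natCast n hn
      · intro h
        by_contra hc
        obtain ⟨n, hn⟩ := ENat.ne_top_iff_exists.1 hc
        exact h ⟨n, hn.symm⟩
    rw [this]
    exact (MeasurableSet.iUnion fun n => measurableSet_pointCount_eq hζ hA n).compl
  | coe n => exact measurableSet_pointCount_eq hζ hA n

/-- The probability generating function: `t^n` times the Poisson(`r`) mass at `n` is `e^{-r(1-t)}`
times the Poisson(`rt`) mass at `n`, and the latter masses sum to `1`. -/
lemma tsum_pow_mul_poissonMeasure (r : ℝ≥0) {t : ℝ≥0∞} (ht : t ≤ 1) :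
    ∑' n : ℕ, t ^ n * poissonMeasure r {n} = expNeg (r * (1 - t)) := by
  lift t to ℝ≥0 using ne_top_of_le_ne_top ENNReal.one_ne_top ht
  have ht' : t ≤ 1 := by exact_mod_cast ht
  have hs := (hasSum_one_poissonMeasure (r * t)).mul_left (Real.exp (-(r * (1 - t))))
  have h1 : ∀ n : ℕ, (t : ℝ≥0∞) ^ n * poissonMeasure r {n} = ENNReal.ofReal
      (Real.exp (-(r * (1 - t))) * (Real.exp (-(r * t : ℝ≥0)) * (r * t : ℝ≥0) ^ n / n.factorial)) :=
    fun n => by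
    rw [poissonMeasure_singleton, ← ENNReal.ofReal_coe_nnreal, ← ENNReal.ofReal_pow (by positivity),
      ← ENNReal.ofReal_mul (by positivity)]
    congr 1
    have : Real.exp (-r) = Real.exp (-(r * (1 - t))) * Real.exp (-(r * t)) := by
      rw [← Real.exp_add]; congr 1; ring
    rw [this]; push_cast; ring
  simp_rw [h1]
  rw [← ENNReal.ofReal_tsum_of_nonneg (fun n => by positivity) hs.summable, hs.tsum_eq, mul_one,
    ← expNeg_ofReal (r := (r : ℝ) * (1 - t))
      (mul_nonneg r.2 (sub_nonneg.2 (by exact_mod_cast ht')))]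
  congr 1
  rw [ENNReal.ofReal_mul r.coe_nonneg, ENNReal.ofReal_sub _ t.coe_nonneg]
  simp

variable {x : ℝ} {ζ : ℕ → Ω → ℝ}

lemma IsREM.ae_pointCount_ne_top [IsProbabilityMeasure P] (h : IsREM P x ζ) {A : Set ℝ}
    (hA : MeasurableSet A) (hfin : remIntensity x A ≠ ∞) : ∀ᵐ ω ∂P, pointCount ζ A ω ≠ ⊤ := by
  have h1 : P (⋃ n : ℕ, {ω | pointCount ζ A ω = n}) = 1 := by
    rw [measure_iUnion]
    · simp_rw [h.poisson A hA hfin]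
      have := tsum_pow_mul_poissonMeasure (remIntensity x A).toNNReal le_rfl
      simpa using this
    · intro a b hab
      refine disjoint_left.2 fun ω ha hb => hab ?_
      have : (a : ℕ∞) = b := by rw [← show pointCount ζ A ω = a from ha]; exact hb
      exact_mod_cast this
    · exact fun n => measurableSet_pointCount_eq h.measurable hA n
  have h2 := (mem_ae_iff_prob_eq_one (MeasurableSet.iUnion fun n =>
    measurableSet_pointCount_eq h.measurable hA n)).2 h1
  filter_upwards [h2] with ω hω
  obtain ⟨n, hn⟩ := mem_iUnion.1 hω
  rw [show pointCount ζ A ω = n from hn]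
  exact ENat.natCast_ne_top n

lemma IsREM.lintegral_pow_pointCount [IsProbabilityMeasure P] (h : IsREM P x ζ) {A : Set ℝ}
    (hA : MeasurableSet A) (hfin : remIntensity x A ≠ ∞) {t : ℝ≥0∞} (ht : t ≤ 1) :
    ∫⁻ ω, t ^ (pointCount ζ A ω).toNat ∂P = expNeg (remIntensity x A * (1 - t)) := by
  have hU : ∀ᵐ ω ∂P, ω ∈ ⋃ n : ℕ, {ω | pointCount ζ A ω = n} := by
    filter_upwards [h.ae_pointCount_ne_top hA hfin] with ω hω
    obtain ⟨n, hn⟩ := ENat.ne_top_iff_exists.1 hω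
    exact mem_iUnion.2 ⟨n, hn.symm⟩
  rw [← Measure.restrict_eq_self_of_ae_mem hU, lintegral_iUnion
    (fun n => measurableSet_pointCount_eq h.measurable hA n)]
  · rw [← ENNReal.coe_toNNReal hfin, ← tsum_pow_mul_poissonMeasure _ ht]
    congr 1
    funext n
    rw [← h.poisson A hA hfin n, ← setLIntegral_const]
    refine setLIntegral_congr_fun (measurableSet_pointCount_eq h.measurable hA n) fun ω hω => ?_
    rw [show pointCount ζ A ω = n from hω]; simp
  · intro a b hab
    refine disjoint_left.2 fun ω ha hb => hab ?_
    have : (a : ℕ∞) = b := by rw [← show pointCount ζ A ω = a from ha]; exact hb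
    exact_mod_cast this

/-- Grouping the points by the value `c` of `f` turns the product into `∏ (1 - c)^{N_c}`, where the
counts `N_c` of disjoint sets are independent Poisson variables. The value `0` only contributes
factors `1`, and the other fibres have finite intensity. -/
lemma IsREM.lintegral_infProd_simpleFunc [IsProbabilityMeasure P] (h : IsREM P x ζ)
    (f : SimpleFunc ℝ ℝ≥0∞) (hf : ∀ s, f s ≤ 1) (hfin : remIntensity x {s | f s ≠ 0} ≠ ∞) :
    ∫⁻ ω, infProd (fun j => 1 - f (ζ j ω)) ∂P = expNeg (∫⁻ s, f s ∂(remIntensity x)) := by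
  classical
  set C := f.range.filter (· ≠ 0) with hC
  have hA : ∀ c, MeasurableSet (f ⁻¹' {c}) := fun c => f.measurableSet_fiber c
  have hAfin : ∀ c ∈ C, remIntensity x (f ⁻¹' {c}) ≠ ∞ := fun c hc =>
    ne_top_of_le_ne_top hfin (measure_mono fun s hs => by
      simp only [mem_preimage, mem_singleton_iff] at hs
      simp only [mem_ofPred_eq, hs]; exact (Finset.mem_filter.1 hc).2)
  have hle : ∀ c ∈ C, c ≤ 1 := fun c hc => by
    obtain ⟨s, rfl⟩ := SimpleFunc.mem_range.1 (Finset.mem_filter.1 hc).1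
    exact hf s
  have hpath : ∀ᵐ ω ∂P, infProd (fun j => 1 - f (ζ j ω)) =
      ∏ c ∈ C, (1 - c) ^ (pointCount ζ (f ⁻¹' {c}) ω).toNat := by
    have : ∀ᵐ ω ∂P, ∀ c ∈ C, pointCount ζ (f ⁻¹' {c}) ω ≠ ⊤ :=
      (ae_ball_iff C.countable_toSet).2 fun c hc => h.ae_pointCount_ne_top (hA c) (hAfin c hc)
    filter_upwards [this] with ω hω
    have hfinite : ∀ c ∈ C, {j | f (ζ j ω) = c}.Finite := fun c hc =>
      encard_ne_top_iff.1 (hω c hc)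
    have hF : {j | f (ζ j ω) ≠ 0}.Finite := by
      refine (C.finite_toSet.biUnion hfinite).subset fun j hj => ?_
      exact mem_biUnion (Finset.mem_coe.2 (Finset.mem_filter.2
        ⟨SimpleFunc.mem_range_self f _, hj⟩)) rfl
    rw [infProd_congr_of_support (F := hF.toFinset) (fun j => tsub_le_self) fun j hj => by
      simp only [Finite.mem_toFinset, mem_ofPred_eq, not_not] at hj; simp [hj]]
    rw [← Finset.prod_fiberwise_of_maps_to (t := C) (g := fun j => f (ζ j ω)) fun j hj =>
      Finset.mem_filter.2 ⟨SimpleFunc.mem_range_self f _, by simpa using hj⟩]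
    refine Finset.prod_congr rfl fun c hc => ?_
    rw [Finset.prod_congr rfl (g := fun _ => 1 - c) fun j hj => by
      rw [(Finset.mem_filter.1 hj).2], Finset.prod_const]
    congr 1
    have : {j | ζ j ω ∈ f ⁻¹' {c}} = (hF.toFinset.filter fun j => f (ζ j ω) = c) := by
      ext j
      simp only [mem_preimage, mem_singleton_iff, mem_ofPred_eq, Finset.coe_filter,
        Finite.mem_toFinset]
      exact ⟨fun hj => ⟨by rw [hj]; exact (Finset.mem_filter.1 hc).2, hj⟩, fun hj => hj.2⟩
    rw [pointCount, this, encard_coe_eq_coe_finsetCard]; simp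
  rw [lintegral_congr_ae hpath]
  let e : Fin C.card ≃ C := C.equivFin.symm
  have hind := h.indep C.card (fun i => f ⁻¹' {(e i : ℝ≥0∞)}) (fun i => hA _) fun i j hij =>
    disjoint_left.2 fun s hs hs' => hij (e.injective (Subtype.ext (by
      simp only [mem_preimage, mem_singleton_iff] at hs hs'; rw [← hs, hs'])))
  have hind' := hind.comp (fun i (n : ℕ∞) => (1 - (e i : ℝ≥0∞)) ^ n.toNat)
    fun i => measurable_from_top
  have hprod : ∀ (u : ℝ≥0∞ → ℝ≥0∞), ∏ c ∈ C, u c = ∏ i, u (e i) := fun u => by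
    rw [← Finset.prod_coe_sort C u]
    exact (Fintype.prod_equiv e _ _ fun i => rfl).symm
  simp_rw [fun ω => hprod fun c => (1 - c) ^ (pointCount ζ (f ⁻¹' {c}) ω).toNat]
  refine (lintegral_prod_eq_prod_lintegral_of_indepFun Finset.univ _ hind' fun i =>
    measurable_from_top.comp (measurable_pointCount h.measurable (hA _))).trans ?_
  have : ∀ i, ∫⁻ ω, ((fun n : ℕ∞ => (1 - (e i : ℝ≥0∞)) ^ n.toNat) ∘
      pointCount ζ (f ⁻¹' {(e i : ℝ≥0∞)})) ω ∂P =
        expNeg (remIntensity x (f ⁻¹' {(e i : ℝ≥0∞)}) * e i) := fun i => by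
    rw [← ENNReal.sub_sub_cancel ENNReal.one_ne_top (hle _ (e i).2),
      ← h.lintegral_pow_pointCount (hA _) ?_ tsub_le_self]
    · rw [ENNReal.sub_sub_cancel ENNReal.one_ne_top (hle _ (e i).2)]; rfl
    · rw [ENNReal.sub_sub_cancel ENNReal.one_ne_top (hle _ (e i).2)]; exact hAfin _ (e i).2
  rw [Finset.prod_congr rfl fun i _ => this i, ← expNeg_sum]
  congr 1
  have := Fintype.sum_equiv e (fun i => remIntensity x (f ⁻¹' {(e i : ℝ≥0∞)}) * e i)
    (fun c => remIntensity x (f ⁻¹' {(c : ℝ≥0∞)}) * c) fun i => rfl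
  rw [this, Finset.sum_coe_sort C (fun c => remIntensity x (f ⁻¹' {(c : ℝ≥0∞)}) * c),
    SimpleFunc.lintegral_eq_lintegral, SimpleFunc.lintegral, hC, Finset.sum_filter]
  refine Finset.sum_congr rfl fun c _ => ?_
  by_cases hc : c = 0 <;> simp [hc, mul_comm]

lemma tendsto_finset_prod_of_le_one {A : Type*} (F : Finset A) {u : A → ℕ → ℝ≥0∞} {v : A → ℝ≥0∞}
    (hv : ∀ a, v a ≤ 1) (h : ∀ a, Filter.Tendsto (u a) Filter.atTop (nhds (v a))) :
    Filter.Tendsto (fun n => ∏ a ∈ F, u a n) Filter.atTop (nhds (∏ a ∈ F, v a)) := by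
  classical
  induction F using Finset.induction with
  | empty => simp
  | insert a F ha ih =>
    simp_rw [Finset.prod_insert ha]
    exact ENNReal.Tendsto.mul (h a) (Or.inr (ne_top_of_le_ne_top ENNReal.one_ne_top
      (Finset.prod_le_one' fun a _ => hv a))) ih
      (Or.inr (ne_top_of_le_ne_top ENNReal.one_ne_top (hv a)))

lemma iInf_infProd {A : Type*} {u : ℕ → A → ℝ≥0∞} (hu : ∀ n a, u n a ≤ 1) (ha : Antitone u) :
    ⨅ n, infProd (u n) = infProd fun a => ⨅ n, u n a := by
  simp_rw [infProd]
  rw [iInf_comm]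
  refine iInf_congr fun F => ?_
  refine tendsto_nhds_unique (tendsto_atTop_iInf fun n m h => Finset.prod_le_prod' fun a _ => ha h a)
    (tendsto_finset_prod_of_le_one F (fun a => (iInf_le _ 0).trans (hu 0 a)) fun a =>
      tendsto_atTop_iInf fun n m h => ha h a)

/-- The multiplicative functional of a REM. -/
theorem IsREM.poissonFun [IsProbabilityMeasure P] (hx : 0 < x) (h : IsREM P x ζ) :
    PoissonFun P ζ (remIntensity x) := fun H hH hle => by
  -- The cut at `1/(n+1)` gives the support finite intensity, since the intensity is infinite only
  -- near `0`. The approximations increase to `1 - H` on `(0,∞)`, where the points and the intensity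
  -- live.
  set f : ℕ → SimpleFunc ℝ ℝ≥0∞ := fun n =>
    (SimpleFunc.eapprox (fun s => 1 - H s) n).restrict (Ioi (1 / ((n : ℝ) + 1))) with hf
  have hmeas : ∀ n : ℕ, MeasurableSet (Ioi (1 / ((n : ℝ) + 1))) := fun n => measurableSet_Ioi
  have hfe : ∀ n s, f n s =
      (Ioi (1 / ((n : ℝ) + 1))).indicator (SimpleFunc.eapprox (fun s => 1 - H s) n) s :=
    fun n s => SimpleFunc.restrict_apply _ (hmeas n) s
  have hmono : Monotone fun n s => f n s := fun n m hnm s => by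
    simp only [hfe]
    have h1 : Ioi (1 / ((n : ℝ) + 1)) ⊆ Ioi (1 / ((m : ℝ) + 1)) :=
      Ioi_subset_Ioi (one_div_le_one_div_of_le (by positivity) (by gcongr))
    refine (indicator_le_indicator_of_subset h1 (fun _ => zero_le) s).trans ?_
    exact indicator_le_indicator (SimpleFunc.monotone_eapprox _ hnm s)
  have hsup : ∀ s, 0 < s → ⨆ n, f n s = 1 - H s := fun s hs => by
    rw [← SimpleFunc.iSup_eapprox_apply (hH.const_sub 1) s]
    refine le_antisymm (iSup_mono fun n => ?_) (iSup_le fun n => ?_)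
    · rw [hfe]; exact indicator_le_self _ _ s
    · obtain ⟨N, hN⟩ := exists_nat_one_div_lt hs
      refine le_iSup_of_le (max n N) ?_
      rw [hfe, indicator_of_mem]
      · exact SimpleFunc.monotone_eapprox _ (le_max_left _ _) s
      · refine lt_of_le_of_lt (one_div_le_one_div_of_le (by positivity) ?_) hN
        gcongr
        exact le_max_right _ _
  have hf1 : ∀ n s, f n s ≤ 1 := fun n s => by
    rw [hfe]
    refine (indicator_le_self _ _ s).trans ?_
    refine (le_iSup (fun n => SimpleFunc.eapprox (fun s => 1 - H s) n s) n).trans ?_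
    rw [SimpleFunc.iSup_eapprox_apply (hH.const_sub 1) s]
    exact tsub_le_self
  have hfin : ∀ n, remIntensity x {s | f n s ≠ 0} ≠ ∞ := fun n => by
    refine ne_top_of_le_ne_top ?_ (measure_mono (t := Ioi (1 / ((n : ℝ) + 1))) fun s hs => ?_)
    · rw [remIntensity_Ioi hx (by positivity)]; exact ENNReal.ofReal_ne_top
    · by_contra hc
      exact hs (by rw [hfe, indicator_of_notMem hc])
  have hae : ∀ᵐ s ∂(remIntensity x), 0 < s := by
    have : {s : ℝ | ¬ 0 < s} = Iic 0 := by ext; simp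
    rw [ae_iff, this, remIntensity_Iic_zero]
  have hlim : ∀ᵐ ω ∂P, infProd (fun j => H (ζ j ω)) =
      ⨅ n, infProd fun j => 1 - f n (ζ j ω) := by
    filter_upwards [h.pos] with ω hω
    rw [iInf_infProd (u := fun n j => 1 - f n (ζ j ω)) (fun n a => tsub_le_self) fun n m hnm j => tsub_le_tsub_left (hmono hnm _) 1]
    congr 1
    funext j
    rw [← ENNReal.sub_iSup ENNReal.one_ne_top, hsup _ (hω j),
      ENNReal.sub_sub_cancel ENNReal.one_ne_top (hle _)]
  have hms : ∀ n, Measurable fun ω => infProd fun j => 1 - f n (ζ j ω) := fun n =>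
    measurable_infProd fun j => ((f n).measurable.comp (h.measurable j)).const_sub 1
  rw [lintegral_congr_ae hlim, lintegral_iInf hms]
  · simp_rw [fun n => h.lintegral_infProd_simpleFunc (f n) (hf1 n) (hfin n)]
    rw [← expNeg_iSup, ← lintegral_iSup (fun n => (f n).measurable) hmono]
    congr 1
    refine lintegral_congr_ae ?_
    filter_upwards [hae] with s hs using hsup s hs
  · exact fun n m hnm ω => infProd_mono fun j => tsub_le_tsub_left (hmono hnm _) 1
  · refine ne_top_of_le_ne_top ENNReal.one_ne_top ((lintegral_mono fun ω => infProd_le_one _).trans ?_)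
    simp

end REM
end GREM

namespace GREM

/-! ### Void probabilities determine the law of an ordered marked sequence -/

section Uniqueness

variable {D : Type*}

/-- No point of the sequence lies in `B`. -/
def voidSet (B : Set (ℝ × D)) : Set (ℕ → ℝ × D) := {z | ∀ j, z j ∉ B}

variable [MeasurableSpace D]

/-- The `σ`-algebra generated by the void events. -/
@[reducible]
def voidSigma (D : Type*) [MeasurableSpace D] : MeasurableSpace (ℕ → ℝ × D) :=
  MeasurableSpace.generateFrom (voidSet '' {B : Set (ℝ × D) | MeasurableSet B})

lemma measurableSet_voidSet {B : Set (ℝ × D)} (hB : MeasurableSet B) :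
    MeasurableSet (voidSet B) := by
  have : voidSet B = ⋂ j, {z : ℕ → ℝ × D | z j ∉ B} := by ext; simp [voidSet]
  rw [this]
  exact .iInter fun j => (measurable_pi_apply j hB).compl

lemma voidSigma_le : voidSigma D ≤ MeasurableSpace.pi := by
  refine MeasurableSpace.generateFrom_le ?_
  rintro _ ⟨B, hB, rfl⟩
  exact measurableSet_voidSet hB

lemma isPiSystem_voidSet : IsPiSystem (voidSet '' {B : Set (ℝ × D) | MeasurableSet B}) := by
  rintro _ ⟨B, hB, rfl⟩ _ ⟨C, hC, rfl⟩ -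
  rw [mem_ofPred_eq] at hB hC
  refine ⟨B ∪ C, hB.union hC, ?_⟩
  ext z
  simp only [voidSet, mem_union, not_or, mem_ofPred_eq, mem_inter_iff, forall_and]

/-- The sequences whose first coordinates decrease strictly. -/
abbrev DecSeq (D : Type*) : Type _ := {z : ℕ → ℝ × D // StrictAnti fun j => (z j).1}

lemma measurableSet_not_void {B : Set (ℝ × D)} (hB : MeasurableSet B) :
    MeasurableSet[(voidSigma D).comap Subtype.val] {z : DecSeq D | ∃ j, z.1 j ∈ B} := by
  have : {z : DecSeq D | ∃ j, z.1 j ∈ B} = Subtype.val ⁻¹' (voidSet B)ᶜ := by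
    ext z; simp [voidSet]
  rw [this]
  exact ⟨_, (MeasurableSpace.measurableSet_generateFrom (mem_image_of_mem voidSet hB)).compl, rfl⟩

/-- The first coordinate of point `0` exceeds `r` iff some point lies above `r`. For point `n + 1`,
a rational `u` is placed between it and point `n`: a point in `(r, u]` must have an index larger
than `n`. -/
lemma measurableSet_lt_fst (n : ℕ) : ∀ r : ℝ,
    MeasurableSet[(voidSigma D).comap Subtype.val] {z : DecSeq D | r < (z.1 n).1} := by
  induction n with
  | zero =>
    intro r
    have : {z : DecSeq D | r < (z.1 0).1} =
        {z : DecSeq D | ∃ j, z.1 j ∈ Prod.fst ⁻¹' Ioi r} := by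
      ext z
      exact ⟨fun h => ⟨0, h⟩, fun ⟨j, hj⟩ => lt_of_lt_of_le hj (z.2.antitone (Nat.zero_le j))⟩
    rw [this]
    exact measurableSet_not_void (measurable_fst measurableSet_Ioi)
  | succ n ih =>
    intro r
    have : {z : DecSeq D | r < (z.1 (n + 1)).1} = ⋃ u : ℚ,
        {z : DecSeq D | (u : ℝ) < (z.1 n).1} ∩
          {z : DecSeq D | ∃ j, z.1 j ∈ Prod.fst ⁻¹' Ioc r u} := by
      ext z
      simp only [mem_ofPred_eq, mem_iUnion, mem_inter_iff, mem_preimage, mem_Ioc]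
      constructor
      · intro h
        obtain ⟨u, hu, hu'⟩ := exists_rat_btwn (z.2 (Nat.lt_succ_self n))
        exact ⟨u, hu', n + 1, h, hu.le⟩
      · rintro ⟨u, hu, j, hj, hj'⟩
        have : n < j := z.2.lt_iff_gt.1 (lt_of_le_of_lt hj' hu)
        exact hj.trans_le (z.2.antitone this)
    rw [this]
    exact .iUnion fun u => (ih u).inter (measurableSet_not_void (measurable_fst measurableSet_Ioc))

/-- Two rationals isolate the `n`-th point: if point `n + 1` is at most `r` and the points before
`n` exceed `u`, only point `n` can lie in `(r, u]`, so the existence of a point of `C` there is a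
statement about it. -/
lemma measurableSet_coord_mem (n : ℕ) {C : Set (ℝ × D)} (hC : MeasurableSet C) :
    MeasurableSet[(voidSigma D).comap Subtype.val] {z : DecSeq D | z.1 n ∈ C} := by
  have : {z : DecSeq D | z.1 n ∈ C} = ⋃ r : ℚ, ⋃ u : ℚ,
      {z : DecSeq D | (r : ℝ) < (z.1 (n + 1)).1}ᶜ ∩
        ((⋂ j : ℕ, ⋂ _ : j < n, {z : DecSeq D | (u : ℝ) < (z.1 j).1}) ∩
          {z : DecSeq D | ∃ j, z.1 j ∈ C ∩ Prod.fst ⁻¹' Ioc (r : ℝ) u}) := by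
    ext z
    simp only [mem_ofPred_eq, mem_iUnion, mem_inter_iff, mem_preimage, mem_Ioc, mem_compl_iff,
      mem_iInter, not_lt]
    constructor
    · intro h
      obtain ⟨r, hr, hr'⟩ := exists_rat_btwn (z.2 (Nat.lt_succ_self n))
      obtain ⟨u, hu, hu'⟩ : ∃ u : ℚ, (z.1 n).1 ≤ u ∧ ∀ j < n, (u : ℝ) < (z.1 j).1 := by
        rcases n with _ | n
        · obtain ⟨u, hu⟩ := exists_rat_gt (z.1 0).1
          exact ⟨u, hu.le, fun j hj => absurd hj (Nat.not_lt_zero j)⟩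
        · obtain ⟨u, hu, hu'⟩ := exists_rat_btwn (z.2 (Nat.lt_succ_self n))
          exact ⟨u, hu.le, fun j hj => hu'.trans_le (z.2.antitone (Nat.lt_succ_iff.1 hj))⟩
      exact ⟨r, u, hr.le, hu', n, h, hr', hu⟩
    · rintro ⟨r, u, hr, hu, j, hj, hj', hj''⟩
      have h1 : ¬ j < n := fun h => absurd (hu j h) (not_lt.2 hj'')
      have h2 : j < n + 1 := z.2.lt_iff_gt.1 (lt_of_le_of_lt hr hj')
      rwa [show n = j by omega]
  rw [this]
  refine .iUnion fun r => .iUnion fun u => (measurableSet_lt_fst _ _).compl.inter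
    (.inter (.iInter fun j => .iInter fun _ => measurableSet_lt_fst _ _)
      (measurableSet_not_void (hC.inter (measurable_fst measurableSet_Ioc))))

lemma comap_pi_le_comap_voidSigma :
    (MeasurableSpace.pi : MeasurableSpace (ℕ → ℝ × D)).comap (Subtype.val : DecSeq D → _) ≤
      (voidSigma D).comap Subtype.val := by
  rw [MeasurableSpace.pi, MeasurableSpace.comap_iSup]
  refine iSup_le fun n => ?_
  rw [MeasurableSpace.comap_comp]
  rintro _ ⟨C, hC, rfl⟩
  exact measurableSet_coord_mem n hC

/-- On strictly decreasing sequences the void events generate the trace of the product σ-algebra,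
and they form a π-system because the void events of `B` and `C` intersect in that of `B ∪ C`. Both
measures live on such sequences, so agreement on void events suffices. -/
theorem ext_of_voidSet {m m' : Measure (ℕ → ℝ × D)} [IsProbabilityMeasure m]
    [IsProbabilityMeasure m'] (hm : ∀ᵐ z ∂m, StrictAnti fun j => (z j).1)
    (hm' : ∀ᵐ z ∂m', StrictAnti fun j => (z j).1)
    (h : ∀ B, MeasurableSet B → m (voidSet B) = m' (voidSet B)) : m = m' := by
  ext T hT
  obtain ⟨T', hT', hTT'⟩ := comap_pi_le_comap_voidSigma (D := D) _ ⟨T, hT, rfl⟩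
  have hcongr : ∀ z : ℕ → ℝ × D, (StrictAnti fun j => (z j).1) → (z ∈ T ↔ z ∈ T') := fun z hz => by
    have := Set.ext_iff.1 hTT' ⟨z, hz⟩
    simpa using this.symm
  have e1 : m T = m T' := measure_congr (by
    filter_upwards [hm] with z hz using propext (hcongr z hz))
  have e2 : m' T = m' T' := measure_congr (by
    filter_upwards [hm'] with z hz using propext (hcongr z hz))
  have e3 : m.trim voidSigma_le = m'.trim (voidSigma_le (D := D)) := by
    refine @ext_of_generate_finite _ (voidSigma D) _ _ _ rfl isPiSystem_voidSet _ ?_ ?_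
    · rintro _ ⟨B, hB, rfl⟩
      rw [trim_measurableSet_eq, trim_measurableSet_eq, h B hB]
      all_goals exact MeasurableSpace.measurableSet_generateFrom ⟨B, hB, rfl⟩
    · rw [trim_measurableSet_eq _ .univ, trim_measurableSet_eq _ .univ]; simp
  rw [e1, e2, ← trim_measurableSet_eq voidSigma_le hT', e3, trim_measurableSet_eq _ hT']

end Uniqueness

/-! ### Points of a Poisson process: summability and absence of ties -/

section Points

variable {A X Ω : Type*} [MeasurableSpace X] [MeasurableSpace Ω]

lemma PoissonFun.void {m : Measure Ω} {z : A → Ω → X} {Λ : Measure X} (h : PoissonFun m z Λ)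
    [Countable A] (hz : ∀ a, Measurable (z a)) {B : Set X} (hB : MeasurableSet B) :
    m {ω | ∀ a, z a ω ∉ B} = expNeg (Λ B) := by
  classical
  have h1 := h (Bᶜ.indicator fun _ => 1) (measurable_const.indicator hB.compl)
    fun p => indicator_le_self' (fun _ _ => zero_le) p
  have h2 : ∀ p, (1 : ℝ≥0∞) - Bᶜ.indicator (fun _ => 1) p = B.indicator (fun _ => 1) p := fun p => by
    by_cases hp : p ∈ B <;> simp [hp]
  simp_rw [h2] at h1
  rw [lintegral_indicator hB, setLIntegral_const, one_mul] at h1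
  rw [← h1]
  have hms : MeasurableSet {ω | ∀ a, z a ω ∉ B} := by
    have : {ω | ∀ a, z a ω ∉ B} = ⋂ a, z a ⁻¹' Bᶜ := by ext; simp
    rw [this]
    exact .iInter fun a => hz a hB.compl
  rw [← lintegral_indicator_one hms]
  refine lintegral_congr fun ω => ?_
  by_cases hω : ∀ a, z a ω ∉ B
  · rw [indicator_of_mem (by exact hω)]
    simp [infProd, hω]
  · rw [indicator_of_notMem (by exact hω)]
    push Not at hω
    obtain ⟨a, ha⟩ := hω
    refine (le_antisymm ((infProd_le _ {a}).trans ?_) zero_le).symm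
    simp [ha]

/-- Let `S` be the sum. Since `e^{-tS}` vanishes where `S = ∞`, its expectation is at most `P(S <
∞)`. By the functional, this expectation is `exp(-∫ (1 - e^{-ts}) dΛ)`, which tends to `1` as `t →
0` by domination with `min 1 s`. -/
lemma PoissonFun.ae_tsum_ne_top {m : Measure Ω} [IsProbabilityMeasure m] {z : A → Ω → X}
    {Λ : Measure X} (h : PoissonFun m z Λ) [Countable A] (hz : ∀ a, Measurable (z a))
    {s : X → ℝ≥0∞} (hs : Measurable s) (hfin : ∀ p, s p ≠ ∞) (hint : ∫⁻ p, min 1 (s p) ∂Λ ≠ ∞) :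
    ∀ᵐ ω ∂m, ∑' a, s (z a ω) ≠ ∞ := by
  set t : ℕ → ℝ≥0∞ := fun n => ((n : ℝ≥0∞) + 1)⁻¹ with ht
  have ht0 : Filter.Tendsto t Filter.atTop (nhds 0) := by
    have := (ENNReal.tendsto_inv_nat_nhds_zero).comp (Filter.tendsto_add_atTop_nat 1)
    simpa [ht, Function.comp_def] using this
  have ht1 : ∀ n, t n ≤ 1 := fun n => ENNReal.inv_le_one.2 (by simp)
  have htne : ∀ n, t n ≠ 0 := fun n => ENNReal.inv_ne_zero.2 (by simp)
  have hS : Measurable fun ω => ∑' a, s (z a ω) := Measurable.tsum fun a => hs.comp (hz a)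
  have key : ∀ n, expNeg (∫⁻ p, (1 - expNeg (t n * s p)) ∂Λ) ≤ m {ω | ∑' a, s (z a ω) ≠ ∞} :=
    fun n => by
    have hHm : Measurable fun p => expNeg (t n * s p) :=
      continuous_expNeg.measurable.comp (hs.const_mul _)
    rw [← h (fun p => expNeg (t n * s p)) hHm fun p => expNeg_le_one _]
    have hset : MeasurableSet {ω | ∑' a, s (z a ω) ≠ ∞} :=
      (measurableSet_eq_fun hS measurable_const).compl
    rw [← lintegral_indicator_one hset]
    refine lintegral_mono fun ω => ?_
    rw [← expNeg_tsum]
    by_cases hω : ∑' a, s (z a ω) = ∞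
    · rw [ENNReal.tsum_mul_left, hω, ENNReal.mul_top (htne n)]; simp
    · rw [indicator_of_mem (by simpa using hω)]
      exact expNeg_le_one _
  have hlim : Filter.Tendsto (fun n => ∫⁻ p, (1 - expNeg (t n * s p)) ∂Λ) Filter.atTop (nhds 0) := by
    have := tendsto_lintegral_of_dominated_convergence (μ := Λ)
      (F := fun n p => 1 - expNeg (t n * s p)) (f := fun _ => 0) (fun p => min 1 (s p))
      (fun n => (continuous_expNeg.measurable.comp (hs.const_mul _)).const_sub 1) ?_ hint ?_
    · simpa using this
    · refine fun n => Filter.Eventually.of_forall fun p => le_min tsub_le_self ?_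
      have h1 : t n * s p ≤ s p := by simpa using mul_le_mul_left (ht1 n) (s p)
      refine (tsub_le_tsub_left (antitone_expNeg h1) 1).trans ?_
      rw [← ENNReal.ofReal_toReal (hfin p), expNeg_ofReal ENNReal.toReal_nonneg,
        ← ENNReal.ofReal_one, ← ENNReal.ofReal_sub _ (Real.exp_pos _).le]
      refine ENNReal.ofReal_le_ofReal ?_
      linarith [Real.add_one_le_exp (-(s p).toReal)]
    · refine Filter.Eventually.of_forall fun p => ?_
      have h1 : Filter.Tendsto (fun n => t n * s p) Filter.atTop (nhds 0) := by
        have := ENNReal.Tendsto.mul_const ht0 (Or.inr (hfin p))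
        simpa using this
      have h2 := ENNReal.Tendsto.sub (tendsto_const_nhds (x := (1 : ℝ≥0∞)))
        (expNeg_tendsto_one h1) (Or.inl ENNReal.one_ne_top)
      simpa using h2
  have h1 : 1 ≤ m {ω | ∑' a, s (z a ω) ≠ ∞} := le_of_tendsto' (expNeg_tendsto_one hlim) key
  exact (mem_ae_iff_prob_eq_one (measurableSet_eq_fun hS measurable_const).compl).2
    (le_antisymm prob_le_one h1)

/-- A second moment type bound from the functional alone. With `N` the number of points in `B`, the
choice `H = 1/2` on `B` gives `E[2^{-N}]`, which is compared with `P(N = 0)` and `P(N ≥ 2)`. -/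
lemma PoissonFun.measure_two_le {m : Measure Ω} [IsProbabilityMeasure m] {z : A → Ω → X}
    {Λ : Measure X} (h : PoissonFun m z Λ) [Countable A] (hz : ∀ a, Measurable (z a))
    {B : Set X} (hB : MeasurableSet B) :
    m {ω | ∃ a b, a ≠ b ∧ z a ω ∈ B ∧ z b ω ∈ B} ≤ (Λ B) ^ 2 := by
  classical
  by_cases hfin : Λ B = ∞
  · simp [hfin]
  set E2 := {ω | ∃ a b, a ≠ b ∧ z a ω ∈ B ∧ z b ω ∈ B} with hE2
  set E0 := {ω | ∀ a, z a ω ∉ B} with hE0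
  have mE2 : MeasurableSet E2 := by
    have : E2 = ⋃ a, ⋃ b, ⋃ _ : a ≠ b, z a ⁻¹' B ∩ z b ⁻¹' B := by
      ext ω
      simp only [hE2, mem_ofPred_eq, mem_iUnion, mem_inter_iff, mem_preimage, exists_prop]
    rw [this]
    exact .iUnion fun a => .iUnion fun b => .iUnion fun _ => (hz a hB).inter (hz b hB)
  have mE0 : MeasurableSet E0 := by
    have : E0 = ⋂ a, z a ⁻¹' Bᶜ := by ext; simp [hE0]
    rw [this]
    exact .iInter fun a => hz a hB.compl
  set H : X → ℝ≥0∞ := fun p => if p ∈ B then 2⁻¹ else 1 with hH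
  have hHm : Measurable H := Measurable.ite hB measurable_const measurable_const
  have h2 : (2⁻¹ : ℝ≥0∞) ≤ 1 := by simp
  have hH1 : ∀ p, H p ≤ 1 := fun p => by simp only [hH]; split_ifs <;> simp
  -- Pointwise `2^{-N} + 1_{N ≥ 2}/4 ≤ 1/2 + 1_{N = 0}/2`, checked separately for `N = 0`, `N = 1`
  -- and `N ≥ 2`.
  have hpt : ∀ ω, infProd (fun a => H (z a ω)) + E2.indicator (fun _ => 4⁻¹) ω ≤
      2⁻¹ + E0.indicator (fun _ => 2⁻¹) ω := fun ω => by
    by_cases h0 : ω ∈ E0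
    · have : ω ∉ E2 := fun ⟨a, b, _, ha, _⟩ => h0 a ha
      rw [indicator_of_mem h0, indicator_of_notMem this, ENNReal.inv_two_add_inv_two, add_zero]
      exact infProd_le_one _
    by_cases hω : ω ∈ E2
    · rw [indicator_of_mem hω, indicator_of_notMem h0]
      obtain ⟨a, b, hab, ha, hb⟩ := hω
      have : infProd (fun a => H (z a ω)) ≤ 4⁻¹ := by
        refine (infProd_le _ {a, b}).trans ?_
        rw [Finset.prod_pair hab]
        simp only [hH, ha, hb, if_true]
        rw [← ENNReal.mul_inv (by simp) (by simp)]; norm_num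
      refine (add_le_add this le_rfl).trans ?_
      rw [add_zero, ← two_mul, show (4 : ℝ≥0∞) = 2 * 2 by norm_num,
        ENNReal.mul_inv (by simp) (by simp), ← mul_assoc, ENNReal.mul_inv_cancel (by simp) (by simp),
        one_mul]
    · rw [indicator_of_notMem hω, indicator_of_notMem h0, add_zero, add_zero]
      simp only [hE0, mem_ofPred_eq, not_forall, not_not] at h0
      obtain ⟨a, ha⟩ := h0
      refine (infProd_le _ {a}).trans ?_
      simp [hH, ha]
  have hint := lintegral_mono (μ := m) hpt
  have hHz : Measurable fun ω => infProd fun a => H (z a ω) :=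
    measurable_infProd fun a => hHm.comp (hz a)
  have h3 : ∀ p, 1 - H p = B.indicator (fun _ => 2⁻¹) p := fun p => by
    by_cases hp : p ∈ B <;> simp [hH, hp]
  rw [lintegral_add_left hHz, lintegral_add_left measurable_const, lintegral_indicator mE2,
    lintegral_indicator mE0, setLIntegral_const, setLIntegral_const, lintegral_const, measure_univ,
    mul_one, h H hHm hH1, h.void hz hB] at hint
  simp_rw [h3] at hint
  rw [lintegral_indicator hB, setLIntegral_const] at hint
  obtain ⟨r, hr⟩ : ∃ r : ℝ≥0, Λ B = r := ⟨_, (ENNReal.coe_toNNReal hfin).symm⟩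
  obtain ⟨p, hp⟩ : ∃ p : ℝ≥0, m E2 = p := ⟨_, (ENNReal.coe_toNNReal (measure_ne_top m E2)).symm⟩
  rw [hr, hp] at hint ⊢
  have e1 : expNeg (2⁻¹ * (r : ℝ≥0∞)) = ENNReal.ofReal (Real.exp (-(r / 2))) := by
    rw [← expNeg_ofReal (by positivity)]
    congr 1
    rw [ENNReal.ofReal_div_of_pos two_pos, ENNReal.ofReal_coe_nnreal, ENNReal.div_eq_inv_mul]
    simp
  have e2 : expNeg (r : ℝ≥0∞) = ENNReal.ofReal (Real.exp (-(r : ℝ))) := by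
    rw [← expNeg_ofReal r.coe_nonneg, ENNReal.ofReal_coe_nnreal]
  rw [e1, e2] at hint
  have e3 : ∀ y : ℝ, 0 < y → ENNReal.ofReal y⁻¹ = (ENNReal.ofReal y)⁻¹ := fun y hy =>
    ENNReal.ofReal_inv_of_pos hy
  have e4 : (4⁻¹ : ℝ≥0∞) = ENNReal.ofReal 4⁻¹ := by rw [e3 _ (by norm_num), ENNReal.ofReal_ofNat]
  have e5 : (2⁻¹ : ℝ≥0∞) = ENNReal.ofReal 2⁻¹ := by rw [e3 _ (by norm_num), ENNReal.ofReal_ofNat]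
  rw [e4, e5, ← ENNReal.ofReal_coe_nnreal (p := p), ← ENNReal.ofReal_mul (by positivity),
    ← ENNReal.ofReal_add (by positivity) (by positivity), ← ENNReal.ofReal_mul (by positivity),
    ← ENNReal.ofReal_add (by positivity) (by positivity),
    ENNReal.ofReal_le_ofReal_iff (by positivity)] at hint
  have h5 : Real.exp (-(r : ℝ)) = Real.exp (-((r : ℝ) / 2)) ^ 2 := by
    rw [← Real.exp_nat_mul]; congr 1; push_cast; ring
  rw [h5] at hint
  have h6 := Real.add_one_le_exp (-((r : ℝ) / 2))
  have h7 : Real.exp (-((r : ℝ) / 2)) ≤ 1 := Real.exp_le_one_iff.2 (by linarith [r.coe_nonneg])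
  -- With `u = e^{-r/2}` the integrated inequality reads `p ≤ 2 (1 - u)^2`, and `0 ≤ 1 - u ≤ r/2`.
  have h8 : (p : ℝ) ≤ r ^ 2 := by nlinarith [r.coe_nonneg]
  exact_mod_cast h8

end Points
end GREM

namespace GREM

/-! ### Ties and power sums for the points of a marked REM -/

section REMPoints

variable {A D Ω : Type*} [MeasurableSpace D] [MeasurableSpace Ω]

lemma remIntensity_le_volume {x : ℝ} (hx : 0 < x) {ε : ℝ} (hε : 0 < ε) {B : Set ℝ}
    (hB : MeasurableSet B) (hBε : B ⊆ Ioi ε) :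
    remIntensity x B ≤ ENNReal.ofReal (x * ε ^ (-x - 1)) * volume B := by
  have h0 : B ⊆ Ioi 0 := hBε.trans (Ioi_subset_Ioi hε.le)
  rw [remIntensity, withDensity_apply _ hB, Measure.restrict_restrict hB,
    inter_eq_left.2 h0, ← setLIntegral_const]
  refine setLIntegral_mono measurable_const fun s hs => ENNReal.ofReal_le_ofReal ?_
  have hs' : ε < s := hBε hs
  exact mul_le_mul_of_nonneg_left (Real.rpow_le_rpow_of_nonpos hε hs'.le (by linarith)) hx.le

/-- A tie at a position in `(ε, N)` puts two points in one cell of a grid of mesh `1/(n+1)`. Each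
cell has intensity at most `K/(n+1)`, so by `PoissonFun.measure_two_le` the probability is at most
`N(n+1) · (K/(n+1))^2`, which tends to `0`. -/
lemma PoissonFun.ae_injective {m : Measure Ω} [IsProbabilityMeasure m] {z : A → Ω → ℝ × D}
    [Countable A] (hz : ∀ a, Measurable (z a)) {x : ℝ} (hx : 0 < x) {ν : Measure D}
    [IsFiniteMeasure ν] (h : PoissonFun m z ((remIntensity x).prod ν)) :
    ∀ᵐ ω ∂m, ∀ a b, a ≠ b → 0 < (z a ω).1 → (z a ω).1 ≠ (z b ω).1 := by
  have key : ∀ N : ℕ, ∀ᵐ ω ∂m, ∀ a b, a ≠ b → 1 / ((N : ℝ) + 1) < (z a ω).1 → (z a ω).1 < N →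
      (z a ω).1 ≠ (z b ω).1 := fun N => by
    set ε : ℝ := 1 / ((N : ℝ) + 1) with hεd
    have hε : 0 < ε := by positivity
    set K : ℝ≥0∞ := ENNReal.ofReal (x * ε ^ (-x - 1)) * ν univ with hK
    have hKfin : K ≠ ∞ := ENNReal.mul_ne_top ENNReal.ofReal_ne_top (measure_ne_top _ _)
    set Bad := {ω | ∃ a b, a ≠ b ∧ ε < (z a ω).1 ∧ (z a ω).1 < N ∧ (z a ω).1 = (z b ω).1} with hBad
    have bound : ∀ n : ℕ, m Bad ≤ (N * K ^ 2) * ((n + 1 : ℕ) : ℝ≥0∞)⁻¹ := fun n => by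
      set B : ℕ → Set ℝ := fun i => Ioi ε ∩ Ico ((i : ℝ) / (n + 1)) (((i : ℝ) + 1) / (n + 1)) with hB
      have hBm : ∀ i, MeasurableSet (B i) := fun i => measurableSet_Ioi.inter measurableSet_Ico
      have hΛ : ∀ i, ((remIntensity x).prod ν) (Prod.fst ⁻¹' B i) ≤ K * ((n + 1 : ℕ) : ℝ≥0∞)⁻¹ :=
        fun i => by
        have : (Prod.fst ⁻¹' B i : Set (ℝ × D)) = B i ×ˢ univ := by ext; simp
        rw [this, Measure.prod_prod]
        have h1 : volume (B i) ≤ ((n + 1 : ℕ) : ℝ≥0∞)⁻¹ := by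
          refine (measure_mono inter_subset_right).trans ?_
          rw [Real.volume_Ico, ← sub_div, add_sub_cancel_left, one_div,
            ENNReal.ofReal_inv_of_pos (by positivity)]
          refine le_of_eq ?_
          congr 1
          rw [← ENNReal.ofReal_natCast]; push_cast; rfl
        calc remIntensity x (B i) * ν univ
            ≤ ENNReal.ofReal (x * ε ^ (-x - 1)) * ((n + 1 : ℕ) : ℝ≥0∞)⁻¹ * ν univ := by
              gcongr
              exact (remIntensity_le_volume hx hε (hBm i) inter_subset_left).trans (by gcongr)
          _ = K * ((n + 1 : ℕ) : ℝ≥0∞)⁻¹ := by rw [hK]; ring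
      have hsub : Bad ⊆ ⋃ i ∈ Finset.range (N * (n + 1)),
          {ω | ∃ a b, a ≠ b ∧ z a ω ∈ Prod.fst ⁻¹' B i ∧ z b ω ∈ Prod.fst ⁻¹' B i} := by
        rintro ω ⟨a, b, hab, h1, h2, h3⟩
        have hpos : 0 ≤ (z a ω).1 * (n + 1) := by have := hε.trans h1; positivity
        have hmem : (z a ω).1 ∈ B ⌊(z a ω).1 * (n + 1)⌋₊ := by
          refine ⟨h1, ?_, ?_⟩
          · rw [div_le_iff₀ (by positivity)]; exact Nat.floor_le hpos
          · rw [lt_div_iff₀ (by positivity)]; exact Nat.lt_floor_add_one _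
        refine mem_iUnion₂.2 ⟨⌊(z a ω).1 * (n + 1)⌋₊, ?_, a, b, hab, hmem, ?_⟩
        · rw [Finset.mem_range, Nat.floor_lt hpos]
          push_cast
          gcongr
        · rw [mem_preimage, ← h3]; exact hmem
      have hle : ∀ i, m {ω | ∃ a b, a ≠ b ∧ z a ω ∈ Prod.fst ⁻¹' B i ∧ z b ω ∈ Prod.fst ⁻¹' B i} ≤
          (K * ((n + 1 : ℕ) : ℝ≥0∞)⁻¹) ^ 2 := fun i =>
        (h.measure_two_le hz (measurable_fst (hBm i))).trans (by gcongr; exact hΛ i)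
      refine (measure_mono hsub).trans ((measure_biUnion_finset_le _ _).trans ?_)
      refine (Finset.sum_le_sum fun i _ => hle i).trans ?_
      rw [Finset.sum_const, Finset.card_range, nsmul_eq_mul]
      have hn : ((n + 1 : ℕ) : ℝ≥0∞) * ((n + 1 : ℕ) : ℝ≥0∞)⁻¹ = 1 :=
        ENNReal.mul_inv_cancel (by simp) (ENNReal.natCast_ne_top _)
      refine le_of_eq ?_
      rw [Nat.cast_mul, mul_pow, sq (((n + 1 : ℕ) : ℝ≥0∞)⁻¹)]
      calc _ = (N * K ^ 2) * ((n + 1 : ℕ) : ℝ≥0∞)⁻¹ *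
            (((n + 1 : ℕ) : ℝ≥0∞) * ((n + 1 : ℕ) : ℝ≥0∞)⁻¹) := by ring
        _ = _ := by rw [hn, mul_one]
    have hlim : Filter.Tendsto (fun n : ℕ => (N * K ^ 2) * ((n + 1 : ℕ) : ℝ≥0∞)⁻¹) Filter.atTop
        (nhds 0) := by
      have h1 := (ENNReal.tendsto_inv_nat_nhds_zero).comp (Filter.tendsto_add_atTop_nat 1)
      have := ENNReal.Tendsto.const_mul (a := N * K ^ 2) h1
        (Or.inr (ENNReal.mul_ne_top (ENNReal.natCast_ne_top _) (ENNReal.pow_ne_top hKfin)))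
      simpa [Function.comp_def] using this
    have h0 : m Bad = 0 := le_antisymm (ge_of_tendsto' hlim bound) zero_le
    have hnot : ∀ᵐ ω ∂m, ω ∉ Bad := measure_eq_zero_iff_ae_notMem.1 h0
    filter_upwards [hnot] with ω hω a b hab h1 h2 h3
    exact hω ⟨a, b, hab, h1, h2, h3⟩
  filter_upwards [ae_all_iff.2 key] with ω hω a b hab ha
  obtain ⟨N1, hN1⟩ := exists_nat_one_div_lt ha
  obtain ⟨N2, hN2⟩ := exists_nat_gt (z a ω).1
  refine hω (max N1 N2) a b hab (lt_of_le_of_lt ?_ hN1) (hN2.trans_le ?_)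
  · refine one_div_le_one_div_of_le (by positivity) ?_
    gcongr; exact le_max_left _ _
  · exact_mod_cast le_max_right _ _

/-- The half-line `(1,∞)` has finite intensity, and on `(0,1]` the integrand is `x s^{y-x-1}`,
integrable because `x < y`. -/
lemma lintegral_min_rpow_remIntensity {x y : ℝ} (hx : 0 < x) (hxy : x < y) :
    ∫⁻ s, min 1 (ENNReal.ofReal (s ^ y)) ∂(remIntensity x) ≠ ∞ := by
  have hsplit : ∀ s : ℝ, min 1 (ENNReal.ofReal (s ^ y)) ≤
      (Ioi 1).indicator (fun _ => 1) s + (Iic 1).indicator (fun s => ENNReal.ofReal (s ^ y)) s :=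
    fun s => by
    by_cases hs : 1 < s
    · rw [indicator_of_mem (mem_Ioi.2 hs)]
      exact (min_le_left _ _).trans le_self_add
    · rw [indicator_of_mem (s := Iic 1) (mem_Iic.2 (not_lt.1 hs))]
      exact (min_le_right _ _).trans le_add_self
  have hm : Measurable fun s : ℝ => ENNReal.ofReal (x * s ^ (-x - 1)) := by fun_prop
  refine ne_top_of_le_ne_top ?_ (lintegral_mono hsplit)
  rw [lintegral_add_left (measurable_const.indicator measurableSet_Ioi),
    lintegral_indicator measurableSet_Ioi, setLIntegral_const, one_mul,
    remIntensity_Ioi hx one_pos, lintegral_indicator measurableSet_Iic]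
  refine ENNReal.add_ne_top.2 ⟨ENNReal.ofReal_ne_top, ?_⟩
  rw [remIntensity, restrict_withDensity measurableSet_Iic, Measure.restrict_restrict
    measurableSet_Iic, lintegral_withDensity_eq_lintegral_mul _ hm (by fun_prop), Iic_inter_Ioi]
  have hI : IntegrableOn (fun s : ℝ => x * s ^ (y - x - 1)) (Ioc 0 1) := by
    refine Integrable.const_mul ?_ x
    exact ((intervalIntegral.intervalIntegrable_rpow' (a := 0) (b := 1)
      (show -1 < y - x - 1 by linarith)).1)
  refine ne_top_of_le_ne_top hI.lintegral_lt_top.ne (setLIntegral_mono (by fun_prop) fun s hs => ?_)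
  rw [Pi.mul_apply, ← ENNReal.ofReal_mul (by have := hs.1; positivity), mul_assoc,
    ← Real.rpow_add hs.1]
  refine ENNReal.ofReal_le_ofReal (le_of_eq ?_)
  congr 2; ring

lemma PoissonFun.ae_tsum_rpow_ne_top {m : Measure Ω} [IsProbabilityMeasure m]
    {z : A → Ω → ℝ × D} [Countable A] (hz : ∀ a, Measurable (z a)) {x y : ℝ} (hx : 0 < x)
    (hxy : x < y) {ν : Measure D} [IsFiniteMeasure ν]
    (h : PoissonFun m z ((remIntensity x).prod ν)) :
    ∀ᵐ ω ∂m, ∑' a, ENNReal.ofReal ((z a ω).1 ^ y) ≠ ∞ := by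
  refine h.ae_tsum_ne_top hz (s := fun p => ENNReal.ofReal (p.1 ^ y)) (by fun_prop)
    (fun p => ENNReal.ofReal_ne_top) ?_
  rw [lintegral_prod _ (by fun_prop)]
  simp only [lintegral_const]
  rw [lintegral_mul_const _ (by fun_prop)]
  exact ENNReal.mul_ne_top (lintegral_min_rpow_remIntensity hx hxy) (measure_ne_top _ _)

end REMPoints

/-! ### Decreasing enumerations -/

section DecEnum

variable {A : Type*}

/-- No ties, and finitely many elements above each one. -/
def Sortable (w : A → ℝ) : Prop := Function.Injective w ∧ ∀ a, {b | w a < w b}.Finite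

lemma IsDecEnum.encard {w : A → ℝ} {e : ℕ → A} (h : IsDecEnum w e) (i : ℕ) :
    {b | w (e i) < w b}.encard = i := by
  have : {b | w (e i) < w b} = e '' (Finset.range i : Set ℕ) := by
    ext b
    obtain ⟨j, rfl⟩ := h.1.2 b
    rw [mem_ofPred_eq, h.1.1.mem_set_image, Finset.mem_coe, Finset.mem_range]
    exact h.2.lt_iff_gt
  rw [this, h.1.1.encard_image, encard_coe_eq_coe_finsetCard, Finset.card_range]

lemma IsDecEnum.injective {w : A → ℝ} {e : ℕ → A} (h : IsDecEnum w e) :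
    Function.Injective w := fun a b hab => by
  obtain ⟨i, rfl⟩ := h.1.2 a
  obtain ⟨j, rfl⟩ := h.1.2 b
  rw [h.2.injective hab]

lemma IsDecEnum.sortable {w : A → ℝ} {e : ℕ → A} (h : IsDecEnum w e) : Sortable w :=
  ⟨h.injective, fun a => by
    obtain ⟨i, rfl⟩ := h.1.2 a
    exact finite_of_encard_eq_coe (h.encard i)⟩

lemma encard_above_strictAnti {w : A → ℝ} (h : ∀ a, {b | w a < w b}.Finite) {a b : A}
    (hab : w a < w b) : {c | w b < w c}.encard < {c | w a < w c}.encard := by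
  have hsub : {c | w b < w c} ⊆ {c | w a < w c} := fun c hc => lt_trans hab hc
  exact (h b).encard_lt_encard ((ssubset_iff_of_subset hsub).2 ⟨b, hab, lt_irrefl (w b)⟩)

lemma encard_above_injective {w : A → ℝ} (h : Sortable w) {a b : A}
    (hab : {c | w a < w c}.encard = {c | w b < w c}.encard) : a = b := by
  refine h.1 (le_antisymm (not_lt.1 fun hc => ?_) (not_lt.1 fun hc => ?_))
  · exact absurd hab (encard_above_strictAnti h.2 hc).ne
  · exact absurd hab (encard_above_strictAnti h.2 hc).ne'

/-- The rank of `a` is the number of elements strictly above it. Ranks are distinct and unbounded,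
and they leave no gap; the enumeration is the inverse of the rank. -/
lemma Sortable.exists_isDecEnum [Infinite A] {w : A → ℝ} (h : Sortable w) :
    ∃ e, IsDecEnum w e := by
  classical
  set rank : A → ℕ := fun a => (h.2 a).toFinset.card with hrank
  have hr : ∀ a, {c | w a < w c}.encard = rank a := fun a => by
    rw [(h.2 a).encard_eq_coe_toFinset_card]
  have hinj : Function.Injective rank := fun a b hab =>
    encard_above_injective h (by rw [hr, hr, hab])
  -- The smallest element above `a` has exactly one element fewer above it.
  have hdown : ∀ n a, rank a = n + 1 → ∃ b, rank b = n := fun n a ha => by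
    have hne : (h.2 a).toFinset.Nonempty := Finset.card_pos.1 (by simp only [hrank] at ha; omega)
    obtain ⟨b, hb, hmin⟩ := Finset.exists_min_image _ w hne
    rw [Finite.mem_toFinset] at hb
    have : (h.2 b).toFinset = (h.2 a).toFinset.erase b := by
      ext c
      simp only [Finite.mem_toFinset, mem_ofPred_eq, Finset.mem_erase]
      constructor
      · intro hc
        exact ⟨fun hcb => by rw [hcb] at hc; exact lt_irrefl _ hc, lt_trans hb hc⟩
      · rintro ⟨hcb, hc⟩
        exact lt_of_le_of_ne (hmin c (by simpa using hc)) fun hh => hcb (h.1 hh).symm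
    refine ⟨b, ?_⟩
    simp only [hrank] at ha ⊢
    rw [this, Finset.card_erase_of_mem (by simpa using hb), ha]
    rfl
  have hsurj : Function.Surjective rank := fun n => by
    obtain ⟨_, ⟨a, rfl⟩, ha⟩ := (infinite_range_of_injective hinj).exists_gt n
    have : ∀ d n, n + d = rank a → ∃ b, rank b = n := fun d => by
      induction d with
      | zero => exact fun n hn => ⟨a, hn.symm⟩
      | succ d ih =>
        intro n hn
        obtain ⟨b, hb⟩ := ih (n + 1) (by omega)
        exact hdown n b hb
    exact this (rank a - n) n (by omega)
  let e := (Equiv.ofBijective rank ⟨hinj, hsurj⟩).symm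
  refine ⟨e, e.bijective, fun i j hij => ?_⟩
  have he : ∀ i, rank (e i) = i := fun i => (Equiv.ofBijective rank ⟨hinj, hsurj⟩).apply_symm_apply i
  refine lt_of_not_ge fun hc => ?_
  rcases hc.lt_or_eq with hc | hc
  · have := encard_above_strictAnti h.2 hc
    rw [hr, hr, he, he] at this
    exact absurd (by exact_mod_cast this : j < i) (by omega)
  · exact hij.ne (e.injective (h.1 hc))

lemma measurableSet_sortable_aux [Countable A] (a : A) (F : Finset A) :
    MeasurableSet {w : A → ℝ | ∀ b, b ∈ F ↔ w a < w b} := by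
  have : {w : A → ℝ | ∀ b, b ∈ F ↔ w a < w b} = ⋂ b, {w : A → ℝ | b ∈ F ↔ w a < w b} := by
    ext; simp
  rw [this]
  exact .iInter fun b => MeasurableSet.iff (.const _)
    (measurableSet_lt (measurable_pi_apply a) (measurable_pi_apply b))

lemma measurableSet_sortable [Countable A] : MeasurableSet {w : A → ℝ | Sortable w} := by
  have : {w : A → ℝ | Sortable w} = (⋂ a, ⋂ b, ⋂ _ : a ≠ b, {w : A → ℝ | w a = w b}ᶜ) ∩
      ⋂ a, ⋃ F : Finset A, {w : A → ℝ | ∀ b, b ∈ F ↔ w a < w b} := by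
    ext w
    simp only [Sortable, mem_ofPred_eq, mem_inter_iff, mem_iInter, mem_iUnion, mem_compl_iff]
    refine and_congr ⟨fun h a b hab hw => hab (h hw), fun h a b hw => ?_⟩ (forall_congr' fun a => ?_)
    · by_contra hab; exact h a b hab hw
    · constructor
      · intro h; exact ⟨h.toFinset, fun b => by simp⟩
      · rintro ⟨F, hF⟩; exact F.finite_toSet.subset fun b hb => (hF b).2 hb
  rw [this]
  refine MeasurableSet.inter (.iInter fun a => .iInter fun b => .iInter fun _ => ?_)
    (.iInter fun a => .iUnion fun F => measurableSet_sortable_aux a F)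
  exact (measurableSet_eq_fun (measurable_pi_apply a) (measurable_pi_apply b)).compl

lemma sortable_of_tsum_ne_top {w : A → ℝ} (hpos : ∀ a, 0 < w a) (hinj : Function.Injective w)
    (hsum : ∑' a, ENNReal.ofReal (w a) ≠ ∞) : Sortable w := by
  refine ⟨hinj, fun a => ?_⟩
  refine (ENNReal.finite_const_le_of_tsum_ne_top hsum
    (ENNReal.ofReal_pos.2 (hpos a)).ne').subset fun b hb => ?_
  exact ENNReal.ofReal_le_ofReal (le_of_lt hb)

variable [Inhabited A]

lemma decEnum_isDecEnum [Infinite A] {w : A → ℝ} (h : Sortable w) : IsDecEnum w (decEnum w) := by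
  rw [decEnum, dif_pos h.exists_isDecEnum]
  exact h.exists_isDecEnum.choose_spec

lemma IsDecEnum.eq_decEnum {w : A → ℝ} {e : ℕ → A} (h : IsDecEnum w e) : decEnum w = e := by
  have hex : ∃ e, IsDecEnum w e := ⟨e, h⟩
  rw [decEnum, dif_pos hex]
  funext i
  exact encard_above_injective h.sortable (by rw [h.encard, hex.choose_spec.encard])

lemma decEnum_of_not_sortable {w : A → ℝ} (h : ¬ Sortable w) : decEnum w = fun _ => default := by
  rw [decEnum, dif_neg]
  rintro ⟨e, he⟩
  exact h he.sortable

/-- On sortable families, `a` is the `i`-th element iff exactly `i` elements lie above it, a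
countable union over the possible finite sets of such elements. Elsewhere the enumeration is the
constant default. -/
lemma measurable_decEnum [Countable A] [Infinite A] [MeasurableSpace A] (i : ℕ) :
    Measurable fun w : A → ℝ => decEnum w i := by
  refine measurable_to_countable' fun a => ?_
  have : (fun w : A → ℝ => decEnum w i) ⁻¹' {a} =
      ({w : A → ℝ | Sortable w} ∩
        ⋃ F : Finset A, ⋃ _ : F.card = i, {w : A → ℝ | ∀ b, b ∈ F ↔ w a < w b}) ∪
      ({w : A → ℝ | Sortable w}ᶜ ∩ {_w : A → ℝ | default = a}) := by
    ext w
    by_cases hw : Sortable w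
    · simp only [mem_preimage, mem_singleton_iff, mem_union, mem_inter_iff, mem_ofPred_eq, hw,
        true_and, mem_compl_iff, not_true, false_and, or_false, mem_iUnion, exists_prop]
      have he := decEnum_isDecEnum hw
      constructor
      · rintro rfl
        have hfin := hw.2 (decEnum w i)
        refine ⟨hfin.toFinset, ?_, fun b => by simp⟩
        have := he.encard i
        rw [hfin.encard_eq_coe_toFinset_card] at this
        exact_mod_cast this
      · rintro ⟨F, hF, hFb⟩
        refine encard_above_injective hw ?_
        rw [he.encard, ← hF, ← encard_coe_eq_coe_finsetCard]
        congr 1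
        ext b; simp [hFb]
    · simp only [mem_preimage, mem_singleton_iff, mem_union, mem_inter_iff, mem_ofPred_eq, hw,
        false_and, mem_compl_iff, not_false_iff, true_and, false_or]
      rw [decEnum_of_not_sortable hw]
  rw [this]
  exact (measurableSet_sortable.inter (.iUnion fun F => .iUnion fun _ =>
    measurableSet_sortable_aux a F)).union (measurableSet_sortable.compl.inter (.const _))

end DecEnum
end GREM

namespace GREM

/-! ### The law of the ordered points -/

/-- The law of the decreasing enumeration of a REM(`x`). -/
structure IsREMLaw (x : ℝ) (ρ : Measure (ℕ → ℝ)) : Prop where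
  isProbabilityMeasure : IsProbabilityMeasure ρ
  pos : ∀ᵐ s ∂ρ, ∀ j, 0 < s j
  strictAnti : ∀ᵐ s ∂ρ, StrictAnti s
  poissonFun : PoissonFun ρ (fun (j : ℕ) (s : ℕ → ℝ) => s j) (remIntensity x)

lemma measurable_comp_countable {A Ω X : Type*} [Countable A] [MeasurableSpace Ω]
    [MeasurableSpace X] {z : A → Ω → X} (hz : ∀ a, Measurable (z a)) {e : Ω → A}
    (he : ∀ a, MeasurableSet {ω | e ω = a}) : Measurable fun ω => z (e ω) ω := by
  intro B hB
  have : (fun ω => z (e ω) ω) ⁻¹' B = ⋃ a, {ω | e ω = a} ∩ z a ⁻¹' B := by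
    ext ω; simp
  rw [this]
  exact .iUnion fun a => (he a).inter (hz a hB)

lemma measurableSet_decEnum_eq {A Ω : Type*} [Countable A] [Infinite A] [Inhabited A]
    [MeasurableSpace Ω] {w : A → Ω → ℝ} (hw : ∀ a, Measurable (w a)) (i : ℕ) (a : A) :
    MeasurableSet {ω | decEnum (fun a => w a ω) i = a} := by
  let : MeasurableSpace A := ⊤
  exact ((measurable_decEnum i).comp (measurable_pi_lambda _ hw)) (measurableSet_singleton a)

section SortLaw

variable {A D Ω : Type*} [MeasurableSpace D] [MeasurableSpace Ω]

lemma PoissonFun.ae_sortable {m : Measure Ω} [IsProbabilityMeasure m] {z : A → Ω → ℝ × D}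
    [Countable A] (hz : ∀ a, Measurable (z a)) {x : ℝ} (hx : 0 < x) (hx1 : x < 1)
    {ν : Measure D} [IsFiniteMeasure ν] (h : PoissonFun m z ((remIntensity x).prod ν))
    (hpos : ∀ᵐ ω ∂m, ∀ a, 0 < (z a ω).1) :
    ∀ᵐ ω ∂m, Sortable fun a => (z a ω).1 := by
  filter_upwards [hpos, h.ae_injective hz hx, h.ae_tsum_rpow_ne_top hz hx hx1] with ω h1 h2 h3
  refine sortable_of_tsum_ne_top h1 (fun a b hab => ?_) (by simpa using h3)
  by_contra hne
  exact h2 a b hne (h1 a) hab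

/-- The points of a Poisson process with intensity `c ^ x • (x s ^ (-x-1) ds ⊗ ν)`, in decreasing
order, are a REM(`x`) multiplied by `c`, with independent marks of law `ν`. -/
theorem PoissonFun.map_sorted {m : Measure Ω} [IsProbabilityMeasure m] {z : A → Ω → ℝ × D}
    [Countable A] [Infinite A] [Inhabited A] (hz : ∀ a, Measurable (z a)) {x : ℝ} (hx : 0 < x)
    (hx1 : x < 1) {ν : Measure D} [IsProbabilityMeasure ν] {c : ℝ} (hc : 0 < c)
    (h : PoissonFun m z ((remIntensity x).prod (ENNReal.ofReal (c ^ x) • ν)))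
    (hpos : ∀ᵐ ω ∂m, ∀ a, 0 < (z a ω).1) {ρ : Measure (ℕ → ℝ)} (hρ : IsREMLaw x ρ) :
    m.map (fun ω i => z (decEnum (fun a => (z a ω).1) i) ω) =
      (ρ.prod (Measure.infinitePi fun _ : ℕ => ν)).map fun p i => (c * p.1 i, p.2 i) := by
  have := hρ.isProbabilityMeasure
  have hfin : IsFiniteMeasure (ENNReal.ofReal (c ^ x) • ν) := ν.smul_finite ENNReal.ofReal_ne_top
  have hsort := h.ae_sortable hz hx hx1 hpos
  have mS : Measurable fun ω (i : ℕ) => z (decEnum (fun a => (z a ω).1) i) ω :=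
    measurable_pi_lambda _ fun i => measurable_comp_countable hz
      (measurableSet_decEnum_eq (fun a => (hz a).fst) i)
  have mR : Measurable fun (p : (ℕ → ℝ) × (ℕ → D)) (i : ℕ) => (c * p.1 i, p.2 i) := by fun_prop
  have := Measure.isProbabilityMeasure_map (μ := m) mS.aemeasurable
  have := Measure.isProbabilityMeasure_map
    (μ := ρ.prod (Measure.infinitePi fun _ : ℕ => ν)) mR.aemeasurable
  have mA : MeasurableSet {z : ℕ → ℝ × D | StrictAnti fun j => (z j).1} := by
    have : {z : ℕ → ℝ × D | StrictAnti fun j => (z j).1} =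
        ⋂ j, {z : ℕ → ℝ × D | (z (j + 1)).1 < (z j).1} := by
      ext z
      simp only [mem_ofPred_eq, mem_iInter]
      exact ⟨fun h j => h (Nat.lt_succ_self j), fun h => strictAnti_nat_of_succ_lt h⟩
    rw [this]
    exact .iInter fun j => measurableSet_lt (by fun_prop) (by fun_prop)
  refine ext_of_voidSet ?_ ?_ fun B hB => ?_
  · rw [ae_map_iff mS.aemeasurable mA]
    filter_upwards [hsort] with ω hω using (decEnum_isDecEnum hω).2
  · rw [ae_map_iff mR.aemeasurable mA]
    have : ∀ᵐ p ∂(ρ.prod (Measure.infinitePi fun _ : ℕ => ν)), StrictAnti p.1 :=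
      Measure.quasiMeasurePreserving_fst.ae hρ.strictAnti
    filter_upwards [this] with p hp i j hij using mul_lt_mul_of_pos_left (hp hij) hc
  · rw [Measure.map_apply mS (measurableSet_voidSet hB),
      Measure.map_apply mR (measurableSet_voidSet hB)]
    -- Void events ignore the order of the points, so sorting can be undone.
    have e1 : m ((fun ω i => z (decEnum (fun a => (z a ω).1) i) ω) ⁻¹' voidSet B) =
        m {ω | ∀ a, z a ω ∉ B} := by
      refine measure_congr ?_
      filter_upwards [hsort] with ω hω
      have hb := (decEnum_isDecEnum hω).1.2
      exact propext ⟨fun h a => by obtain ⟨i, rfl⟩ := hb a; exact h i, fun h i => h _⟩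
    have hT : Measurable fun q : ℝ × D => (c * q.1, q.2) := by fun_prop
    have hR := (hρ.poissonFun.mark (fun j => measurable_pi_apply j) ν).map hT
    have e2 := hR.void (fun j => hT.comp (by fun_prop)) hB
    -- The constant `c` on the points of the right-hand side becomes the factor `c^x` of the
    -- intensity.
    have e3 : ((remIntensity x).prod ν).map (fun q : ℝ × D => (c * q.1, q.2)) =
        (remIntensity x).prod (ENNReal.ofReal (c ^ x) • ν) := by
      have : (fun q : ℝ × D => (c * q.1, q.2)) = Prod.map (c * ·) id := rfl
      rw [this, ← Measure.map_prod_map _ _ (measurable_const_mul c) measurable_id, Measure.map_id,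
        map_mul_remIntensity x hc, Measure.prod_smul_left, Measure.prod_smul_right]
    rw [e1, h.void hz hB, ← e3, ← e2]
    rfl

/-- A REM law is unique. -/
lemma IsREM.map_eq {Ω' : Type*} [MeasurableSpace Ω'] {P : Measure Ω'} [IsProbabilityMeasure P]
    {x : ℝ} (hx : 0 < x) (hx1 : x < 1) {ζ : ℕ → Ω' → ℝ} (h : IsREM P x ζ) {ρ : Measure (ℕ → ℝ)}
    (hρ : IsREMLaw x ρ) : P.map (fun ω j => ζ j ω) = ρ := by
  have := hρ.isProbabilityMeasure
  -- A trivial mark in `Unit` and the constant `c = 1` make `PoissonFun.map_sorted` applicable. The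
  -- sequence is already decreasing, so sorting it changes nothing.
  have h1 := (h.poissonFun hx).map (T := fun s => (s, ())) (by fun_prop)
  have e1 : (remIntensity x).map (fun s => (s, ())) =
      (remIntensity x).prod (ENNReal.ofReal ((1 : ℝ) ^ x) • Measure.dirac ()) := by
    rw [Real.one_rpow, ENNReal.ofReal_one, one_smul, Measure.prod_dirac]
  rw [e1] at h1
  have h2 := h1.map_sorted (fun j => (h.measurable j).prodMk measurable_const) hx hx1 one_pos
    (by filter_upwards [h.pos] with ω hω using hω) hρ
  have hm : Measurable fun (z : ℕ → ℝ × Unit) (i : ℕ) => (z i).1 := by fun_prop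
  have h3 := congrArg (fun μ => μ.map fun (z : ℕ → ℝ × Unit) (i : ℕ) => (z i).1) h2
  simp only at h3
  rw [Measure.map_map hm, Measure.map_map hm (by fun_prop)] at h3
  · have e2 : ((fun (z : ℕ → ℝ × Unit) (i : ℕ) => (z i).1) ∘
        fun (p : (ℕ → ℝ) × (ℕ → Unit)) i => (1 * p.1 i, p.2 i)) = Prod.fst := by
      ext p i; simp
    rw [e2, Measure.map_fst_prod, measure_univ, one_smul] at h3
    rw [← h3]
    refine Measure.map_congr ?_
    filter_upwards [h.strictAnti] with ω hω
    have : IsDecEnum (fun j => ζ j ω) id := ⟨Function.bijective_id, hω⟩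
    funext i
    simp only [Function.comp_apply]
    rw [this.eq_decEnum]; rfl
  · exact measurable_pi_lambda _ fun i => measurable_comp_countable
      (fun j => (h.measurable j).prodMk measurable_const)
      (measurableSet_decEnum_eq (w := fun j ω => ζ j ω) h.measurable i)

lemma IsREM.isREMLaw {Ω' : Type*} [MeasurableSpace Ω'] {P : Measure Ω'} [IsProbabilityMeasure P]
    {x : ℝ} (hx : 0 < x) {ζ : ℕ → Ω' → ℝ} (h : IsREM P x ζ) :
    IsREMLaw x (P.map fun ω j => ζ j ω) := by
  have hm : Measurable fun ω j => ζ j ω := measurable_pi_lambda _ h.measurable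
  refine ⟨Measure.isProbabilityMeasure_map hm.aemeasurable, ?_, ?_, fun H hH hle => ?_⟩
  · rw [ae_map_iff hm.aemeasurable]
    · exact h.pos
    · have : {s : ℕ → ℝ | ∀ j, 0 < s j} = ⋂ j, {s : ℕ → ℝ | 0 < s j} := by ext; simp
      rw [this]
      exact .iInter fun j => measurableSet_lt measurable_const (measurable_pi_apply j)
  · rw [ae_map_iff hm.aemeasurable]
    · exact h.strictAnti
    · have : {s : ℕ → ℝ | StrictAnti s} = ⋂ j, {s : ℕ → ℝ | s (j + 1) < s j} := by
        ext z
        simp only [mem_ofPred_eq, mem_iInter]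
        exact ⟨fun h j => h (Nat.lt_succ_self j), fun h => strictAnti_nat_of_succ_lt h⟩
      rw [this]
      exact .iInter fun j => measurableSet_lt (by fun_prop) (by fun_prop)
  · have hI : Measurable fun s : ℕ → ℝ => infProd fun j => H (s j) :=
      measurable_infProd fun j => hH.comp (measurable_pi_apply j)
    rw [lintegral_map hI hm]
    exact h.poissonFun hx H hH hle

/-- Multiply the points by a function of the mark, and order them again. -/
noncomputable def sortMarks (W : D → ℝ) (p : (ℕ → ℝ) × (ℕ → D)) : (ℕ → ℝ) × (ℕ → D) :=
  (fun i => p.1 (decEnum (fun j => p.1 j * W (p.2 j)) i) *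
      W (p.2 (decEnum (fun j => p.1 j * W (p.2 j)) i)),
    fun i => p.2 (decEnum (fun j => p.1 j * W (p.2 j)) i))

variable {x : ℝ} {ρ : Measure (ℕ → ℝ)} {ν : Measure D} [IsProbabilityMeasure ν] {W : D → ℝ}

lemma measurable_sortMarks (hW : Measurable W) : Measurable (sortMarks W) := by
  have h1 : ∀ j : ℕ, Measurable fun p : (ℕ → ℝ) × (ℕ → D) => (p.1 j * W (p.2 j), p.2 j) := by
    intro j; fun_prop
  have h2 : ∀ i : ℕ, Measurable fun p : (ℕ → ℝ) × (ℕ → D) =>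
      (p.1 (decEnum (fun j => p.1 j * W (p.2 j)) i) *
        W (p.2 (decEnum (fun j => p.1 j * W (p.2 j)) i)),
        p.2 (decEnum (fun j => p.1 j * W (p.2 j)) i)) := fun i =>
    measurable_comp_countable (z := fun (j : ℕ) (p : (ℕ → ℝ) × (ℕ → D)) =>
      (p.1 j * W (p.2 j), p.2 j)) h1 (measurableSet_decEnum_eq
        (w := fun (j : ℕ) (p : (ℕ → ℝ) × (ℕ → D)) => p.1 j * W (p.2 j)) (fun j => (h1 j).fst) i)
  exact (measurable_pi_lambda _ fun i => (h2 i).fst).prodMk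
    (measurable_pi_lambda _ fun i => (h2 i).snd)

/-- For a fixed mark `y`, multiplication by `W y` scales the intensity by `W y ^ x`; integrated over
`y`, this factor is a density on the marks and the intensity remains a product. -/
lemma poissonFun_mul_mark (hρ : IsREMLaw x ρ) (hW : Measurable W) (hW0 : ∀ y, 0 < W y) :
    PoissonFun (ρ.prod (Measure.infinitePi fun _ : ℕ => ν))
      (fun (j : ℕ) (p : (ℕ → ℝ) × (ℕ → D)) => (p.1 j * W (p.2 j), p.2 j))
      ((remIntensity x).prod (ν.withDensity fun y => ENNReal.ofReal (W y ^ x))) := by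
  have := hρ.isProbabilityMeasure
  have hT : Measurable fun q : ℝ × D => (q.1 * W q.2, q.2) := by fun_prop
  have h1 := (hρ.poissonFun.mark (fun j => measurable_pi_apply j) ν).map hT
  convert h1 using 1
  refine Measure.ext_of_lintegral _ fun f hf => ?_
  have hWx : Measurable fun y => ENNReal.ofReal (W y ^ x) := by fun_prop
  have hfT : Measurable fun q : ℝ × D => f (q.1 * W q.2, q.2) := hf.comp hT
  rw [lintegral_prod_symm _ hf.aemeasurable, lintegral_map hf hT,
    lintegral_prod_symm _ hfT.aemeasurable,
    lintegral_withDensity_eq_lintegral_mul _ hWx hf.lintegral_prod_left']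
  refine lintegral_congr fun y => ?_
  have hfy : Measurable fun s => f (s, y) := hf.comp measurable_prodMk_right
  have h2 := congrArg (fun μ => ∫⁻ s, f (s, y) ∂μ) (map_mul_remIntensity x (hW0 y))
  rw [lintegral_map hfy (measurable_const_mul _), lintegral_smul_measure] at h2
  simp only [Pi.mul_apply]
  rw [← smul_eq_mul, ← h2]
  simp_rw [mul_comm]

/-- The invariance of a REM with independent marks: multiply each point by a function of its mark
and order the points; this gives a REM with independent marks, whose law is tilted. -/
theorem map_sortMarks (hx : 0 < x) (hx1 : x < 1) (hρ : IsREMLaw x ρ) (hW : Measurable W)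
    (hW0 : ∀ y, 0 < W y) (hν : ∫⁻ y, ENNReal.ofReal (W y ^ x) ∂ν = 1) :
    (ρ.prod (Measure.infinitePi fun _ : ℕ => ν)).map (sortMarks W) =
        ρ.prod (Measure.infinitePi fun _ : ℕ =>
          ν.withDensity fun y => ENNReal.ofReal (W y ^ x)) ∧
      ∀ᵐ p ∂(ρ.prod (Measure.infinitePi fun _ : ℕ => ν)),
        IsDecEnum (fun j => p.1 j * W (p.2 j)) (decEnum fun j => p.1 j * W (p.2 j)) := by
  have := hρ.isProbabilityMeasure
  set ν' := ν.withDensity fun y => ENNReal.ofReal (W y ^ x) with hν'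
  have : IsProbabilityMeasure ν' := ⟨by rw [hν', withDensity_apply _ .univ, setLIntegral_univ, hν]⟩
  have hP := poissonFun_mul_mark (ν := ν) hρ hW hW0
  have hz : ∀ j : ℕ, Measurable fun p : (ℕ → ℝ) × (ℕ → D) => (p.1 j * W (p.2 j), p.2 j) := by
    intro j; fun_prop
  have hpos : ∀ᵐ p ∂(ρ.prod (Measure.infinitePi fun _ : ℕ => ν)),
      ∀ j, 0 < p.1 j * W (p.2 j) := by
    filter_upwards [Measure.quasiMeasurePreserving_fst.ae hρ.pos] with p hp j using
      mul_pos (hp j) (hW0 _)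
  refine ⟨?_, ?_⟩
  · have h1 := PoissonFun.map_sorted hz hx hx1 one_pos (ν := ν') (by simpa using hP) hpos hρ
    have hu : Measurable fun z : ℕ → ℝ × D => ((fun i => (z i).1, fun i => (z i).2) :
      (ℕ → ℝ) × (ℕ → D)) := by fun_prop
    have h2 := congrArg (fun μ => μ.map fun z : ℕ → ℝ × D =>
      ((fun i => (z i).1, fun i => (z i).2) : (ℕ → ℝ) × (ℕ → D))) h1
    simp only at h2
    rw [Measure.map_map hu, Measure.map_map hu (by fun_prop)] at h2
    · refine Eq.trans ?_ (h2.trans ?_)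
      · rfl
      · have : ((fun z : ℕ → ℝ × D => ((fun i => (z i).1, fun i => (z i).2) :
          (ℕ → ℝ) × (ℕ → D))) ∘ fun p : (ℕ → ℝ) × (ℕ → D) => fun i => (1 * p.1 i, p.2 i)) = id := by
          funext p; simp
        rw [this, Measure.map_id]
    · exact measurable_pi_lambda _ fun i => measurable_comp_countable hz
        (measurableSet_decEnum_eq
          (w := fun (j : ℕ) (p : (ℕ → ℝ) × (ℕ → D)) => p.1 j * W (p.2 j)) (fun j => (hz j).fst) i)
  · filter_upwards [hP.ae_sortable hz hx hx1 hpos] with p hp using decEnum_isDecEnum hp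

end SortLaw
end GREM

namespace GREM

/-! ### Product measures -/

section ProductMeasures

lemma map_sumElim_infinitePi {ι κ X : Type*} [MeasurableSpace X] (μ : ι → Measure X)
    (ν : κ → Measure X) [∀ i, IsProbabilityMeasure (μ i)] [∀ i, IsProbabilityMeasure (ν i)] :
    ((Measure.infinitePi μ).prod (Measure.infinitePi ν)).map
        (fun p : (ι → X) × (κ → X) => (Sum.elim p.1 p.2 : ι ⊕ κ → X)) =
      Measure.infinitePi (Sum.elim μ ν : ι ⊕ κ → Measure X) := by
  have : ∀ i : ι ⊕ κ, IsProbabilityMeasure ((Sum.elim μ ν : ι ⊕ κ → Measure X) i) := by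
    rintro (i | i) <;> simp only [Sum.elim_inl, Sum.elim_inr] <;> infer_instance
  refine Measure.eq_infinitePi _ fun s t ht => ?_
  have hm : Measurable fun p : (ι → X) × (κ → X) => (Sum.elim p.1 p.2 : ι ⊕ κ → X) := by
    refine measurable_pi_lambda _ ?_
    rintro (i | i) <;> simp only [Sum.elim_inl, Sum.elim_inr] <;> fun_prop
  rw [Measure.map_apply hm (MeasurableSet.pi s.countable_toSet fun i _ => ht i)]
  have hpre : (fun p : (ι → X) × (κ → X) => (Sum.elim p.1 p.2 : ι ⊕ κ → X)) ⁻¹' (Set.pi s t) =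
      (Set.pi s.toLeft fun i => t (Sum.inl i)) ×ˢ (Set.pi s.toRight fun i => t (Sum.inr i)) := by
    ext p
    simp [Set.mem_pi]
  rw [hpre, Measure.prod_prod, Measure.infinitePi_pi _ (fun i _ => ht _),
    Measure.infinitePi_pi _ (fun i _ => ht _), Finset.prod_sum_eq_prod_toLeft_mul_prod_toRight]
  rfl

lemma map_pair_infinitePi {ι α β X : Type*} [MeasurableSpace X] (μ : ι → Measure X)
    [∀ i, IsProbabilityMeasure (μ i)] {f : α → ι} {g : β → ι} (hf : Function.Injective f)
    (hg : Function.Injective g) (hfg : ∀ a b, f a ≠ g b) :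
    (Measure.infinitePi μ).map (fun ω => ((fun a => ω (f a), fun b => ω (g b)) :
        (α → X) × (β → X))) =
      (Measure.infinitePi fun a => μ (f a)).prod (Measure.infinitePi fun b => μ (g b)) := by
  have h1 := Measure.map_infinitePi_infinitePi_of_inj (P := μ) (hf.sumElim hg hfg)
  have h2 : (fun i => μ (Sum.elim f g i)) =
      (Sum.elim (fun a => μ (f a)) (fun b => μ (g b)) : α ⊕ β → Measure X) := by
    funext i; rcases i with i | i <;> rfl
  have hs : Measurable fun p : (α → X) × (β → X) => (Sum.elim p.1 p.2 : α ⊕ β → X) := by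
    refine measurable_pi_lambda _ ?_
    rintro (i | i) <;> simp only [Sum.elim_inl, Sum.elim_inr] <;> fun_prop
  have hr : Measurable fun ω : α ⊕ β → X => ((fun a => ω (Sum.inl a), fun b => ω (Sum.inr b)) :
      (α → X) × (β → X)) := by fun_prop
  rw [h2, ← map_sumElim_infinitePi] at h1
  have h3 := congrArg (fun m => m.map fun ω : α ⊕ β → X =>
    ((fun a => ω (Sum.inl a), fun b => ω (Sum.inr b)) : (α → X) × (β → X))) h1
  rw [Measure.map_map hr (by fun_prop), Measure.map_map hr hs] at h3
  refine Eq.trans ?_ (h3.trans ?_)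
  · rfl
  · exact Measure.map_id

/-- The whole space is a square cylinder. -/
def spanningSquareCylinders {ι Z : Type*} [MeasurableSpace Z] (ν : ι → Measure Z)
    [∀ i, IsProbabilityMeasure (ν i)] : (Measure.infinitePi ν).FiniteSpanningSetsIn
      (squareCylinders fun _ : ι => {s : Set Z | MeasurableSet s}) :=
  ⟨fun _ => univ, fun _ => ⟨∅, fun _ => univ, fun _ _ => MeasurableSet.univ, by simp⟩,
    fun _ => by simp, iUnion_const _⟩

lemma map_unzip_infinitePi {ι X Y : Type*} [MeasurableSpace X] [MeasurableSpace Y]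
    (μ : ι → Measure X) (ν : ι → Measure Y) [∀ i, IsProbabilityMeasure (μ i)]
    [∀ i, IsProbabilityMeasure (ν i)] :
    (Measure.infinitePi fun i => (μ i).prod (ν i)).map
        (fun m => ((fun i => (m i).1, fun i => (m i).2) : (ι → X) × (ι → Y))) =
      (Measure.infinitePi μ).prod (Measure.infinitePi ν) := by
  classical
  symm
  refine Measure.prod_eq_generateFrom generateFrom_squareCylinders generateFrom_squareCylinders
    (isPiSystem_squareCylinders (fun _ => MeasurableSpace.isPiSystem_measurableSet) (by simp))
    (isPiSystem_squareCylinders (fun _ => MeasurableSpace.isPiSystem_measurableSet) (by simp))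
    (spanningSquareCylinders μ) (spanningSquareCylinders ν) ?_
  rintro _ ⟨s, a, ha, rfl⟩ _ ⟨t, b, hb, rfl⟩
  have ha' : ∀ i, MeasurableSet (a i) := by simpa using ha
  have hb' : ∀ i, MeasurableSet (b i) := by simpa using hb
  rw [Measure.map_apply (by fun_prop) ((MeasurableSet.pi s.countable_toSet fun i _ => ha' i).prod
    (MeasurableSet.pi t.countable_toSet fun i _ => hb' i))]
  have hpre : (fun m : ι → X × Y => ((fun i => (m i).1, fun i => (m i).2) : (ι → X) × (ι → Y))) ⁻¹'
      (Set.pi s a ×ˢ Set.pi t b) = Set.pi ((s ∪ t : Finset ι) : Set ι)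
        (fun i => (if i ∈ s then a i else univ) ×ˢ (if i ∈ t then b i else univ)) := by
    ext m
    simp only [mem_preimage, mem_prod, Set.mem_pi, Finset.mem_coe, Finset.coe_union, mem_union]
    constructor
    · rintro ⟨h1, h2⟩ i -
      constructor
      · split_ifs with h; exacts [h1 i h, mem_univ _]
      · split_ifs with h; exacts [h2 i h, mem_univ _]
    · intro h
      exact ⟨fun i hi => by simpa [hi] using (h i (Or.inl hi)).1,
        fun i hi => by simpa [hi] using (h i (Or.inr hi)).2⟩
  rw [hpre, Measure.infinitePi_pi, Measure.infinitePi_pi _ (fun i _ => ha' i),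
    Measure.infinitePi_pi _ (fun i _ => hb' i)]
  · simp_rw [Measure.prod_prod]
    rw [Finset.prod_mul_distrib]
    congr 1
    · rw [← Finset.prod_subset (Finset.subset_union_left (s₂ := t)) fun i _ hi => by simp [hi]]
      exact Finset.prod_congr rfl fun i hi => by simp [hi]
    · rw [← Finset.prod_subset (Finset.subset_union_right (s₁ := s)) fun i _ hi => by simp [hi]]
      exact Finset.prod_congr rfl fun i hi => by simp [hi]
  · intro i _
    refine MeasurableSet.prod ?_ ?_
    · split_ifs; exacts [ha' i, .univ]
    · split_ifs; exacts [hb' i, .univ]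

/-! ### Families indexed by the inner vertices of the tree -/

variable {X : Type*}

/-- The law of an independent family indexed by the inner vertices, with law `μ l` at depth `l`. -/
noncomputable def treeMeas [MeasurableSpace X] (μ : ℕ → Measure X) (d : ℕ) : Measure (Vertex d → X) :=
  Measure.infinitePi fun v : Vertex d => μ v.1

instance [MeasurableSpace X] (μ : ℕ → Measure X) [∀ l, IsProbabilityMeasure (μ l)] (d : ℕ) :
    IsProbabilityMeasure (treeMeas μ d) := by
  unfold treeMeas; infer_instance

/-- An inner vertex is the root, or a vertex of the subtree above a child of the root. -/
def vertexCode {d : ℕ} (v : Vertex (d + 1)) : Unit ⊕ (ℕ × Vertex d) :=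
  Fin.cases (motive := fun l : Fin (d + 1) => (Fin l → ℕ) → Unit ⊕ (ℕ × Vertex d))
    (fun _ => Sum.inl ()) (fun m u => Sum.inr (u ⟨0, Nat.succ_pos _⟩, ⟨m, fun i => u i.succ⟩))
    v.1 v.2

/-- The vertex `v` of the subtree above the child `j` of the root. -/
def vertexCons {d : ℕ} (j : ℕ) (v : Vertex d) : Vertex (d + 1) :=
  ⟨v.1.succ, fun i => Fin.cases (motive := fun _ => ℕ) j v.2 i⟩

/-- The root of the tree. -/
def vertexRoot (d : ℕ) : Vertex (d + 1) := ⟨0, fun i => i.elim0⟩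

lemma vertexCode_root (d : ℕ) : vertexCode (vertexRoot d) = Sum.inl () := rfl

lemma vertexCode_cons {d : ℕ} (j : ℕ) (v : Vertex d) :
    vertexCode (vertexCons j v) = Sum.inr (j, v) := rfl

lemma vertex_cases {d : ℕ} (v : Vertex (d + 1)) :
    v = vertexRoot d ∨ ∃ j w, v = vertexCons j w := by
  obtain ⟨l, u⟩ := v
  induction l using Fin.cases with
  | zero => left; rw [vertexRoot]; congr 1; funext i; exact i.elim0
  | succ m =>
    right
    refine ⟨u ⟨0, Nat.succ_pos _⟩, ⟨m, fun i => u i.succ⟩, ?_⟩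
    rw [vertexCons]
    congr 1
    funext i
    induction i using Fin.cases with
    | zero => rfl
    | succ i => rfl

lemma vertexCode_injective {d : ℕ} : Function.Injective (vertexCode (d := d)) := fun v w h => by
  rcases vertex_cases v with rfl | ⟨j, v, rfl⟩ <;> rcases vertex_cases w with rfl | ⟨j', w, rfl⟩
  · rfl
  · rw [vertexCode_root, vertexCode_cons] at h; cases h
  · rw [vertexCode_root, vertexCode_cons] at h; cases h
  · rw [vertexCode_cons, vertexCode_cons] at h; cases h; rfl

/-- Assemble a family from its value at the root and from the families on the subtrees. -/
def glueVertex {d : ℕ} (p : X × (ℕ → Vertex d → X)) (v : Vertex (d + 1)) : X :=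
  Sum.elim (fun _ => p.1) (fun jw => p.2 jw.1 jw.2) (vertexCode v)

lemma glueVertex_root {d : ℕ} (p : X × (ℕ → Vertex d → X)) :
    glueVertex p (vertexRoot d) = p.1 := rfl

lemma glueVertex_cons {d : ℕ} (p : X × (ℕ → Vertex d → X)) (j : ℕ) (v : Vertex d) :
    glueVertex p (vertexCons j v) = p.2 j v := rfl

variable [MeasurableSpace X]

lemma measurable_glueVertex {d : ℕ} : Measurable (glueVertex (X := X) (d := d)) := by
  refine measurable_pi_lambda _ fun v => ?_
  rcases vertex_cases v with rfl | ⟨j, w, rfl⟩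
  · exact measurable_fst
  · exact (measurable_pi_apply w).comp ((measurable_pi_apply j).comp measurable_snd)

/-- The recursive form of the product over the vertices: an inner vertex is the root or a pair of a
child and a vertex above it, so the product measure is reindexed along `vertexCode`. -/
lemma treeMeas_succ (μ : ℕ → Measure X) [∀ l, IsProbabilityMeasure (μ l)] (d : ℕ) :
    treeMeas μ (d + 1) = ((μ 0).prod (Measure.infinitePi fun _ : ℕ =>
      treeMeas (fun l => μ (l + 1)) d)).map glueVertex := by
  have h1 : (μ 0).prod (Measure.infinitePi fun _ : ℕ => treeMeas (fun l => μ (l + 1)) d) =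
      ((Measure.infinitePi fun _ : Unit => μ 0).prod
        (Measure.infinitePi fun p : ℕ × Vertex d => μ (p.2.1 + 1))).map
          (Prod.map (fun f => f ()) Function.curry) := by
    rw [← Measure.map_prod_map _ _ (by fun_prop) (by
      exact (MeasurableEquiv.curry ℕ (Vertex d) X).measurable)]
    congr 1
    · exact (Measure.infinitePi_map_eval (fun _ : Unit => μ 0) ()).symm
    · exact (Measure.infinitePi_map_curry (fun (_ : ℕ) (v : Vertex d) => μ (v.1 + 1))).symm
  have hP : Measurable (Prod.map (fun f : Unit → X => f ()) (Function.curry (α := ℕ)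
      (β := Vertex d) (φ := X))) :=
    (measurable_pi_apply ()).prodMap (MeasurableEquiv.curry ℕ (Vertex d) X).measurable
  have hprob : ∀ i : Unit ⊕ (ℕ × Vertex d), IsProbabilityMeasure
      ((Sum.elim (fun _ : Unit => μ 0) fun p : ℕ × Vertex d => μ (p.2.1 + 1) :
        Unit ⊕ (ℕ × Vertex d) → Measure X) i) := by
    rintro (i | i) <;> simp only [Sum.elim_inl, Sum.elim_inr] <;> infer_instance
  have h2 := Measure.map_infinitePi_infinitePi_of_inj (P := Sum.elim (fun _ : Unit => μ 0)
    fun p : ℕ × Vertex d => μ (p.2.1 + 1)) (vertexCode_injective (d := d))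
  have h3 : (fun v : Vertex (d + 1) => (Sum.elim (fun _ : Unit => μ 0)
      (fun p : ℕ × Vertex d => μ (p.2.1 + 1)) (vertexCode v))) = fun v => μ v.1 := by
    funext v
    rcases vertex_cases v with rfl | ⟨j, w, rfl⟩ <;> rfl
  have hs : Measurable fun p : (Unit → X) × (ℕ × Vertex d → X) =>
      (Sum.elim p.1 p.2 : Unit ⊕ (ℕ × Vertex d) → X) := by
    refine measurable_pi_lambda _ ?_
    rintro (i | i) <;> simp only [Sum.elim_inl, Sum.elim_inr] <;> fun_prop
  rw [treeMeas, ← h3, ← h2, ← map_sumElim_infinitePi, Measure.map_map (by fun_prop) hs, h1,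
    Measure.map_map measurable_glueVertex hP]
  congr 1

end ProductMeasures
end GREM

namespace GREM

/-! ### Branching Markov chains indexed by the leaves of the tree -/

section TreeLaw

variable {E : Type*}

/-- Assemble a family on the leaves from the families on the subtrees. -/
def glueLeaf {d : ℕ} (g : ℕ → (Fin d → ℕ) → E) (α : Fin (d + 1) → ℕ) : E :=
  g (α 0) (Fin.tail α)

variable [MeasurableSpace E]

lemma measurable_glueLeaf {d : ℕ} : Measurable (glueLeaf (E := E) (d := d)) :=
  measurable_pi_lambda _ fun α => (measurable_pi_apply _).comp (measurable_pi_apply _)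

/-- The law of the final values of a branching Markov chain on the tree of depth `d`, started at
`y`; the step at depth `l` has the transition kernel `K l`. -/
noncomputable def treeLaw : (d : ℕ) → (ℕ → Kernel E E) → E → Measure ((Fin d → ℕ) → E)
  | 0, _, y => Measure.dirac fun _ => y
  | d + 1, K, y => (Measure.infinitePi fun _ : ℕ =>
      (K 0 y).bind (treeLaw d fun l => K (l + 1))).map glueLeaf

lemma measurable_infinitePi_const {X Z : Type*} [MeasurableSpace X] [MeasurableSpace Z]
    {μ : X → Measure Z} (h : ∀ y, IsProbabilityMeasure (μ y)) (hμ : Measurable μ) :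
    Measurable fun y => Measure.infinitePi fun _ : ℕ => μ y := by
  refine Measurable.measure_of_isPiSystem_of_isProbabilityMeasure
    generateFrom_squareCylinders.symm (isPiSystem_squareCylinders
      (fun _ => MeasurableSpace.isPiSystem_measurableSet) (by simp)) ?_
  rintro _ ⟨s, a, ha, rfl⟩
  have ha' : ∀ i, MeasurableSet (a i) := by simpa using ha
  simp_rw [Measure.infinitePi_pi _ (fun i _ => ha' i)]
  exact Finset.measurable_prod _ fun i _ => (Measure.measurable_coe (ha' i)).comp hμ

lemma treeLaw_aux (d : ℕ) (K : ℕ → Kernel E E) [∀ l, IsMarkovKernel (K l)] :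
    (∀ y, IsProbabilityMeasure (treeLaw d K y)) ∧ Measurable (treeLaw d K) := by
  induction d generalizing K with
  | zero =>
    refine ⟨fun y => ?_, ?_⟩
    · rw [treeLaw]; infer_instance
    · exact Measure.measurable_dirac.comp (measurable_pi_lambda _ fun _ => measurable_id)
  | succ d ih =>
    obtain ⟨h1, h2⟩ := ih fun l => K (l + 1)
    let κ : Kernel E ((Fin d → ℕ) → E) := ⟨_, h2⟩
    have : IsMarkovKernel κ := ⟨h1⟩
    have hp : ∀ y, IsProbabilityMeasure ((K 0 y).bind (treeLaw d fun l => K (l + 1))) := by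
      intro y
      change IsProbabilityMeasure (κ ∘ₘ (K 0 y))
      infer_instance
    have hm : Measurable fun y => (K 0 y).bind (treeLaw d fun l => K (l + 1)) :=
      (Measure.measurable_bind' h2).comp (K 0).measurable
    refine ⟨fun y => ?_, ?_⟩
    · rw [treeLaw]
      exact Measure.isProbabilityMeasure_map measurable_glueLeaf.aemeasurable
    · exact (Measure.measurable_map _ measurable_glueLeaf).comp (measurable_infinitePi_const hp hm)

variable (d : ℕ) (K : ℕ → Kernel E E) [∀ l, IsMarkovKernel (K l)]

instance (y : E) : IsProbabilityMeasure (treeLaw d K y) := (treeLaw_aux d K).1 y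

lemma measurable_treeLaw : Measurable (treeLaw d K) := (treeLaw_aux d K).2

/-- The branching Markov chain as a kernel. -/
noncomputable def treeKernel : Kernel E ((Fin d → ℕ) → E) := ⟨treeLaw d K, measurable_treeLaw d K⟩

lemma treeKernel_apply (y : E) : treeKernel d K y = treeLaw d K y := rfl

instance : IsMarkovKernel (treeKernel d K) := ⟨fun y => inferInstanceAs
  (IsProbabilityMeasure (treeLaw d K y))⟩

/-- The law of the branching chain above one child of the root. -/
noncomputable def childLaw (y : E) : Measure ((Fin d → ℕ) → E) :=
  treeKernel d (fun l => K (l + 1)) ∘ₘ K 0 y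

instance (y : E) : IsProbabilityMeasure (childLaw d K y) := by
  unfold childLaw; infer_instance

lemma treeLaw_zero (y : E) : treeLaw 0 K y = Measure.dirac fun _ => y := rfl

lemma treeLaw_succ (y : E) : treeLaw (d + 1) K y =
    (Measure.infinitePi fun _ : ℕ => childLaw d K y).map glueLeaf := rfl

lemma ae_infinitePi {ι Z : Type*} [Countable ι] [MeasurableSpace Z] {μ : ι → Measure Z}
    [∀ i, IsProbabilityMeasure (μ i)] {p : ι → Z → Prop} (h : ∀ i, ∀ᵐ z ∂μ i, p i z) :
    ∀ᵐ z ∂Measure.infinitePi μ, ∀ i, p i (z i) :=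
  ae_all_iff.2 fun i => (measurePreserving_eval_infinitePi μ i).quasiMeasurePreserving.ae (h i)

variable {K}

/-- A quantity kept by every step has the same value at all leaves. It is applied to the weight of
the first step of a subtree, which can then be read off at any leaf of that subtree. -/
lemma ae_treeLaw_eq {u : E → ℝ} (hu : Measurable u) (h : ∀ m y, ∀ᵐ p ∂K m y, u p = u y) (y : E) :
    ∀ᵐ f ∂treeLaw d K y, ∀ α, u (f α) = u y := by
  have hset : ∀ d (c : ℝ), MeasurableSet {f : (Fin d → ℕ) → E | ∀ α, u (f α) = c} := fun d c => by
    have : {f : (Fin d → ℕ) → E | ∀ α, u (f α) = c} = ⋂ α, {f | u (f α) = c} := by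
      ext; simp [mem_ofPred_eq]
    rw [this]
    exact MeasurableSet.iInter fun α => measurableSet_eq_fun (by fun_prop) measurable_const
  induction d generalizing K y with
  | zero =>
    rw [treeLaw_zero, ae_dirac_iff (hset 0 _)]
    exact fun _ => rfl
  | succ d ih =>
    rw [treeLaw_succ, ae_map_iff measurable_glueLeaf.aemeasurable (hset _ _)]
    have h1 : ∀ᵐ f ∂childLaw d K y, ∀ α, u (f α) = u y := by
      refine Measure.ae_comp_of_ae_ae (hset _ _) ?_
      filter_upwards [h 0 y] with p hp
      rw [← hp]
      exact ih (fun m => h (m + 1)) p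
    filter_upwards [ae_infinitePi (fun _ : ℕ => h1)] with g hg α using hg _ _

end TreeLaw

/-! ### Tilting the kernels -/

section Tilt

variable {E : Type*} [MeasurableSpace E]

/-- Weights `w l` such that `w l ^ x l` is a density for every `K l y`, and `w l` is constant along
the steps of the chain after the one at depth `l`. -/
structure TiltData (x : ℕ → ℝ) (K : ℕ → Kernel E E) (w : ℕ → E → ℝ) : Prop where
  measurable : ∀ l, Measurable (w l)
  pos : ∀ l p, 0 < w l p
  lintegral : ∀ l y, ∫⁻ p, ENNReal.ofReal (w l p ^ x l) ∂K l y = 1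
  preserved : ∀ l m, l < m → ∀ y, ∀ᵐ p ∂K m y, w l p = w l y

/-- The kernels `K l` with density `w l ^ x l`. -/
noncomputable def tilt (x : ℕ → ℝ) (K : ℕ → Kernel E E) [∀ l, IsMarkovKernel (K l)]
    (w : ℕ → E → ℝ) (l : ℕ) : Kernel E E :=
  (K l).withDensity fun _ p => ENNReal.ofReal (w l p ^ x l)

variable {x : ℕ → ℝ} {K : ℕ → Kernel E E} [∀ l, IsMarkovKernel (K l)] {w : ℕ → E → ℝ}

lemma TiltData.shift (h : TiltData x K w) :
    TiltData (fun l => x (l + 1)) (fun l => K (l + 1)) fun l => w (l + 1) :=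
  ⟨fun l => h.measurable _, fun l => h.pos _, fun l => h.lintegral _,
    fun l m hlm => h.preserved _ _ (by omega)⟩

lemma TiltData.measurable_rpow (h : TiltData x K w) (l : ℕ) :
    Measurable fun p => ENNReal.ofReal (w l p ^ x l) :=
  ((h.measurable l).pow_const _).ennreal_ofReal

lemma TiltData.tilt_apply (h : TiltData x K w) (l : ℕ) (y : E) :
    tilt x K w l y = (K l y).withDensity fun p => ENNReal.ofReal (w l p ^ x l) := by
  rw [tilt, Kernel.withDensity_apply _ (by
    exact (h.measurable_rpow l).comp measurable_snd)]

lemma TiltData.isMarkovKernel_tilt (h : TiltData x K w) (l : ℕ) : IsMarkovKernel (tilt x K w l) :=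
  ⟨fun y => ⟨by rw [h.tilt_apply, withDensity_apply _ .univ, setLIntegral_univ, h.lintegral]⟩⟩

lemma TiltData.preserved_tilt (h : TiltData x K w) (l m : ℕ) (hlm : l < m) (y : E) :
    ∀ᵐ p ∂tilt x K w m y, w l p = w l y := by
  rw [h.tilt_apply]
  exact (withDensity_absolutelyContinuous _ _).ae_le (h.preserved l m hlm y)

/-- The law of a subtree is tilted by tilting the first step. -/
lemma childLaw_withDensity {K' : ℕ → Kernel E E} [∀ l, IsMarkovKernel (K' l)] {κ : Kernel E E}
    [IsMarkovKernel κ] (d : ℕ) {u : E → ℝ} (hu : Measurable u) (y : E) {φ : ℝ → ℝ≥0∞}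
    (hφ : Measurable φ)
    (h : ∀ m y, ∀ᵐ p ∂K' m y, u p = u y) (hκ : κ y = (K 0 y).withDensity fun p => φ (u p)) :
    (treeKernel d K' ∘ₘ K 0 y).withDensity (fun f => φ (u (f 0))) = treeKernel d K' ∘ₘ κ y := by
  have hm : Measurable fun f : (Fin d → ℕ) → E => φ (u (f 0)) := by fun_prop
  ext A hA
  rw [withDensity_apply _ hA, ← lintegral_indicator hA,
    Measure.lintegral_bind (Kernel.aemeasurable _) ((hm.indicator hA).aemeasurable),
    Measure.bind_apply hA (Kernel.aemeasurable _), hκ,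
    lintegral_withDensity_eq_lintegral_mul _ (by fun_prop) (Kernel.measurable_coe _ hA)]
  refine lintegral_congr fun p => ?_
  simp only [Pi.mul_apply]
  rw [← lintegral_indicator_one hA, ← lintegral_const_mul _ (measurable_one.indicator hA)]
  refine lintegral_congr_ae ?_
  rw [treeKernel_apply]
  -- The density is evaluated at leaf `0`, but `u` is unchanged after the first step, so it is a
  -- function of the state `p` reached by that step and can be moved into the first kernel.
  filter_upwards [ae_treeLaw_eq d hu h p] with f hf
  by_cases hfA : f ∈ A <;> simp [hfA, hf]

end Tilt

end GREM

namespace GREM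

/-! ### Reordering a tilted cascade -/

section Relabel

/-- The weight of a leaf. -/
def treeWt {d : ℕ} (Z : Vertex d → ℕ → ℝ) (α : Fin d → ℕ) : ℝ :=
  ∏ l : Fin d, Z (vertex α l) (α l)

lemma vertex_zero {d : ℕ} (α : Fin (d + 1) → ℕ) : vertex α 0 = vertexRoot d := by
  rw [vertex, vertexRoot]
  congr 1
  funext i
  exact i.elim0

lemma vertex_succ {d : ℕ} (α : Fin (d + 1) → ℕ) (l : Fin d) :
    vertex α l.succ = vertexCons (α 0) (vertex (Fin.tail α) l) := by
  rw [vertex, vertexCons]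
  congr 1
  funext i
  induction i using Fin.cases with
  | zero => rfl
  | succ i => rfl

lemma measurableSet_forall_mem {ι X : Type*} [Countable ι] [MeasurableSpace X] {s : ι → Set X}
    (h : ∀ i, MeasurableSet (s i)) : MeasurableSet {x | ∀ i, x ∈ s i} := by
  have : {x | ∀ i, x ∈ s i} = ⋂ i, s i := by ext; simp
  rw [this]
  exact .iInter h

lemma treeWt_glueVertex {d : ℕ} (p : (ℕ → ℝ) × (ℕ → Vertex d → ℕ → ℝ)) (α : Fin (d + 1) → ℕ) :
    treeWt (glueVertex p) α = p.1 (α 0) * treeWt (p.2 (α 0)) (Fin.tail α) := by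
  rw [treeWt, Fin.prod_univ_succ, vertex_zero, glueVertex_root]
  simp_rw [vertex_succ, glueVertex_cons]
  rfl

lemma agree_zero {k : ℕ} (α β : Fin k → ℕ) : Agree 0 α β := fun i hi => absurd hi (by omega)

lemma agree_self_iff {k l : ℕ} (hl : k ≤ l) (α β : Fin k → ℕ) : Agree l α β ↔ α = β :=
  ⟨fun h => funext fun i => h i (by omega), fun h i _ => h ▸ rfl⟩

lemma Agree.mono {k l m : ℕ} {α β : Fin k → ℕ} (h : Agree m α β) (hlm : l ≤ m) : Agree l α β :=
  fun i hi => h i (by omega)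

lemma agree_succ {d : ℕ} (l : ℕ) (α β : Fin (d + 1) → ℕ) :
    Agree (l + 1) α β ↔ α 0 = β 0 ∧ Agree l (Fin.tail α) (Fin.tail β) := by
  refine ⟨fun h => ⟨h 0 (by simp), fun i hi => h i.succ (by simpa using hi)⟩, fun h i hi => ?_⟩
  induction i using Fin.cases with
  | zero => exact h.1
  | succ i => exact h.2 i (by simpa using hi)

/-- The automorphisms of the tree, as maps on the leaves. -/
def IsTreeAut {d : ℕ} (σ : (Fin d → ℕ) → Fin d → ℕ) : Prop :=
  Function.Surjective σ ∧ ∀ l α β, Agree l (σ α) (σ β) ↔ Agree l α β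

lemma IsTreeAut.injective {d : ℕ} {σ : (Fin d → ℕ) → Fin d → ℕ} (h : IsTreeAut σ) :
    Function.Injective σ := fun α β hαβ =>
  (agree_self_iff le_rfl α β).1 ((h.2 d α β).1 ((agree_self_iff le_rfl _ _).2 hαβ))

lemma isTreeAut_id (d : ℕ) : IsTreeAut (id : (Fin d → ℕ) → Fin d → ℕ) :=
  ⟨Function.surjective_id, fun _ _ _ => Iff.rfl⟩

/-- The children of the root are permuted by `e`, and each subtree has its own automorphism. These
are indexed by the child before the permutation, whence `σ (e (α 0))`. -/
lemma IsTreeAut.cons {d : ℕ} {e : ℕ → ℕ} (he : Function.Bijective e)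
    {σ : ℕ → (Fin d → ℕ) → Fin d → ℕ} (hσ : ∀ j, IsTreeAut (σ j)) :
    IsTreeAut fun α : Fin (d + 1) → ℕ =>
      (Fin.cons (e (α 0)) (σ (e (α 0)) (Fin.tail α)) : Fin (d + 1) → ℕ) := by
  refine ⟨fun β => ?_, fun l α β => ?_⟩
  · obtain ⟨a, ha⟩ := he.2 (β 0)
    obtain ⟨γ, hγ⟩ := (hσ (β 0)).1 (Fin.tail β)
    refine ⟨Fin.cons a γ, ?_⟩
    simp only [Fin.cons_zero, ha, Fin.tail_cons, hγ, Fin.cons_self_tail]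
  · cases l with
    | zero => exact ⟨fun _ => agree_zero _ _, fun _ => agree_zero _ _⟩
    | succ l =>
      rw [agree_succ, agree_succ]
      simp only [Fin.cons_zero, Fin.tail_cons]
      constructor
      · rintro ⟨h1, h2⟩
        have h3 := he.1 h1
        rw [h3] at h2
        exact ⟨h3, ((hσ _).2 _ _ _).1 h2⟩
      · rintro ⟨h1, h2⟩
        rw [h1]
        exact ⟨rfl, ((hσ _).2 _ _ _).2 h2⟩

end Relabel

/-! ### Reordering the whole tree, by induction on its depth -/

section Reorder

variable {E : Type*}

/-- The processes on the tree together with the field on the leaves. -/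
abbrev TreeSpace (d : ℕ) (E : Type*) : Type _ := (Vertex d → ℕ → ℝ) × ((Fin d → ℕ) → E)

/-- Assemble the tree from the process at the root and the subtrees. -/
def joinTree {d : ℕ} (p : (ℕ → ℝ) × (ℕ → TreeSpace d E)) : TreeSpace (d + 1) E :=
  (glueVertex (p.1, fun j => (p.2 j).1), glueLeaf fun j => (p.2 j).2)

/-- The process at the root and the subtrees. -/
def splitTree {d : ℕ} (p : TreeSpace (d + 1) E) : (ℕ → ℝ) × (ℕ → TreeSpace d E) :=
  (p.1 (vertexRoot d), fun j => (fun v => p.1 (vertexCons j v), fun β => p.2 (Fin.cons j β)))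

lemma joinTree_splitTree {d : ℕ} (p : TreeSpace (d + 1) E) : joinTree (splitTree p) = p := by
  refine Prod.ext (funext fun v => ?_) (funext fun α => ?_)
  · rcases vertex_cases v with rfl | ⟨j, v, rfl⟩ <;> rfl
  · change p.2 (Fin.cons (α 0) (Fin.tail α)) = p.2 α
    rw [Fin.cons_self_tail]

variable [MeasurableSpace E]

lemma measurable_joinTree {d : ℕ} : Measurable (joinTree (E := E) (d := d)) := by
  refine (measurable_glueVertex.comp (by fun_prop)).prodMk (measurable_glueLeaf.comp (by fun_prop))

lemma measurable_splitTree {d : ℕ} : Measurable (splitTree (E := E) (d := d)) := by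
  unfold splitTree; fun_prop

/-- Regroups independent subtrees carrying a pair (processes, field) into the processes of the whole
tree and an independent field. -/
lemma map_joinTree {d : ℕ} (μ : Measure (ℕ → ℝ)) [IsProbabilityMeasure μ]
    (R : Measure (Vertex d → ℕ → ℝ)) [IsProbabilityMeasure R]
    (L : Measure ((Fin d → ℕ) → E)) [IsProbabilityMeasure L] :
    (μ.prod (Measure.infinitePi fun _ : ℕ => R.prod L)).map joinTree =
      ((μ.prod (Measure.infinitePi fun _ : ℕ => R)).map glueVertex).prod
        ((Measure.infinitePi fun _ : ℕ => L).map glueLeaf) := by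
  have hu : Measurable fun m : ℕ → TreeSpace d E => ((fun i => (m i).1, fun i => (m i).2) :
    (ℕ → Vertex d → ℕ → ℝ) × (ℕ → (Fin d → ℕ) → E)) := by fun_prop
  have h1 := map_unzip_infinitePi (fun _ : ℕ => R) fun _ : ℕ => L
  have hg := measurable_glueVertex (X := ℕ → ℝ) (d := d)
  have hl := measurable_glueLeaf (E := E) (d := d)
  have h2 := (measurePreserving_prodAssoc μ (Measure.infinitePi fun _ : ℕ => R)
    (Measure.infinitePi fun _ : ℕ => L)).symm.map_eq
  rw [Measure.map_prod_map _ _ hg hl, ← h2, Measure.map_map (hg.prodMap hl)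
    (MeasurableEquiv.measurable _), ← h1]
  have h3 := Measure.map_prod_map μ (Measure.infinitePi fun _ : ℕ => R.prod L) measurable_id hu
  rw [Measure.map_id] at h3
  rw [h3, Measure.map_map ((hg.prodMap hl).comp (MeasurableEquiv.measurable _))
    (measurable_id.prodMap hu)]
  rfl

lemma lintegral_prod_comp {X Y Z : Type*} [MeasurableSpace X] [MeasurableSpace Y]
    [MeasurableSpace Z] (R : Measure X) [SFinite R] (κ : Kernel Y Z) [IsMarkovKernel κ]
    (μ : Measure Y) [IsProbabilityMeasure μ] {F : X × Z → ℝ≥0∞} (hF : Measurable F) :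
    ∫⁻ p, F p ∂(R.prod (κ ∘ₘ μ)) = ∫⁻ y, ∫⁻ p, F p ∂(R.prod (κ y)) ∂μ := by
  rw [lintegral_prod_symm' _ hF, Measure.lintegral_bind (Kernel.aemeasurable _)
    (Measurable.lintegral_prod_left' hF).aemeasurable]
  exact lintegral_congr fun y => (lintegral_prod_symm' _ hF).symm

/-- Since `S` does not depend on the starting point `y`, an identity valid for every `y` passes to a
random start. -/
lemma map_prod_comp {X Y Z W : Type*} [MeasurableSpace X] [MeasurableSpace Y] [MeasurableSpace Z]
    [MeasurableSpace W] (R : Measure X) [SFinite R] (κ : Kernel Y Z) [IsMarkovKernel κ]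
    (κ' : Kernel Y W) [IsMarkovKernel κ']
    (μ : Measure Y) [IsProbabilityMeasure μ] {S : X × Z → X × W} (hS : Measurable S)
    (h : ∀ y, (R.prod (κ y)).map S = R.prod (κ' y)) :
    (R.prod (κ ∘ₘ μ)).map S = R.prod (κ' ∘ₘ μ) := by
  refine Measure.ext_of_lintegral _ fun F hF => ?_
  rw [lintegral_map hF hS, lintegral_prod_comp _ _ _ hF]
  have h1 : Measurable fun p => F (S p) := hF.comp hS
  rw [lintegral_prod_comp _ _ _ h1]
  refine lintegral_congr fun y => ?_
  rw [← h, lintegral_map hF hS]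

lemma ae_prod_comp {X Y Z : Type*} [MeasurableSpace X] [MeasurableSpace Y]
    [MeasurableSpace Z] (R : Measure X) [SFinite R] (κ : Kernel Y Z) [IsMarkovKernel κ]
    (μ : Measure Y) [IsProbabilityMeasure μ] {G : Set (X × Z)} (hG : MeasurableSet G)
    (h : ∀ y, ∀ᵐ p ∂(R.prod (κ y)), p ∈ G) : ∀ᵐ p ∂(R.prod (κ ∘ₘ μ)), p ∈ G := by
  have h0 : (R.prod (κ ∘ₘ μ)) Gᶜ = 0 := by
    rw [← lintegral_indicator_one hG.compl,
      lintegral_prod_comp _ _ _ (measurable_one.indicator hG.compl)]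
    simp_rw [lintegral_indicator_one hG.compl]
    rw [lintegral_congr fun y => (show (R.prod (κ y)) Gᶜ = 0 from h y)]
    simp
  exact h0

/-- The heart of the proof. Each subtree above a child of the root is treated as the mark of that
child. Reordering inside the subtrees absorbs the weights at depths at least `1` and tilts the
kernels there. What remains is the weight at depth `0`, a function of the mark, and `map_sortMarks`
at the root absorbs it while tilting the first step. The map `S` and the good set `G` are
independent of the starting point `y`, and `G` is measurable; both facts are needed to integrate
over `y` in the induction. -/
theorem exists_reorder (d : ℕ) {x : ℕ → ℝ} (hx : ∀ l, 0 < x l) (hx1 : ∀ l, x l < 1)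
    {ρ : ℕ → Measure (ℕ → ℝ)} (hρ : ∀ l, IsREMLaw (x l) (ρ l)) {K : ℕ → Kernel E E}
    [∀ l, IsMarkovKernel (K l)] {w : ℕ → E → ℝ} (h : TiltData x K w) :
    ∃ S : TreeSpace d E → TreeSpace d E, Measurable S ∧
      (∀ y, ((treeMeas ρ d).prod (treeLaw d K y)).map S =
        (treeMeas ρ d).prod (treeLaw d (tilt x K w) y)) ∧
      ∃ G : Set (TreeSpace d E), MeasurableSet G ∧
        (∀ y, ∀ᵐ p ∂(treeMeas ρ d).prod (treeLaw d K y), p ∈ G) ∧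
        ∀ p ∈ G, ∃ σ, IsTreeAut σ ∧ (∀ α, (S p).2 α = p.2 (σ α)) ∧
          ∀ α, treeWt p.1 (σ α) * ∏ l ∈ Finset.range d, w l (p.2 (σ α)) = treeWt (S p).1 α := by
  induction d generalizing x ρ K w with
  | zero =>
    refine ⟨id, measurable_id, fun y => ?_, univ, .univ, fun y => by simp, fun p _ =>
      ⟨id, isTreeAut_id 0, fun α => rfl, fun α => by simp⟩⟩
    rw [Measure.map_id]
    rfl
  | succ d ih =>
    obtain ⟨S', hS', hmap, G', hG', hG'ae, hσ⟩ := ih (fun l => hx (l + 1)) (fun l => hx1 (l + 1))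
      (fun l => hρ (l + 1)) h.shift
    have hρp : ∀ l, IsProbabilityMeasure (ρ l) := fun l => (hρ l).isProbabilityMeasure
    have hmk := h.isMarkovKernel_tilt
    have hmk' := h.shift.isMarkovKernel_tilt
    set R' := treeMeas (fun l => ρ (l + 1)) d with hR'
    set Kt' : ℕ → Kernel E E := tilt (fun l => x (l + 1)) (fun l => K (l + 1)) fun l => w (l + 1)
      with hKt'
    -- Leaf `0` is an arbitrary choice: almost surely `w 0` is constant on the leaves of a subtree.
    let W : TreeSpace d E → ℝ := fun m => w 0 (m.2 0)
    have hW : Measurable W := (h.measurable 0).comp (by fun_prop)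
    -- the law of the marks after reordering the subtrees
    have hN : ∀ y, (R'.prod (childLaw d K y)).map S' =
        R'.prod (treeKernel d Kt' ∘ₘ K 0 y) := fun y =>
      map_prod_comp R' (treeKernel d fun l => K (l + 1)) (treeKernel d Kt') (K 0 y) hS' hmap
    have hpres : ∀ m y, ∀ᵐ p ∂Kt' m y, w 0 p = w 0 y := fun m y =>
      h.preserved_tilt 0 (m + 1) (by omega) y
    -- At this stage the deeper kernels are tilted and the first step is not. The tilted kernels
    -- still preserve `w 0`, so the density `W ^ x 0` of the marks acts on the first step alone.
    have htilt : ∀ y, (R'.prod (treeKernel d Kt' ∘ₘ K 0 y)).withDensity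
        (fun m => ENNReal.ofReal (W m ^ x 0)) = R'.prod (childLaw d (tilt x K w) y) := by
      intro y
      have := childLaw_withDensity (K := K) (K' := Kt') (κ := tilt x K w 0) d (h.measurable 0) y
        (φ := fun t => ENNReal.ofReal (t ^ x 0)) (by fun_prop) hpres (h.tilt_apply 0 y)
      have hm : Measurable fun f : (Fin d → ℕ) → E => ENNReal.ofReal (w 0 (f 0) ^ x 0) :=
        (h.measurable_rpow 0).comp (by fun_prop)
      rw [show childLaw d (tilt x K w) y = treeKernel d Kt' ∘ₘ (tilt x K w 0) y from rfl, ← this,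
        prod_withDensity_right hm]
    -- The tilted mark law is a probability measure, which is the normalization that `map_sortMarks`
    -- requires.
    have hnorm : ∀ y, ∫⁻ m, ENNReal.ofReal (W m ^ x 0) ∂(R'.prod (treeKernel d Kt' ∘ₘ K 0 y)) = 1 :=
      fun y => by
        have := congrArg (fun μ => μ univ) (htilt y)
        simpa [withDensity_apply] using this
    have hsort := fun y => map_sortMarks (hx 0) (hx1 0) (hρ 0) hW (fun m => h.pos 0 _) (hnorm y)
    let S1 : (ℕ → ℝ) × (ℕ → TreeSpace d E) → (ℕ → ℝ) × (ℕ → TreeSpace d E) :=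
      Prod.map id fun m j => S' (m j)
    have hS1 : Measurable S1 := by
      refine measurable_id.prodMap (measurable_pi_lambda _ fun j => hS'.comp (measurable_pi_apply j))
    have hS1map : ∀ y, ((ρ 0).prod (Measure.infinitePi fun _ : ℕ =>
        R'.prod (childLaw d K y))).map S1 = (ρ 0).prod (Measure.infinitePi fun _ : ℕ =>
        R'.prod (treeKernel d Kt' ∘ₘ K 0 y)) := fun y => by
      have h1 := Measure.infinitePi_map_pi (fun _ : ℕ => R'.prod (childLaw d K y)) fun _ => hS'
      rw [hN] at h1
      have hm : Measurable fun (m : ℕ → TreeSpace d E) j => S' (m j) :=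
        measurable_pi_lambda _ fun j => hS'.comp (measurable_pi_apply j)
      rw [← h1]
      have h2 := Measure.map_prod_map (ρ 0) (Measure.infinitePi fun _ : ℕ =>
        R'.prod (childLaw d K y)) measurable_id hm
      rw [Measure.map_id] at h2
      exact h2.symm
    have hjoin : ∀ y, (treeMeas ρ (d + 1)).prod (treeLaw (d + 1) K y) =
        ((ρ 0).prod (Measure.infinitePi fun _ : ℕ => R'.prod (childLaw d K y))).map joinTree :=
      fun y => by rw [map_joinTree, treeMeas_succ, treeLaw_succ]
    have hsw := measurable_sortMarks hW
    -- the exceptional set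
    let Gd : Set ((ℕ → ℝ) × (ℕ → TreeSpace d E)) :=
      {p | (∀ j, p.2 j ∈ G') ∧ (∀ j α, w 0 ((p.2 j).2 α) = w 0 ((p.2 j).2 0)) ∧
        Sortable fun j => (S1 p).1 j * W ((S1 p).2 j)}
    have hu : Measurable (w 0) := h.measurable 0
    have hGd : MeasurableSet Gd := by
      have hm : Measurable fun (p : (ℕ → ℝ) × (ℕ → TreeSpace d E)) (j : ℕ) =>
          (S1 p).1 j * W ((S1 p).2 j) := by fun_prop
      refine MeasurableSet.inter (measurableSet_forall_mem fun j => ?_)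
        (MeasurableSet.inter (measurableSet_forall_mem fun j => measurableSet_forall_mem fun α => ?_)
          (hm measurableSet_sortable))
      · exact hG'.preimage (f := fun p : (ℕ → ℝ) × (ℕ → TreeSpace d E) => p.2 j) (by fun_prop)
      · exact measurableSet_eq_fun (by fun_prop) (by fun_prop)
    have hwset : MeasurableSet {f : (Fin d → ℕ) → E | ∀ α, w 0 (f α) = w 0 (f 0)} :=
      measurableSet_forall_mem fun α => measurableSet_eq_fun (by fun_prop) (by fun_prop)
    have hGae : ∀ y, ∀ᵐ p ∂((ρ 0).prod (Measure.infinitePi fun _ : ℕ =>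
        R'.prod (childLaw d K y))), p ∈ Gd := by
      intro y
      have h1 : ∀ᵐ m ∂(R'.prod (childLaw d K y)), m ∈ G' :=
        ae_prod_comp R' (treeKernel d fun l => K (l + 1)) (K 0 y) hG' hG'ae
      have h2 : ∀ᵐ m ∂(R'.prod (childLaw d K y)), ∀ α, w 0 (m.2 α) = w 0 (m.2 0) := by
        refine Measure.quasiMeasurePreserving_snd.ae (p := fun f : (Fin d → ℕ) → E => ∀ α, w 0 (f α) = w 0 (f 0)) ?_
        refine Measure.ae_comp_of_ae_ae hwset (ae_of_all _ fun p => ?_)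
        filter_upwards [ae_treeLaw_eq (K := fun l => K (l + 1)) d hu
          (fun m y => h.preserved 0 (m + 1) (by omega) y) p] with f hf α
        rw [hf, hf]
      have h3 := (hsort y).2
      rw [← hS1map y] at h3
      have h4 := ae_of_ae_map hS1.aemeasurable h3
      have h5 := Measure.quasiMeasurePreserving_snd (μ := ρ 0).ae
        (ae_infinitePi fun _ : ℕ => h1.and h2)
      filter_upwards [h4, h5] with p hp4 hp5
      exact ⟨fun j => (hp5 j).1, fun j => (hp5 j).2, hp4.sortable⟩
    refine ⟨joinTree ∘ sortMarks W ∘ S1 ∘ splitTree, measurable_joinTree.comp (hsw.comp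
      (hS1.comp measurable_splitTree)), fun y => ?_, splitTree ⁻¹' Gd,
      measurable_splitTree hGd, fun y => ?_, fun p hp => ?_⟩
    · rw [hjoin, Measure.map_map (measurable_joinTree.comp (hsw.comp
        (hS1.comp measurable_splitTree))) measurable_joinTree]
      have : (joinTree ∘ sortMarks W ∘ S1 ∘ splitTree) ∘ joinTree =
        joinTree ∘ sortMarks W ∘ S1 := rfl
      rw [this, ← Measure.map_map measurable_joinTree (hsw.comp hS1), ← Measure.map_map hsw hS1,
        hS1map, (hsort y).1, htilt, map_joinTree, treeMeas_succ, treeLaw_succ]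
    · rw [hjoin]
      exact (ae_map_iff measurable_joinTree.aemeasurable (measurable_splitTree hGd)).2 (hGae y)
    · obtain ⟨hp1, hp2, hp3⟩ := hp
      choose σ hσ1 hσ2 hσ3 using fun j => hσ _ (hp1 j)
      have he := (decEnum_isDecEnum hp3)
      set e := decEnum fun j => (S1 (splitTree p)).1 j * W ((S1 (splitTree p)).2 j) with hedef
      refine ⟨_, IsTreeAut.cons he.1 hσ1, fun α => ?_, fun α => ?_⟩
      · exact hσ2 (e (α 0)) (Fin.tail α)
      · set j := e (α 0) with hj
        set β : Fin d → ℕ := σ j (Fin.tail α) with hβ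
        have h1 : treeWt p.1 (Fin.cons j β) = (splitTree p).1 j *
            treeWt ((splitTree p).2 j).1 β := by
          conv_lhs => rw [← joinTree_splitTree p]
          rw [joinTree, treeWt_glueVertex]
          rfl
        have h2 : treeWt ((joinTree ∘ sortMarks W ∘ S1 ∘ splitTree) p).1 α =
            (splitTree p).1 j * W (S' ((splitTree p).2 j)) *
              treeWt (S' ((splitTree p).2 j)).1 (Fin.tail α) := by
          simp only [Function.comp_apply, joinTree, treeWt_glueVertex]
          rfl
        -- Reordering relabels the leaves of the subtree, so leaf `0` may move; the value of `w 0`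
        -- does not.
        have h3 : W (S' ((splitTree p).2 j)) = w 0 (p.2 (Fin.cons j β)) := by
          change w 0 ((S' ((splitTree p).2 j)).2 0) = w 0 (((splitTree p).2 j).2 β)
          rw [hσ2, hp2 j, hp2 j β]
        rw [h1, h2, h3, ← hσ3, Finset.prod_range_succ']
        change _ * (_ * w 0 (p.2 (Fin.cons j β))) = _ * _ * (_ *
          ∏ l ∈ Finset.range d, w (l + 1) (p.2 (Fin.cons j β)))
        ring

end Reorder
end GREM

namespace GREM

/-! ### The density of the tilted field at finitely many leaves -/

section Density

variable {E : Type*} [MeasurableSpace E] {ι : Type*}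

lemma lintegral_infinitePi_prod {J Z : Type*} [MeasurableSpace Z] (μ : J → Measure Z)
    [∀ j, IsProbabilityMeasure (μ j)] (s : Finset J) {Φ : J → Z → ℝ≥0∞}
    (hΦ : ∀ j, Measurable (Φ j)) :
    ∫⁻ g, ∏ j ∈ s, Φ j (g j) ∂Measure.infinitePi μ = ∏ j ∈ s, ∫⁻ z, Φ j z ∂μ j := by
  rw [lintegral_prod_eq_prod_lintegral_of_indepFun s (fun j (g : J → Z) => Φ j (g j))
    (iIndepFun_infinitePi hΦ) (by fun_prop)]
  refine Finset.prod_congr rfl fun j _ => ?_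
  rw [← (measurePreserving_eval_infinitePi μ j).lintegral_comp (hΦ j)]

/-- The point `i` is the first one of its class of points of `s` agreeing up to level `l`. -/
def IsFirst [LinearOrder ι] {k : ℕ} (s : Finset ι) (α : ι → Fin k → ℕ) (l : ℕ) (i : ι) : Prop :=
  ∀ i' ∈ s, i' < i → ¬ Agree l (α i') (α i)

open Classical in
/-- The contribution of the level `l` to the density at the point `i`. -/
noncomputable def firstFactor [LinearOrder ι] {k : ℕ} (s : Finset ι) (α : ι → Fin k → ℕ) (l : ℕ)
    (i : ι) (a : ℝ≥0∞) : ℝ≥0∞ :=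
  if IsFirst s α l i then a else 1

@[fun_prop]
lemma measurable_firstFactor [LinearOrder ι] {k : ℕ} (s : Finset ι) (α : ι → Fin k → ℕ) (l : ℕ)
    (i : ι) : Measurable (firstFactor s α l i) := by
  unfold firstFactor; split_ifs <;> fun_prop

variable [LinearOrder ι]

lemma isFirst_fiber {d : ℕ} (s : Finset ι) (α : ι → Fin (d + 1) → ℕ) (j l : ℕ) {i : ι}
    (hi : α i 0 = j) :
    IsFirst s α (l + 1) i ↔ IsFirst {i ∈ s | α i 0 = j} (fun i => Fin.tail (α i)) l i := by
  simp only [IsFirst, Finset.mem_filter, agree_succ, hi]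
  constructor
  · rintro h i' ⟨h1, h2⟩ h3 h4
    exact h i' h1 h3 ⟨h2, h4⟩
  · rintro h i' h1 h3 ⟨h2, h4⟩
    exact h i' ⟨h1, h2⟩ h3 h4

/-- The leaves are grouped by their first coordinate. Different children carry independent subtrees,
so the integral factorizes over the groups; in each group the first step is tilted once, however
many leaves share it, and the induction hypothesis handles the rest. The general finite set `s` in a
linear order allows the restriction to a group, whose least element carries the factor. -/
theorem lintegral_treeLaw_tilt (d : ℕ) {x : ℕ → ℝ} {K : ℕ → Kernel E E} [∀ l, IsMarkovKernel (K l)]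
    {w : ℕ → E → ℝ} (h : TiltData x K w) (s : Finset ι) (α : ι → Fin d → ℕ) {G : ι → E → ℝ≥0∞}
    (hG : ∀ i, Measurable (G i)) (y : E) :
    ∫⁻ f, ∏ i ∈ s, G i (f (α i)) ∂treeLaw d (tilt x K w) y =
      ∫⁻ f, ∏ i ∈ s, (G i (f (α i)) * ∏ l ∈ Finset.range d,
        firstFactor s α (l + 1) i (ENNReal.ofReal (w l (f (α i)) ^ x l))) ∂treeLaw d K y := by
  induction d generalizing x K w s G y with
  | zero => simp; rfl
  | succ d ih =>
    have hmk := h.isMarkovKernel_tilt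
    have hmk' := h.shift.isMarkovKernel_tilt
    have hV := h.measurable_rpow
    have hw := h.measurable
    have hgl := measurable_glueLeaf (E := E) (d := d)
    rw [treeLaw_succ, treeLaw_succ, lintegral_map (by fun_prop) hgl, lintegral_map (by fun_prop) hgl]
    simp only [glueLeaf]
    have hfib : ∀ F : ι → (ℕ → (Fin d → ℕ) → E) → ℝ≥0∞, ∀ g, ∏ i ∈ s, F i g =
        ∏ j ∈ s.image fun i => α i 0, ∏ i ∈ s with α i 0 = j, F i g := fun F g =>
      (Finset.prod_fiberwise_of_maps_to (fun i hi => Finset.mem_image_of_mem _ hi) _).symm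
    let Φ : ℕ → ((Fin d → ℕ) → E) → ℝ≥0∞ := fun j f =>
      ∏ i ∈ s with α i 0 = j, G i (f (Fin.tail (α i)))
    let Φ' : ℕ → ((Fin d → ℕ) → E) → ℝ≥0∞ := fun j f => ∏ i ∈ s with α i 0 = j,
      (G i (f (Fin.tail (α i))) * ∏ l ∈ Finset.range (d + 1),
        firstFactor s α (l + 1) i (ENNReal.ofReal (w l (f (Fin.tail (α i))) ^ x l)))
    have hL : ∀ g : ℕ → (Fin d → ℕ) → E, ∏ i ∈ s, G i (g (α i 0) (Fin.tail (α i))) =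
        ∏ j ∈ s.image fun i => α i 0, Φ j (g j) := fun g => by
      rw [hfib fun i g => G i (g (α i 0) (Fin.tail (α i)))]
      exact Finset.prod_congr rfl fun j _ =>
        Finset.prod_congr rfl fun i hi => by rw [(Finset.mem_filter.1 hi).2]
    have hR : ∀ g : ℕ → (Fin d → ℕ) → E, ∏ i ∈ s, (G i (g (α i 0) (Fin.tail (α i))) *
        ∏ l ∈ Finset.range (d + 1), firstFactor s α (l + 1) i
          (ENNReal.ofReal (w l (g (α i 0) (Fin.tail (α i))) ^ x l))) =
        ∏ j ∈ s.image fun i => α i 0, Φ' j (g j) := fun g => by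
      rw [hfib fun i g => G i (g (α i 0) (Fin.tail (α i))) *
        ∏ l ∈ Finset.range (d + 1), firstFactor s α (l + 1) i
          (ENNReal.ofReal (w l (g (α i 0) (Fin.tail (α i))) ^ x l))]
      exact Finset.prod_congr rfl fun j _ =>
        Finset.prod_congr rfl fun i hi => by rw [(Finset.mem_filter.1 hi).2]
    rw [lintegral_congr hL, lintegral_congr hR,
      lintegral_infinitePi_prod _ _ (Φ := Φ) (by fun_prop),
      lintegral_infinitePi_prod _ _ (Φ := Φ') (by fun_prop)]
    refine Finset.prod_congr rfl fun j hj => ?_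
    set t : Finset ι := {i ∈ s | α i 0 = j} with ht
    have htne : t.Nonempty := by
      obtain ⟨i, hi, hij⟩ := Finset.mem_image.1 hj
      exact ⟨i, Finset.mem_filter.2 ⟨hi, hij⟩⟩
    -- All members of `t` agree at level `1` and agree with nothing else in `s`, so only the least
    -- one contributes.
    have hfirst : ∀ c : ι → ℝ≥0∞, ∏ i ∈ t, firstFactor s α 1 i (c i) = c (t.min' htne) := by
      intro c
      have hmem := t.min'_mem htne
      rw [Finset.prod_eq_single_of_mem _ hmem]
      · rw [firstFactor, if_pos]
        rw [isFirst_fiber s α j 0 (Finset.mem_filter.1 hmem).2]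
        exact fun i' hi' hlt => absurd (t.min'_le i' hi') (not_le.2 hlt)
      · intro i hi hne
        rw [firstFactor, if_neg]
        rw [isFirst_fiber s α j 0 (Finset.mem_filter.1 hi).2]
        exact fun hc => hc _ hmem (lt_of_le_of_ne (t.min'_le i hi) (Ne.symm hne)) (agree_zero _ _)
    have hprod : ∀ f : (Fin d → ℕ) → E, ∏ i ∈ t, (G i (f (Fin.tail (α i))) *
        ∏ l ∈ Finset.range (d + 1), firstFactor s α (l + 1) i
          (ENNReal.ofReal (w l (f (Fin.tail (α i))) ^ x l))) =
        ENNReal.ofReal (w 0 (f (Fin.tail (α (t.min' htne)))) ^ x 0) *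
        ∏ i ∈ t, (G i (f (Fin.tail (α i))) * ∏ l ∈ Finset.range d,
          firstFactor t (fun i => Fin.tail (α i)) (l + 1) i
            (ENNReal.ofReal (w (l + 1) (f (Fin.tail (α i))) ^ x (l + 1)))) := by
      intro f
      simp_rw [Finset.prod_range_succ' _ d]
      rw [← hfirst fun i => ENNReal.ofReal (w 0 (f (Fin.tail (α i))) ^ x 0), ← Finset.prod_mul_distrib]
      refine Finset.prod_congr rfl fun i hi => ?_
      have : ∀ l a, firstFactor s α (l + 1 + 1) i a =
          firstFactor t (fun i => Fin.tail (α i)) (l + 1) i a := fun l a => by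
        simp only [firstFactor]
        rw [isFirst_fiber s α j (l + 1) (Finset.mem_filter.1 hi).2]
      simp_rw [this]
      ring
    have hΦ : Measurable fun f : (Fin d → ℕ) → E => ∏ i ∈ t, G i (f (Fin.tail (α i))) := by fun_prop
    simp only [Φ, Φ']
    rw [lintegral_congr hprod, childLaw, childLaw,
      Measure.lintegral_bind (Kernel.aemeasurable _) hΦ.aemeasurable,
      Measure.lintegral_bind (Kernel.aemeasurable _) (by fun_prop), h.tilt_apply]
    have hI : Measurable fun p => ∫⁻ f, ∏ i ∈ t, G i (f (Fin.tail (α i)))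
        ∂treeKernel d (fun l => tilt x K w (l + 1)) p :=
      Measurable.lintegral_kernel (by fun_prop)
    rw [lintegral_withDensity_eq_lintegral_mul _ (hV 0) hI]
    refine lintegral_congr fun p => ?_
    simp only [Pi.mul_apply, treeKernel_apply]
    have h1 := ih h.shift t (fun i => Fin.tail (α i)) hG p
    change _ * ∫⁻ f, _ ∂treeLaw d (tilt (fun l => x (l + 1)) (fun l => K (l + 1))
      fun l => w (l + 1)) p = _
    have hsh := h.shift.measurable_rpow
    rw [h1, ← lintegral_const_mul _ (by fun_prop)]
    refine lintegral_congr_ae ?_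
    -- The deeper steps preserve `w 0`, so its value at the representative leaf is its value at the
    -- state `p` after the first step.
    filter_upwards [ae_treeLaw_eq (K := fun l => K (l + 1)) d (h.measurable 0)
      (fun m y => h.preserved 0 (m + 1) (by omega) y) p] with f hf
    rw [hf]

/-- The density of the tilted field at the leaves `a i`. -/
noncomputable def leafDensity {n d : ℕ} (x : ℕ → ℝ) (w : ℕ → E → ℝ) (a : Fin n → Fin d → ℕ)
    (p : Fin n → E) : ℝ≥0∞ :=
  ∏ i, ∏ l ∈ Finset.range d,
    firstFactor Finset.univ a (l + 1) i (ENNReal.ofReal (w l (p i) ^ x l))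

variable {x : ℕ → ℝ} {K : ℕ → Kernel E E} [∀ l, IsMarkovKernel (K l)] {w : ℕ → E → ℝ}

lemma measurable_leafDensity (h : TiltData x K w) {n d : ℕ} (a : Fin n → Fin d → ℕ) :
    Measurable (leafDensity x w a) := by
  have := h.measurable
  unfold leafDensity; fun_prop

theorem map_treeLaw_tilt (h : TiltData x K w) {n d : ℕ} (a : Fin n → Fin d → ℕ) (y : E) :
    (treeLaw d (tilt x K w) y).map (fun f i => f (a i)) =
      ((treeLaw d K y).map fun f i => f (a i)).withDensity (leafDensity x w a) := by
  have hmk := h.isMarkovKernel_tilt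
  have hm : Measurable fun (f : (Fin d → ℕ) → E) (i : Fin n) => f (a i) := by fun_prop
  have hd := measurable_leafDensity h a
  have := Measure.isProbabilityMeasure_map (μ := treeLaw d (tilt x K w) y) hm.aemeasurable
  have key : ∀ t : Fin n → Set E, (∀ i, MeasurableSet (t i)) →
      (treeLaw d (tilt x K w) y).map (fun f i => f (a i)) (Set.pi univ t) =
      ((treeLaw d K y).map fun f i => f (a i)).withDensity (leafDensity x w a) (Set.pi univ t) := by
    intro t ht
    have hpi := MeasurableSet.univ_pi ht
    have hind : ∀ p : Fin n → E, (Set.pi univ t).indicator (1 : (Fin n → E) → ℝ≥0∞) p =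
        ∏ i, (t i).indicator (1 : E → ℝ≥0∞) (p i) := by
      intro p
      by_cases hp : p ∈ Set.pi univ t
      · rw [indicator_of_mem hp, Finset.prod_eq_one]
        · rfl
        · exact fun i _ => by rw [indicator_of_mem (hp i (mem_univ i))]; rfl
      · rw [indicator_of_notMem hp]
        simp only [Set.mem_pi, mem_univ, forall_const, not_forall] at hp
        obtain ⟨i, hi⟩ := hp
        exact (Finset.prod_eq_zero (Finset.mem_univ i) (indicator_of_notMem hi _)).symm
    have hti : ∀ i, Measurable ((t i).indicator (1 : E → ℝ≥0∞)) := fun i =>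
      measurable_one.indicator (ht i)
    rw [← lintegral_indicator_one hpi, ← lintegral_indicator_one hpi,
      lintegral_map (measurable_one.indicator hpi) hm,
      lintegral_withDensity_eq_lintegral_mul _ hd (measurable_one.indicator hpi),
      lintegral_map (hd.mul (measurable_one.indicator hpi)) hm]
    simp_rw [Pi.mul_apply, hind]
    rw [lintegral_treeLaw_tilt d h Finset.univ a hti y]
    refine lintegral_congr fun f => ?_
    rw [Finset.prod_mul_distrib, leafDensity, mul_comm]
  refine ext_of_generate_finite _ generateFrom_pi.symm isPiSystem_pi ?_ ?_
  · rintro _ ⟨t, ht, rfl⟩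
    exact key t (by simpa using ht)
  · simpa using key (fun _ => univ) fun _ => .univ

end Density
end GREM

namespace GREM

/-! ### The last level of the tree -/

section LastLevel

lemma infProd_equiv {A B : Type*} (e : A ≃ B) (f : B → ℝ≥0∞) :
    infProd (fun a => f (e a)) = infProd f := by
  unfold infProd
  refine Equiv.iInf_congr (Equiv.finsetCongr e) fun F => ?_
  simp [Equiv.finsetCongr, Finset.prod_map]

lemma PoissonFun.reindex {A B Ω X : Type*} [MeasurableSpace X] [MeasurableSpace Ω]
    {m : Measure Ω} {z : B → Ω → X} {Λ : Measure X} (h : PoissonFun m z Λ) (e : A ≃ B) :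
    PoissonFun m (fun a => z (e a)) Λ := fun H hH hle => by
  rw [← h H hH hle]
  exact lintegral_congr fun ω => infProd_equiv e fun b => H (z b ω)

/-- A leaf is a leaf of the tree cut above the last level, and a child of it. -/
def leafEquiv (d : ℕ) : (Fin (d + 1) → ℕ) ≃ (Fin d → ℕ) × ℕ where
  toFun α := (Fin.init α, α (Fin.last d))
  invFun p := (Fin.snoc p.1 p.2 : Fin (d + 1) → ℕ)
  left_inv α := by simp
  right_inv p := by simp

/-- The inner vertices below the last level. -/
def vertexLower {d : ℕ} (v : Vertex d) : Vertex (d + 1) := ⟨v.1.castSucc, v.2⟩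

/-- The inner vertices at the last level. -/
def vertexLast {d : ℕ} (v : Fin d → ℕ) : Vertex (d + 1) := ⟨Fin.last d, v⟩

lemma vertexLower_injective {d : ℕ} : Function.Injective (vertexLower (d := d)) := by
  rintro ⟨l, u⟩ ⟨m, v⟩ h
  have h1 : l = m := by
    have := congrArg Sigma.fst h
    exact Fin.castSucc_injective d this
  subst h1
  simp only [vertexLower, Sigma.mk.injEq, heq_eq_eq, true_and] at h
  rw [h]

lemma vertexLast_injective {d : ℕ} : Function.Injective (vertexLast (d := d)) := fun u v h => by
  simpa [vertexLast] using h

lemma vertexLower_ne_vertexLast {d : ℕ} (v : Vertex d) (u : Fin d → ℕ) :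
    vertexLower v ≠ vertexLast u := fun h => by
  have := congrArg (fun z : Vertex (d + 1) => (z.1 : ℕ)) h
  simp only [vertexLower, vertexLast, Fin.val_castSucc, Fin.val_last] at this
  exact absurd this v.1.2.ne

lemma treeWt_last {d : ℕ} (Z : Vertex (d + 1) → ℕ → ℝ) (α : Fin (d + 1) → ℕ) :
    treeWt Z α = treeWt (fun v => Z (vertexLower v)) (Fin.init α) *
      Z (vertexLast (Fin.init α)) (α (Fin.last d)) := by
  rw [treeWt, Fin.prod_univ_castSucc]
  rfl

lemma map_lower_last {X : Type*} [MeasurableSpace X] (μ : ℕ → Measure X)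
    [∀ l, IsProbabilityMeasure (μ l)] (d : ℕ) :
    (treeMeas μ (d + 1)).map (fun Z => ((fun v => Z (vertexLower v), fun v => Z (vertexLast v)) :
      (Vertex d → X) × ((Fin d → ℕ) → X))) =
      (treeMeas μ d).prod (Measure.infinitePi fun _ : Fin d → ℕ => μ d) :=
  map_pair_infinitePi (fun v : Vertex (d + 1) => μ v.1) vertexLower_injective vertexLast_injective
    vertexLower_ne_vertexLast

/-- The weights of the leaves from the weights `η` one level below. -/
def lastWt {d : ℕ} (η : (Fin d → ℕ) → ℝ) (s : (Fin d → ℕ) → ℕ → ℝ) (α : Fin (d + 1) → ℕ) : ℝ :=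
  η (Fin.init α) * s (Fin.init α) (α (Fin.last d))

lemma treeWt_eq_lastWt {d : ℕ} (Z : Vertex (d + 1) → ℕ → ℝ) :
    treeWt Z = lastWt (treeWt fun v => Z (vertexLower v)) fun v => Z (vertexLast v) :=
  funext fun α => treeWt_last Z α

variable {d : ℕ} {x : ℝ} {ρ : Measure (ℕ → ℝ)} {η : (Fin d → ℕ) → ℝ}

lemma measurable_lastWt (η : (Fin d → ℕ) → ℝ) (α : Fin (d + 1) → ℕ) :
    Measurable fun s => lastWt η s α := by
  unfold lastWt; fun_prop

/-- The children of `v` form a REM multiplied by `η v`, with intensity `η v ^ x` times the original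
one. Superposition therefore yields a product: the common intensity for the weights and a discrete
measure for the parents. -/
lemma poissonFun_lastWt (hρ : IsREMLaw x ρ) (hη : ∀ v, 0 < η v) :
    PoissonFun (Measure.infinitePi fun _ : Fin d → ℕ => ρ)
      (fun (α : Fin (d + 1) → ℕ) s => (lastWt η s α, (Fin.init α : Fin d → ℕ)))
      ((remIntensity x).prod (Measure.sum fun v =>
        ENNReal.ofReal (η v ^ x) • Measure.dirac v)) := by
  have := hρ.isProbabilityMeasure
  have h1 : ∀ v : Fin d → ℕ, PoissonFun ρ (fun (j : ℕ) (s : ℕ → ℝ) => (η v * s j, v))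
      ((remIntensity x).prod (ENNReal.ofReal (η v ^ x) • Measure.dirac v)) := by
    intro v
    have hT : Measurable fun t : ℝ => (η v * t, v) := by fun_prop
    convert hρ.poissonFun.map hT using 1
    rw [Measure.prod_smul_right, Measure.prod_dirac, ← Measure.map_smul, ← map_mul_remIntensity x (hη v),
      Measure.map_map (by fun_prop) (by fun_prop)]
    rfl
  have h2 := PoissonFun.superpose (fun _ : Fin d → ℕ => ρ)
    (z := fun (v : Fin d → ℕ) (j : ℕ) (s : ℕ → ℝ) => (η v * s j, v)) (fun v j => by fun_prop) h1
  rw [← Measure.prod_sum_right] at h2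
  exact h2.reindex (leafEquiv d)

lemma lastWt_pos (hρ : IsREMLaw x ρ) (hη : ∀ v, 0 < η v) :
    ∀ᵐ s ∂Measure.infinitePi fun _ : Fin d → ℕ => ρ, ∀ α, 0 < lastWt η s α := by
  have := hρ.isProbabilityMeasure
  filter_upwards [ae_infinitePi fun _ : Fin d → ℕ => hρ.pos] with s hs α using
    mul_pos (hη _) (hs _ _)

lemma isFiniteMeasure_parent (hsum : ∑' v, ENNReal.ofReal (η v ^ x) ≠ ∞) :
    IsFiniteMeasure (Measure.sum fun v => ENNReal.ofReal (η v ^ x) • Measure.dirac v) :=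
  ⟨by simpa using hsum.lt_top⟩

lemma ae_tsum_lastWt (hx : 0 < x) (hρ : IsREMLaw x ρ) (hη : ∀ v, 0 < η v)
    (hsum : ∑' v, ENNReal.ofReal (η v ^ x) ≠ ∞) {y : ℝ} (hy : x < y) :
    ∀ᵐ s ∂Measure.infinitePi fun _ : Fin d → ℕ => ρ,
      ∑' α, ENNReal.ofReal (lastWt η s α ^ y) ≠ ∞ := by
  have := hρ.isProbabilityMeasure
  have := isFiniteMeasure_parent hsum
  exact (poissonFun_lastWt hρ hη).ae_tsum_rpow_ne_top
    (fun α => (measurable_lastWt η α).prodMk measurable_const) hx hy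

lemma ae_sortable_lastWt (hx : 0 < x) (hx1 : x < 1) (hρ : IsREMLaw x ρ) (hη : ∀ v, 0 < η v)
    (hsum : ∑' v, ENNReal.ofReal (η v ^ x) ≠ ∞) :
    ∀ᵐ s ∂Measure.infinitePi fun _ : Fin d → ℕ => ρ, Sortable (lastWt η s) := by
  have := hρ.isProbabilityMeasure
  have := isFiniteMeasure_parent hsum
  exact (poissonFun_lastWt hρ hη).ae_sortable
    (fun α => (measurable_lastWt η α).prodMk measurable_const) hx hx1 (lastWt_pos hρ hη)

/-- The weights of the leaves in decreasing order are a multiple of a REM, independent of the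
parents of the leaves, which are independent and identically distributed. -/
lemma map_sorted_lastWt (hx : 0 < x) (hx1 : x < 1) (hρ : IsREMLaw x ρ) (hη : ∀ v, 0 < η v)
    (hsum : ∑' v, ENNReal.ofReal (η v ^ x) ≠ ∞) :
    ∃ (c : ℝ) (ν : Measure (Fin d → ℕ)), 0 < c ∧ IsProbabilityMeasure ν ∧
      (Measure.infinitePi fun _ : Fin d → ℕ => ρ).map (fun s i =>
        (lastWt η s (decEnum (lastWt η s) i), (Fin.init (decEnum (lastWt η s) i) : Fin d → ℕ))) =
      (ρ.prod (Measure.infinitePi fun _ : ℕ => ν)).map fun p i => (c * p.1 i, p.2 i) := by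
  have := hρ.isProbabilityMeasure
  -- The total mass of the parent measure. Division by `C` gives the law of a parent, and the mass
  -- itself is absorbed by the scale `c = C^{1/x}`, as `c^x = C`.
  set C := ∑' v, ENNReal.ofReal (η v ^ x) with hC
  have hC0 : C ≠ 0 := by
    rw [hC, Ne, ENNReal.tsum_eq_zero]
    intro h
    have h1 := h fun _ => 0
    rw [ENNReal.ofReal_eq_zero] at h1
    exact absurd (Real.rpow_pos_of_pos (hη _) x) (not_lt.2 h1)
  have hCr : 0 < C.toReal := ENNReal.toReal_pos hC0 hsum
  set Λ := Measure.sum fun v => ENNReal.ofReal (η v ^ x) • Measure.dirac v with hΛ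
  have hΛu : Λ univ = C := by rw [hΛ, hC]; simp
  have hν : IsProbabilityMeasure (C⁻¹ • Λ) := ⟨by
    rw [Measure.smul_apply, hΛu, smul_eq_mul, ENNReal.inv_mul_cancel hC0 hsum]⟩
  refine ⟨C.toReal ^ x⁻¹, C⁻¹ • Λ, Real.rpow_pos_of_pos hCr _, hν, ?_⟩
  refine PoissonFun.map_sorted (z := fun (α : Fin (d + 1) → ℕ) s =>
    (lastWt η s α, (Fin.init α : Fin d → ℕ)))
    (fun α => (measurable_lastWt η α).prodMk measurable_const) hx hx1
    (Real.rpow_pos_of_pos hCr _) ?_ (lastWt_pos hρ hη) hρ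
  have : ENNReal.ofReal ((C.toReal ^ x⁻¹) ^ x) • (C⁻¹ • Λ) = Λ := by
    rw [← Real.rpow_mul hCr.le, inv_mul_cancel₀ hx.ne', Real.rpow_one, ENNReal.ofReal_toReal hsum,
      smul_smul, ENNReal.mul_inv_cancel hC0 hsum, one_smul]
  rw [this]
  exact poissonFun_lastWt hρ hη

end LastLevel

/-! ### Overlaps and normalized weights -/

section Overlap

variable {d : ℕ} (q : ℕ → unitInterval)

/-- The weights in decreasing order, divided by their sum. -/
noncomputable def normWt {A : Type*} [Inhabited A] (w : A → ℝ) (i : ℕ) : ℝ :=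
  w (decEnum w i) / (∑' a, ENNReal.ofReal (w a)).toReal

lemma measurable_apply_decEnum {A : Type*} [Countable A] [Infinite A] [Inhabited A] (i : ℕ) :
    Measurable fun w : A → ℝ => w (decEnum w i) :=
  measurable_comp_countable (z := fun a (w : A → ℝ) => w a) (fun a => measurable_pi_apply a)
    (measurableSet_decEnum_eq (fun a => measurable_pi_apply a) i)

lemma measurable_normWt {A : Type*} [Countable A] [Infinite A] [Inhabited A] :
    Measurable (normWt (A := A)) := by
  refine measurable_pi_lambda _ fun i => (measurable_apply_decEnum i).div ?_
  exact (Measurable.tsum fun a => (measurable_pi_apply a).ennreal_ofReal).ennreal_toReal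

lemma measurable_orderedOverlap :
    Measurable (orderedOverlap q : ((Fin (d + 1) → ℕ) → ℝ) → ℕ → ℕ → unitInterval) := by
  refine measurable_pi_lambda _ fun i => measurable_pi_lambda _ fun j => ?_
  exact (Measurable.of_discrete (f := fun p : (Fin (d + 1) → ℕ) × (Fin (d + 1) → ℕ) =>
    overlap q p.1 p.2)).comp ((measurable_decEnum i).prodMk (measurable_decEnum j))

lemma overlap_self {k : ℕ} (α β : Fin k → ℕ) : overlap q α α = overlap q β β := by
  simp [overlap, Agree]

/-- Distinct leaves cannot agree in all `d + 1` coordinates, and agreement up to a level at most `d`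
involves only the parents. -/
lemma overlap_init {α β : Fin (d + 1) → ℕ} (h : α ≠ β) :
    overlap q α β = overlap q (Fin.init α : Fin d → ℕ) (Fin.init β) := by
  classical
  unfold overlap
  congr 1
  ext l
  have h1 : Agree l α β ↔ l ≤ d ∧ Agree l (Fin.init α : Fin d → ℕ) (Fin.init β) := by
    constructor
    · intro hA
      refine ⟨?_, fun i hi => hA i.castSucc hi⟩
      by_contra hl
      exact h ((agree_self_iff (by omega) α β).1 hA)
    · rintro ⟨hl, hA⟩ i hi
      induction i using Fin.lastCases with
      | last => simp at hi; omega
      | cast i => exact hA i hi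
  simp only [Finset.mem_filter, Finset.mem_range, h1]
  constructor
  · rintro ⟨_, h2, h3⟩; exact ⟨by omega, h3⟩
  · rintro ⟨h2, h3⟩; exact ⟨by omega, by omega, h3⟩

open Classical in
/-- The overlap matrix in terms of the parents of the leaves. -/
noncomputable def parentOverlap (V : ℕ → Fin d → ℕ) (i j : ℕ) : unitInterval :=
  if i = j then overlap q (fun _ : Fin (d + 1) => 0) (fun _ => 0) else overlap q (V i) (V j)

lemma measurable_parentOverlap : Measurable (parentOverlap (d := d) q) := by
  refine measurable_pi_lambda _ fun i => measurable_pi_lambda _ fun j => ?_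
  unfold parentOverlap
  split_ifs
  · exact measurable_const
  · exact (Measurable.of_discrete (f := fun p : (Fin d → ℕ) × (Fin d → ℕ) =>
      overlap q p.1 p.2)).comp (g := fun p : (Fin d → ℕ) × (Fin d → ℕ) => overlap q p.1 p.2)
        (f := fun V : ℕ → Fin d → ℕ => (V i, V j))
        ((measurable_pi_apply i).prodMk (measurable_pi_apply j))

lemma orderedOverlap_eq {w : (Fin (d + 1) → ℕ) → ℝ} (hw : Sortable w) :
    orderedOverlap q w = parentOverlap q fun i => (Fin.init (decEnum w i) : Fin d → ℕ) := by
  funext i j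
  rw [orderedOverlap, parentOverlap]
  split_ifs with h
  · rw [h]; exact overlap_self q _ _
  · exact overlap_init q fun hij => h ((decEnum_isDecEnum hw).1.1 hij)

lemma tsum_decEnum {A : Type*} [Infinite A] [Inhabited A] {w : A → ℝ} (hw : Sortable w)
    (f : A → ℝ≥0∞) : ∑' a, f a = ∑' i, f (decEnum w i) :=
  ((Equiv.ofBijective _ (decEnum_isDecEnum hw).1).tsum_eq f).symm

variable {x : ℝ} {ρ : Measure (ℕ → ℝ)} {η : (Fin d → ℕ) → ℝ}

/-- The first factor is the same for every `η`: the scale `c`, which does depend on `η`, cancels in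
the normalization. This is what makes the weights independent of the earlier levels as well. The
second factor may depend on `η`. -/
lemma map_normWt_overlap (hx : 0 < x) (hx1 : x < 1) (hρ : IsREMLaw x ρ) (hη : ∀ v, 0 < η v)
    (hsum : ∑' v, ENNReal.ofReal (η v ^ x) ≠ ∞) :
    ∃ M : Measure (ℕ → ℕ → unitInterval), IsProbabilityMeasure M ∧
      (Measure.infinitePi fun _ : Fin d → ℕ => ρ).map (fun s =>
        (normWt (lastWt η s), orderedOverlap q (lastWt η s))) =
      (ρ.map fun t i => t i / (∑' j, ENNReal.ofReal (t j)).toReal).prod M := by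
  have := hρ.isProbabilityMeasure
  obtain ⟨c, ν, hc, hν, hmap⟩ := map_sorted_lastWt hx hx1 hρ hη hsum
  let N : (ℕ → ℝ) → ℕ → ℝ := fun t i => t i / (∑' j, ENNReal.ofReal (t j)).toReal
  have hN : Measurable N := measurable_pi_lambda _ fun i => (measurable_pi_apply i).div
    (Measurable.tsum fun a => (measurable_pi_apply a).ennreal_ofReal).ennreal_toReal
  have hV := measurable_parentOverlap (d := d) q
  let Ψ : (ℕ → ℝ × (Fin d → ℕ)) → (ℕ → ℝ) × (ℕ → ℕ → unitInterval) := fun p =>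
    (N fun i => (p i).1, parentOverlap q fun i => (p i).2)
  have hΨ : Measurable Ψ := (hN.comp (by fun_prop)).prodMk (hV.comp (by fun_prop))
  refine ⟨(Measure.infinitePi fun _ : ℕ => ν).map (parentOverlap q),
    Measure.isProbabilityMeasure_map hV.aemeasurable, ?_⟩
  have hw : Measurable fun s => lastWt η s := measurable_pi_lambda _ fun α => measurable_lastWt η α
  have hS : Measurable fun s (i : ℕ) => (lastWt η s (decEnum (lastWt η s) i),
      (Fin.init (decEnum (lastWt η s) i) : Fin d → ℕ)) := by
    refine measurable_pi_lambda _ fun i => ((measurable_apply_decEnum i).comp hw).prodMk ?_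
    exact (Measurable.of_discrete (f := fun α : Fin (d + 1) → ℕ => (Fin.init α : Fin d → ℕ))).comp
      ((measurable_decEnum i).comp hw)
  have h1 := congrArg (Measure.map Ψ) hmap
  have hR : Measurable fun (p : (ℕ → ℝ) × (ℕ → Fin d → ℕ)) (i : ℕ) => (c * p.1 i, p.2 i) := by
    fun_prop
  rw [Measure.map_map hΨ hS, Measure.map_map hΨ hR] at h1
  refine Eq.trans (Measure.map_congr ?_) (h1.trans ?_)
  · filter_upwards [ae_sortable_lastWt hx hx1 hρ hη hsum] with s hs
    refine Prod.ext ?_ (orderedOverlap_eq q hs)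
    funext i
    simp only [normWt, Function.comp_apply, Ψ, N]
    rw [tsum_decEnum hs fun a => ENNReal.ofReal (lastWt η s a)]
  · rw [Measure.map_prod_map _ _ hN hV]
    congr 1
    funext p
    refine Prod.ext ?_ rfl
    funext i
    simp only [Function.comp_apply, Ψ, N, Prod.map_fst]
    simp_rw [ENNReal.ofReal_mul hc.le, ENNReal.tsum_mul_left, ENNReal.toReal_mul,
      ENNReal.toReal_ofReal hc.le]
    rw [mul_div_mul_left _ _ hc.ne']

end Overlap

/-! ### The weights of the cascade -/

section Cascade

variable {x : ℕ → ℝ} {ρ : ℕ → Measure (ℕ → ℝ)}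

lemma measurable_treeWt {d : ℕ} : Measurable (treeWt (d := d)) :=
  measurable_pi_lambda _ fun α => by unfold treeWt; fun_prop

lemma ae_treeWt_pos (hρ : ∀ l, IsREMLaw (x l) (ρ l)) (d : ℕ) :
    ∀ᵐ Z ∂treeMeas ρ d, ∀ α, 0 < treeWt Z α := by
  have := fun l => (hρ l).isProbabilityMeasure
  filter_upwards [ae_infinitePi fun v : Vertex d => (hρ v.1).pos] with Z hZ α using
    Finset.prod_pos fun l _ => hZ _ _

/-- Fubini for the last level against the earlier ones. -/
lemma ae_treeMeas_succ [∀ l, IsProbabilityMeasure (ρ l)] {d : ℕ}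
    {p : ((Fin (d + 1) → ℕ) → ℝ) → Prop} (hp : MeasurableSet {w | p w})
    (h : ∀ᵐ Z ∂treeMeas ρ d, ∀ᵐ s ∂Measure.infinitePi fun _ : Fin d → ℕ => ρ d,
      p (lastWt (treeWt Z) s)) : ∀ᵐ Z ∂treeMeas ρ (d + 1), p (treeWt Z) := by
  have hm : Measurable fun z : (Vertex d → ℕ → ℝ) × ((Fin d → ℕ) → ℕ → ℝ) =>
      lastWt (treeWt z.1) z.2 := by
    refine measurable_pi_lambda _ fun α => ?_
    have := (measurable_pi_apply (Fin.init α : Fin d → ℕ)).comp (measurable_treeWt (d := d))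
    unfold lastWt
    exact (this.comp measurable_fst).mul (by fun_prop)
  have h1 := (Measure.ae_prod_iff_ae_ae (hm hp)).2 h
  rw [← map_lower_last] at h1
  have h2 := ae_of_ae_map (by fun_prop) h1
  filter_upwards [h2] with Z hZ
  rwa [treeWt_eq_lastWt]

/-- The exponent `y` must vary in the induction: the sum at exponent `y` over the last level is
finite if the sum at exponent `x d` over the earlier levels is, and the strict increase of the
parameters puts `x d` above all earlier ones. -/
lemma ae_tsum_treeWt (hx : ∀ l, 0 < x l) (hρ : ∀ l, IsREMLaw (x l) (ρ l)) (d : ℕ)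
    (hmono : ∀ l m, l < m → m < d → x l < x m) {y : ℝ} (hy : ∀ l < d, x l < y) :
    ∀ᵐ Z ∂treeMeas ρ d, ∑' α, ENNReal.ofReal (treeWt Z α ^ y) ≠ ∞ := by
  have := fun l => (hρ l).isProbabilityMeasure
  induction d generalizing y with
  | zero =>
    refine ae_of_all _ fun Z => ?_
    rw [tsum_fintype]
    exact ENNReal.sum_ne_top.2 fun _ _ => ENNReal.ofReal_ne_top
  | succ d ih =>
    refine ae_treeMeas_succ (p := fun w => ∑' α, ENNReal.ofReal (w α ^ y) ≠ ∞) ?_ ?_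
    · exact (Measurable.tsum fun α => by fun_prop) (measurableSet_singleton ∞).compl
    · filter_upwards [ae_treeWt_pos hρ d, ih (fun l m h1 h2 => hmono l m h1 (by omega))
        (fun l hl => hmono l d hl (by omega))] with Z h1 h2
      exact ae_tsum_lastWt (hx d) (hρ d) h1 h2 (hy d (by omega))

lemma ae_sortable_treeWt (hx : ∀ l, 0 < x l) (hx1 : ∀ l, x l < 1)
    (hρ : ∀ l, IsREMLaw (x l) (ρ l)) (d : ℕ) (hmono : ∀ l m, l < m → m ≤ d → x l < x m) :
    ∀ᵐ Z ∂treeMeas ρ (d + 1), Sortable (treeWt Z) := by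
  have := fun l => (hρ l).isProbabilityMeasure
  refine ae_treeMeas_succ measurableSet_sortable ?_
  filter_upwards [ae_treeWt_pos hρ d, ae_tsum_treeWt hx hρ d (fun l m h1 h2 => hmono l m h1 (by omega))
        (fun l hl => hmono l d hl (by omega))] with Z h1 h2
  exact ae_sortable_lastWt (hx d) (hx1 d) (hρ d) h1 h2

/-- Given the earlier levels, the normalized weights are independent of the overlaps and have a law
`n₀` not depending on the condition. Integration over the earlier levels keeps the product form. -/
theorem indepFun_overlap_normWt (q : ℕ → unitInterval) (hx : ∀ l, 0 < x l) (hx1 : ∀ l, x l < 1)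
    (hρ : ∀ l, IsREMLaw (x l) (ρ l)) (d : ℕ) (hmono : ∀ l m, l < m → m ≤ d → x l < x m) :
    IndepFun (fun Z => orderedOverlap q (treeWt Z)) (fun Z => normWt (treeWt Z))
      (treeMeas ρ (d + 1)) := by
  have := fun l => (hρ l).isProbabilityMeasure
  set B := Measure.infinitePi fun _ : Fin d → ℕ => ρ d with hB
  set n₀ := (ρ d).map fun t i => t i / (∑' j, ENNReal.ofReal (t j)).toReal with hn₀
  have hwm : Measurable fun z : (Vertex d → ℕ → ℝ) × ((Fin d → ℕ) → ℕ → ℝ) =>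
      lastWt (treeWt z.1) z.2 := by
    refine measurable_pi_lambda _ fun α => ?_
    have := (measurable_pi_apply (Fin.init α : Fin d → ℕ)).comp (measurable_treeWt (d := d))
    unfold lastWt
    exact (this.comp measurable_fst).mul (by fun_prop)
  have hQ := measurable_orderedOverlap (d := d) q
  have hN := measurable_normWt (A := Fin (d + 1) → ℕ)
  have hn₀p : IsProbabilityMeasure n₀ := by
    rw [hn₀]
    exact Measure.isProbabilityMeasure_map (measurable_pi_lambda _ fun i =>
      (measurable_pi_apply i).div (Measurable.tsum fun a =>
        (measurable_pi_apply a).ennreal_ofReal).ennreal_toReal).aemeasurable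
  have hae := (ae_treeWt_pos hρ d).and
    (ae_tsum_treeWt hx hρ d (fun l m h1 h2 => hmono l m h1 (by omega))
      (fun l hl => hmono l d hl (by omega)))
  have hstep : ∀ s t, MeasurableSet s → MeasurableSet t →
      treeMeas ρ (d + 1) ((fun Z => orderedOverlap q (treeWt Z)) ⁻¹' s ∩
        (fun Z => normWt (treeWt Z)) ⁻¹' t) =
      (∫⁻ Z, B ((fun u => orderedOverlap q (lastWt (treeWt Z) u)) ⁻¹' s) ∂treeMeas ρ d) * n₀ t := by
    intro s t hs ht
    have hst : MeasurableSet {w : (Fin (d + 1) → ℕ) → ℝ | orderedOverlap q w ∈ s ∧ normWt w ∈ t} :=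
      (hQ hs).inter (hN ht)
    have h1 : (fun Z => orderedOverlap q (treeWt Z)) ⁻¹' s ∩ (fun Z => normWt (treeWt Z)) ⁻¹' t =
        (fun Z : Vertex (d + 1) → ℕ → ℝ => ((fun v => Z (vertexLower v), fun v => Z (vertexLast v)) :
          (Vertex d → ℕ → ℝ) × ((Fin d → ℕ) → ℕ → ℝ))) ⁻¹' ((fun z => lastWt (treeWt z.1) z.2) ⁻¹'
          {w | orderedOverlap q w ∈ s ∧ normWt w ∈ t}) := by
      ext Z
      simp only [mem_inter_iff, mem_preimage, mem_ofPred_eq, treeWt_eq_lastWt Z]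
    rw [h1, ← Measure.map_apply (by fun_prop) (hwm hst), map_lower_last,
      Measure.prod_apply (hwm hst), ← lintegral_mul_const']
    · refine lintegral_congr_ae ?_
      filter_upwards [hae] with Z hZ
      obtain ⟨M, hM, hmap⟩ := map_normWt_overlap q (hx d) (hx1 d) (hρ d) hZ.1 hZ.2
      have hwZ : Measurable fun u => lastWt (treeWt Z) u :=
        measurable_pi_lambda _ fun α => measurable_lastWt _ α
      have hpair : Measurable fun u => (normWt (lastWt (treeWt Z) u),
          orderedOverlap q (lastWt (treeWt Z) u)) := (hN.comp hwZ).prodMk (hQ.comp hwZ)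
      have h2 := congrArg (fun μ => μ (t ×ˢ s)) hmap
      have h3 := congrArg (fun μ => μ (univ ×ˢ s)) hmap
      simp only [Measure.prod_prod] at h2 h3
      rw [Measure.map_apply hpair (ht.prod hs)] at h2
      rw [Measure.map_apply hpair (MeasurableSet.univ.prod hs)] at h3
      have h4 : n₀ univ = 1 := measure_univ
      rw [← hn₀] at h2 h3
      rw [h4, one_mul] at h3
      rw [mul_comm, ← hB] at h2
      rw [← h3] at h2
      refine Eq.trans ?_ (h2.trans ?_)
      · congr 1
        ext u
        simp [mem_ofPred_eq, and_comm]
      · congr 2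
        ext u
        simp
    · exact measure_ne_top _ _
  rw [indepFun_iff_measure_inter_preimage_eq_mul]
  intro s t hs ht
  have h1 := hstep univ t .univ ht
  have h2 := hstep s univ hs .univ
  simp only [preimage_univ, univ_inter, inter_univ, measure_univ, lintegral_const, mul_one,
    one_mul] at h1 h2
  rw [hstep s t hs ht, h1, h2]

end Cascade
end GREM

namespace GREM

/-! ### Centered Gaussian processes -/

section Gaussian

variable {Ω T : Type*} [MeasurableSpace Ω] {P : Measure Ω}

lemma memLp_two_of_isGaussianProcess {X : T → Ω → ℝ} (h : IsGaussianProcess X P) (t : T) :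
    MemLp (X t) 2 P := (h.hasGaussianLaw_eval t).memLp_two

/-- A centered Gaussian process is determined by its covariance. -/
theorem map_eq_of_covariance_eq [IsProbabilityMeasure P] {X Y : T → Ω → ℝ}
    (hX : IsGaussianProcess X P) (hY : IsGaussianProcess Y P) (mX : ∀ t, Measurable (X t))
    (mY : ∀ t, Measurable (Y t)) (hX0 : ∀ t, ∫ ω, X t ω ∂P = 0) (hY0 : ∀ t, ∫ ω, Y t ω ∂P = 0)
    (h : ∀ s t, cov[X s, X t; P] = cov[Y s, Y t; P]) :
    P.map (fun ω t => X t ω) = P.map fun ω t => Y t ω := by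
  classical
  have mX' : Measurable fun ω t => X t ω := measurable_pi_lambda _ mX
  have mY' : Measurable fun ω t => Y t ω := measurable_pi_lambda _ mY
  rw [map_eq_iff_forall_finset_map_restrict_eq mX'.aemeasurable mY'.aemeasurable]
  intro I
  have mXI : Measurable fun ω => I.restrict (X · ω) := measurable_pi_lambda _ fun i => mX i
  have mYI : Measurable fun ω => I.restrict (Y · ω) := measurable_pi_lambda _ fun i => mY i
  have := Measure.isProbabilityMeasure_map (μ := P) mXI.aemeasurable
  have := Measure.isProbabilityMeasure_map (μ := P) mYI.aemeasurable
  refine Measure.ext_of_charFunDual (funext fun L => ?_)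
  -- Every continuous linear functional of a finite marginal is centered Gaussian with variance a
  -- quadratic form in the covariances; these one-dimensional laws determine the marginal.
  have key : ∀ Z : T → Ω → ℝ, IsGaussianProcess Z P → (∀ t, Measurable (Z t)) →
      (∀ t, ∫ ω, Z t ω ∂P = 0) → (P.map fun ω => I.restrict (Z · ω)).map L =
        gaussianReal 0 (∑ i : I, ∑ j : I, L (Pi.single i 1) * (L (Pi.single j 1) *
          cov[Z i, Z j; P])).toNNReal := by
    intro Z hZ mZ hZ0
    have hL : ∀ v : I → ℝ, L v = ∑ i, L (Pi.single i 1) * v i := by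
      intro v
      conv_lhs => rw [← Finset.univ_sum_single v, map_sum]
      refine Finset.sum_congr rfl fun i _ => ?_
      rw [show (Pi.single i (v i) : I → ℝ) = v i • Pi.single i 1 by
        rw [← Pi.single_smul, smul_eq_mul, mul_one], map_smul, smul_eq_mul, mul_comm]
    have hmem : ∀ i : I, MemLp (fun ω => L (Pi.single i 1) * Z i ω) 2 P := fun i =>
      (memLp_two_of_isGaussianProcess hZ i).const_mul _
    have h1 : HasGaussianLaw (fun ω => L (I.restrict (Z · ω))) P := (hZ.hasGaussianLaw I).map L
    have mZI : Measurable fun ω => I.restrict (Z · ω) := measurable_pi_lambda _ fun i => mZ i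
    rw [Measure.map_map (by fun_prop) mZI]
    refine h1.map_eq_gaussianReal.trans ?_
    have h2 : (fun ω => L (I.restrict (Z · ω))) = fun ω => ∑ i : I, L (Pi.single i 1) * Z i ω :=
      funext fun ω => hL _
    have hv : Var[fun ω => ∑ i : I, L (Pi.single i 1) * Z i ω; P] =
        ∑ i : I, ∑ j : I, L (Pi.single i 1) * (L (Pi.single j 1) * cov[Z i, Z j; P]) := by
      rw [← covariance_self (by fun_prop), covariance_fun_sum_fun_sum hmem hmem]
      simp_rw [covariance_const_mul_left, covariance_const_mul_right]
    rw [h2, hv]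
    congr 1
    rw [integral_finsetSum _ fun i _ => (hmem i).integrable (by norm_num)]
    simp [integral_const_mul, hZ0]
  rw [charFunDual_eq_charFun_map_one, charFunDual_eq_charFun_map_one, key X hX mX hX0,
    key Y hY mY hY0]
  simp_rw [h]

/-- A process whose values are differences of values of a Gaussian process. -/
lemma isGaussianProcess_sub {S : Type*} {X : T → Ω → ℝ} (hX : IsGaussianProcess X P) (f g : S → T) :
    IsGaussianProcess (fun s ω => X (f s) ω - X (g s) ω) P := by
  classical
  exact hX.of_isGaussianProcess fun s => ⟨{f s, g s},
    { toFun := fun x => x ⟨f s, by simp⟩ - x ⟨g s, by simp⟩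
      map_add' := fun x y => by simp; abel
      map_smul' := fun c x => by simp; ring },
    by simp⟩

end Gaussian

/-! ### Branching paths -/

section Paths

/-- Continue the path `y`, stopped at `a`, by the increment `u`, stopped at `b`. -/
def step (a b : unitInterval) (y u : unitInterval → ℝ) : unitInterval → ℝ :=
  fun r => y (r ⊓ a) + u (r ⊓ b)

lemma measurable_step (a b : unitInterval) : Measurable fun p : (unitInterval → ℝ) ×
    (unitInterval → ℝ) => step a b p.1 p.2 := by
  unfold step; fun_prop

/-- Continue a path by an increment with law `γ`. -/
noncomputable def stepKernel (a b : unitInterval) (γ : Measure (unitInterval → ℝ)) :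
    Kernel (unitInterval → ℝ) (unitInterval → ℝ) :=
  (Kernel.id ×ₖ Kernel.const _ γ).map fun p => step a b p.1 p.2

instance (a b : unitInterval) (γ : Measure (unitInterval → ℝ)) [IsProbabilityMeasure γ] :
    IsMarkovKernel (stepKernel a b γ) :=
  Kernel.IsMarkovKernel.map _ (measurable_step a b)

lemma stepKernel_apply (a b : unitInterval) (γ : Measure (unitInterval → ℝ))
    [IsProbabilityMeasure γ] (y : unitInterval → ℝ) :
    stepKernel a b γ y = γ.map (step a b y) := by
  have h := measurable_step a b
  rw [stepKernel, Kernel.map_apply _ h, Kernel.prod_apply, Kernel.id_apply, Kernel.const_apply,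
    Measure.dirac_prod, Measure.map_map h (by fun_prop)]
  rfl

/-- The paths at the leaves of the tree, from the root path and the increments. -/
def buildPath : (d : ℕ) → (ℕ → unitInterval) → (unitInterval → ℝ) →
    (Vertex d → ℕ → unitInterval → ℝ) → (Fin d → ℕ) → unitInterval → ℝ
  | 0, _, y, _, _ => y
  | d + 1, a, y, Y, α => buildPath d (fun l => a (l + 1)) (step (a 0) (a 1) y (Y (vertexRoot d) (α 0)))
      (fun v => Y (vertexCons (α 0) v)) (Fin.tail α)

/-- The hypothesis `hy` says that the root path is stopped at `a 0`; one step makes it stopped at `a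
1`, so the induction goes through. -/
lemma buildPath_apply (d : ℕ) {a : ℕ → unitInterval} (ha : Monotone a) {y : unitInterval → ℝ}
    (hy : ∀ r, y (r ⊓ a 0) = y r) (Y : Vertex d → ℕ → unitInterval → ℝ) (α : Fin d → ℕ)
    (r : unitInterval) : buildPath d a y Y α r =
      y r + ∑ l : Fin d, Y (vertex α l) (α l) (r ⊓ a (l + 1)) := by
  induction d generalizing a y with
  | zero => simp [buildPath]
  | succ d ih =>
    rw [buildPath, ih (fun l m h => ha (by omega)), Fin.sum_univ_succ, ← add_assoc]
    · simp_rw [vertex_zero, vertex_succ]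
      congr 1
      rw [step, hy]
      rfl
    · intro r
      have h1 : a 0 ≤ a 1 := ha (by omega)
      simp only [step, zero_add, inf_assoc, inf_idem, inf_eq_right.2 h1]

lemma measurable_buildPath (d : ℕ) (a : ℕ → unitInterval) : Measurable fun p : (unitInterval → ℝ) ×
    (Vertex d → ℕ → unitInterval → ℝ) => buildPath d a p.1 p.2 := by
  induction d generalizing a with
  | zero => exact measurable_pi_lambda _ fun α => measurable_fst
  | succ d ih =>
    refine measurable_pi_lambda _ fun α => ?_
    have h1 := (measurable_pi_apply (Fin.tail α)).comp (ih fun l => a (l + 1))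
    have h2 : Measurable fun p : (unitInterval → ℝ) × (Vertex (d + 1) → ℕ → unitInterval → ℝ) =>
        (step (a 0) (a 1) p.1 (p.2 (vertexRoot d) (α 0)), fun v => p.2 (vertexCons (α 0) v)) :=
      ((measurable_step (a 0) (a 1)).comp (measurable_fst.prodMk
        ((measurable_pi_apply (α 0)).comp ((measurable_pi_apply _).comp measurable_snd)))).prodMk
        (measurable_pi_lambda _ fun v => (measurable_pi_apply _).comp measurable_snd)
    exact h1.comp h2

variable {γ : ℕ → Measure (unitInterval → ℝ)} [∀ l, IsProbabilityMeasure (γ l)]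

/-- Realizes the branching chain as a deterministic function of independent increments, the form in
which the Gaussian field is compared with it. -/
theorem treeLaw_stepKernel (d : ℕ) (a : ℕ → unitInterval) (γ : ℕ → Measure (unitInterval → ℝ))
    [∀ l, IsProbabilityMeasure (γ l)] (y : unitInterval → ℝ) :
    treeLaw d (fun l => stepKernel (a l) (a (l + 1)) (γ l)) y =
      (treeMeas (fun l => Measure.infinitePi fun _ : ℕ => γ l) d).map (buildPath d a y) := by
  have hb : ∀ d a y, Measurable (buildPath d a y) := fun d a y =>
    (measurable_buildPath d a).comp measurable_prodMk_left
  induction d generalizing a γ y with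
  | zero =>
    rw [treeLaw_zero, show buildPath 0 a y = fun _ _ => y from rfl, Measure.map_const, measure_univ,
      one_smul]
  | succ d ih =>
    set Γ := treeMeas (fun l => Measure.infinitePi fun _ : ℕ => γ (l + 1)) d with hΓ
    let F : (unitInterval → ℝ) × (Vertex d → ℕ → unitInterval → ℝ) →
      (Fin d → ℕ) → unitInterval → ℝ := fun p =>
        buildPath d (fun l => a (l + 1)) (step (a 0) (a 1) y p.1) p.2
    have hF : Measurable F := (measurable_buildPath d fun l => a (l + 1)).comp
      (((measurable_step (a 0) (a 1)).comp (measurable_const.prodMk measurable_fst)).prodMk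
        measurable_snd)
    have hs : Measurable (step (a 0) (a 1) y) := (measurable_step _ _).comp measurable_prodMk_left
    have h1 : childLaw d (fun l => stepKernel (a l) (a (l + 1)) (γ l)) y =
        ((γ 0).prod Γ).map F := by
      ext A hA
      rw [childLaw, Measure.bind_apply hA (Kernel.aemeasurable _), stepKernel_apply,
        lintegral_map (Kernel.measurable_coe _ hA) hs, Measure.map_apply hF hA,
        Measure.prod_apply (hF hA)]
      refine lintegral_congr fun u => ?_
      rw [treeKernel_apply, ih (fun l => a (l + 1)) (fun l => γ (l + 1)),
        Measure.map_apply (hb _ _ _) hA]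
      rfl
    have hg := measurable_glueVertex (X := ℕ → unitInterval → ℝ) (d := d)
    have hu : Measurable fun m : ℕ → (unitInterval → ℝ) × (Vertex d → ℕ → unitInterval → ℝ) =>
        ((fun i => (m i).1, fun i => (m i).2) :
          (ℕ → unitInterval → ℝ) × (ℕ → Vertex d → ℕ → unitInterval → ℝ)) := by fun_prop
    have hFm : Measurable fun (m : ℕ → (unitInterval → ℝ) × (Vertex d → ℕ → unitInterval → ℝ)) i =>
        F (m i) := measurable_pi_lambda _ fun j => hF.comp (measurable_pi_apply j)
    rw [treeLaw_succ, h1, treeMeas_succ, Measure.map_map (hb _ _ _) hg,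
      ← Measure.infinitePi_map_pi (fun _ : ℕ => (γ 0).prod Γ) (fun _ => hF),
      ← map_unzip_infinitePi, Measure.map_map ((hb _ _ _).comp hg) hu,
      Measure.map_map measurable_glueLeaf hFm]
    rfl

end Paths
end GREM

namespace GREM

/-! ### The levels and the overlaps -/

section Levels

variable {k : ℕ} {x : ℕ → ℝ} {q : ℕ → unitInterval}

/-- The levels, continued by `1`. -/
def lvl (k : ℕ) (q : ℕ → unitInterval) (l : ℕ) : unitInterval := q (min l (k + 1))

/-- The parameters of the processes at depth `l`, continued by the last one. -/
def par (k : ℕ) (x : ℕ → ℝ) (l : ℕ) : ℝ := x (min (l + 1) k)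

lemma lvl_of_le {l : ℕ} (h : l ≤ k + 1) : lvl k q l = q l := by rw [lvl, min_eq_left h]

lemma IsAtomic.lvl_last (h : IsAtomic k x q) {l : ℕ} (hl : k + 1 ≤ l) : lvl k q l = 1 := by
  rw [lvl, min_eq_right hl, h.q_last]

lemma IsAtomic.monotone_lvl (h : IsAtomic k x q) : Monotone (lvl k q) := by
  refine monotone_nat_of_le_succ fun l => ?_
  rcases le_or_gt (k + 1) l with hl | hl
  · rw [h.lvl_last hl, h.lvl_last (by omega)]
  · rw [lvl_of_le hl.le, lvl_of_le (by omega : l + 1 ≤ k + 1)]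
    rcases Nat.eq_zero_or_pos l with rfl | h0
    · rw [h.q_zero]; exact bot_le
    · exact (h.q_lt l h0 (by omega)).le

lemma IsAtomic.x_strictMono (h : IsAtomic k x q) {l m : ℕ} (hlm : l < m) (hm : m ≤ k + 1) :
    x l < x m := by
  induction m, hlm using Nat.le_induction with
  | base => exact h.x_lt l (by omega)
  | succ n hn ih => exact (ih (by omega)).trans (h.x_lt n (by omega))

lemma IsAtomic.par_pos (h : IsAtomic k x q) (l : ℕ) : 0 < par k x l := by
  have h1 := h.one_le
  rw [← h.x_zero]
  exact h.x_strictMono (by omega) (by omega)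

lemma IsAtomic.par_lt_one (h : IsAtomic k x q) (l : ℕ) : par k x l < 1 := by
  have h1 := h.one_le
  rw [← h.x_last]
  exact h.x_strictMono (by omega) (by omega)

lemma IsAtomic.par_lt (h : IsAtomic k x q) {l m : ℕ} (hlm : l < m) (hm : m < k) :
    par k x l < par k x m := by
  unfold par
  rw [min_eq_left (by omega), min_eq_left (by omega)]
  exact h.x_strictMono (by omega) (by omega)

lemma IsAtomic.le_overlap (h : IsAtomic k x q) {l : ℕ} (hl : l ≤ k) {α β : Fin k → ℕ}
    (hA : Agree l α β) : q (l + 1) ≤ overlap q α β :=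
  (levelRel_overlap_iff h (fun n => if n = 0 then α else β) hl 0 1).2 (by simpa using hA)

lemma IsAtomic.overlap_self_eq (h : IsAtomic k x q) (α : Fin k → ℕ) : overlap q α α = 1 := by
  have h1 := h.le_overlap le_rfl (α := α) (β := α) fun _ _ => rfl
  rw [h.q_last] at h1
  exact le_antisymm unitInterval.le_one' h1

lemma IsAtomic.overlap_le (h : IsAtomic k x q) {l : ℕ} (hl : l < k) {α β : Fin k → ℕ}
    (hA : ¬ Agree (l + 1) α β) : overlap q α β ≤ q (l + 1) := by
  classical
  unfold overlap
  refine Finset.sup_le fun m hm => ?_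
  simp only [Finset.mem_filter, Finset.mem_range] at hm
  have hml : m ≤ l := by
    by_contra hc
    exact hA (hm.2.mono (by omega))
  rw [← lvl_of_le (q := q) (k := k) (by omega : m + 1 ≤ k + 1),
    ← lvl_of_le (q := q) (k := k) (by omega : l + 1 ≤ k + 1)]
  exact h.monotone_lvl (by omega)

lemma overlap_comm (q : ℕ → unitInterval) (α β : Fin k → ℕ) : overlap q α β = overlap q β α := by
  classical
  unfold overlap
  congr 1
  refine Finset.filter_congr fun l _ => ?_
  exact ⟨fun h i hi => (h i hi).symm, fun h i hi => (h i hi).symm⟩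

/-- A leaf above the child `j` of the inner vertex `v`. -/
def extLeaf (v : Vertex k) (j : ℕ) (i : Fin k) : ℕ :=
  if h : (i : ℕ) < v.1 then v.2 ⟨i, h⟩ else if i = v.1 then j else 0

lemma agree_extLeaf (α : Fin k → ℕ) (l : Fin k) :
    Agree ((l : ℕ) + 1) (extLeaf (vertex α l) (α l)) α := by
  intro i hi
  unfold extLeaf
  split_ifs with h1 h2
  · rfl
  · rw [h2]; rfl
  · exact absurd (Fin.ext (by simp only [vertex, not_lt] at h1; omega) : i = l) h2

lemma extLeaf_eq {l : Fin k} {u v : Fin l → ℕ} {i j : ℕ}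
    (h : Agree ((l : ℕ) + 1) (extLeaf ⟨l, u⟩ i) (extLeaf ⟨l, v⟩ j)) : u = v ∧ i = j := by
  refine ⟨funext fun m => ?_, ?_⟩
  · have h1 := h ⟨m, by omega⟩ (by simp only []; omega)
    simpa [extLeaf, m.2] using h1
  · have h1 := h l (by simp)
    simpa [extLeaf] using h1

end Levels

/-! ### The law of the field -/

section Field

variable {Ω : Type*} [MeasurableSpace Ω] {P : Measure Ω} [IsProbabilityMeasure P] {k : ℕ}
  {x : ℕ → ℝ} {q : ℕ → unitInterval} {g : ℝ → ℝ} {ζ : Vertex k → ℕ → Ω → ℝ}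
  {κ : (Fin k → ℕ) → unitInterval → Ω → ℝ}

/-- The increments of the path of the leaf `α` between `a` and `b`. -/
def incr (κ : (Fin k → ℕ) → unitInterval → Ω → ℝ) (α : Fin k → ℕ) (a b : unitInterval) (ω : Ω)
    (r : unitInterval) : ℝ :=
  κ α (r ⊓ b) ω - κ α (r ⊓ a) ω

/-- The law of the increment at depth `l`. -/
noncomputable def incrLaw (P : Measure Ω) (κ : (Fin k → ℕ) → unitInterval → Ω → ℝ)
    (q : ℕ → unitInterval) (l : ℕ) : Measure (unitInterval → ℝ) :=
  P.map (incr κ (fun _ => 0) (lvl k q (l + 1)) (lvl k q (l + 2)))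

/-- The law of the path up to the first level. -/
noncomputable def rootLaw (P : Measure Ω) (κ : (Fin k → ℕ) → unitInterval → Ω → ℝ)
    (q : ℕ → unitInterval) : Measure (unitInterval → ℝ) :=
  P.map fun ω r => κ (fun _ => 0) (r ⊓ lvl k q 1) ω

/-- The transition kernels of the field. -/
noncomputable def fieldKernel (P : Measure Ω) (κ : (Fin k → ℕ) → unitInterval → Ω → ℝ)
    (q : ℕ → unitInterval) (l : ℕ) : Kernel (unitInterval → ℝ) (unitInterval → ℝ) :=
  stepKernel (lvl k q (l + 1)) (lvl k q (l + 2)) (incrLaw P κ q l)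

namespace IsGREMWithField

lemma measurable_incr (hG : IsGREMWithField P k x q g ζ κ) (α : Fin k → ℕ) (a b : unitInterval) :
    Measurable (incr κ α a b) :=
  measurable_pi_lambda _ fun r => (hG.measurable_field _ _).sub (hG.measurable_field _ _)

lemma isProbabilityMeasure_incrLaw (hG : IsGREMWithField P k x q g ζ κ) (l : ℕ) :
    IsProbabilityMeasure (incrLaw P κ q l) :=
  Measure.isProbabilityMeasure_map (hG.measurable_incr _ _ _).aemeasurable

lemma measurable_root (hG : IsGREMWithField P k x q g ζ κ) :
    Measurable fun ω r => κ (fun _ => 0) (r ⊓ lvl k q 1) ω :=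
  measurable_pi_lambda _ fun r => hG.measurable_field _ _

lemma isProbabilityMeasure_rootLaw (hG : IsGREMWithField P k x q g ζ κ) :
    IsProbabilityMeasure (rootLaw P κ q) :=
  Measure.isProbabilityMeasure_map hG.measurable_root.aemeasurable

lemma isMarkovKernel_fieldKernel (hG : IsGREMWithField P k x q g ζ κ) (l : ℕ) :
    IsMarkovKernel (fieldKernel P κ q l) := by
  have := hG.isProbabilityMeasure_incrLaw l
  unfold fieldKernel; infer_instance

lemma memLp (hG : IsGREMWithField P k x q g ζ κ) (α : Fin k → ℕ) (r : unitInterval) :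
    MemLp (κ α r) 2 P := memLp_two_of_isGaussianProcess hG.gaussian (α, r)

lemma cov_sub_sub (hG : IsGREMWithField P k x q g ζ κ) (α₁ α₂ α₃ α₄ : Fin k → ℕ)
    (r₁ r₂ r₃ r₄ : unitInterval) :
    cov[fun ω => κ α₁ r₁ ω - κ α₂ r₂ ω, fun ω => κ α₃ r₃ ω - κ α₄ r₄ ω; P] =
      g ((r₁ ⊓ r₃ ⊓ overlap q α₁ α₃ : unitInterval) : ℝ) -
        g ((r₁ ⊓ r₄ ⊓ overlap q α₁ α₄ : unitInterval) : ℝ) -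
        g ((r₂ ⊓ r₃ ⊓ overlap q α₂ α₃ : unitInterval) : ℝ) +
        g ((r₂ ⊓ r₄ ⊓ overlap q α₂ α₄ : unitInterval) : ℝ) := by
  rw [covariance_fun_sub_fun_sub (hG.memLp _ _) (hG.memLp _ _) (hG.memLp _ _) (hG.memLp _ _)]
  simp only [hG.covariance]

lemma integral_sub_eq_zero (hG : IsGREMWithField P k x q g ζ κ) (α β : Fin k → ℕ)
    (r s : unitInterval) : ∫ ω, κ α r ω - κ β s ω ∂P = 0 := by
  rw [integral_sub ((hG.memLp _ _).integrable (by norm_num))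
    ((hG.memLp _ _).integrable (by norm_num)), hG.centered, hG.centered, sub_zero]

/-- Below the overlap all four covariances equal `g r`, so the difference is centered with variance
zero. -/
lemma ae_eq (hxq : IsAtomic k x q) (hG : IsGREMWithField P k x q g ζ κ) {α β : Fin k → ℕ}
    {r : unitInterval} (hr : r ≤ overlap q α β) : ∀ᵐ ω ∂P, κ α r ω = κ β r ω := by
  have hr' : r ≤ overlap q β α := by
    rwa [overlap_comm]
  have h1 := hG.cov_sub_sub α β α β r r r r
  have hm : Measurable fun ω => κ α r ω - κ β r ω :=
    (hG.measurable_field _ _).sub (hG.measurable_field _ _)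
  rw [hxq.overlap_self_eq, hxq.overlap_self_eq, inf_idem, inf_eq_left.2 hr, inf_eq_left.2 hr',
    inf_eq_left.2 unitInterval.le_one', covariance_self hm.aemeasurable] at h1
  have h2 : Var[fun ω => κ α r ω - κ β r ω; P] = 0 := by linarith
  have h3 := ae_eq_integral_of_variance_eq_zero ((hG.memLp α r).sub (hG.memLp β r)) h2
  filter_upwards [h3] with ω hω
  have h4 := hG.integral_sub_eq_zero α β r r
  simp only [Pi.sub_apply] at hω
  rw [h4] at hω
  linarith

end IsGREMWithField

lemma inf_inf_eq_of_le {a a' b' r s : unitInterval} (h1 : a ≤ a') (h2 : a ≤ b') :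
    (r ⊓ a) ⊓ (s ⊓ a') = (r ⊓ a) ⊓ (s ⊓ b') := by
  rw [inf_inf_inf_comm, inf_inf_inf_comm r a s b', inf_eq_left.2 h1, inf_eq_left.2 h2]

lemma inf_inf_eq_of_ge {c c' o r s : unitInterval} (h1 : o ≤ c) (h2 : o ≤ c') :
    (r ⊓ c) ⊓ (s ⊓ c') ⊓ o = r ⊓ s ⊓ o := by
  rw [inf_inf_inf_comm, inf_assoc (r ⊓ s), inf_eq_right.2 (le_inf h1 h2)]

end Field
end GREM

namespace GREM
namespace IsGREMWithField

variable {Ω : Type*} [MeasurableSpace Ω] {P : Measure Ω} [IsProbabilityMeasure P] {k : ℕ}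
  {x : ℕ → ℝ} {q : ℕ → unitInterval} {g : ℝ → ℝ} {ζ : Vertex k → ℕ → Ω → ℝ}
  {κ : (Fin k → ℕ) → unitInterval → Ω → ℝ}

/-- The increment above the child `j` of the inner vertex `v`. -/
def mark (q : ℕ → unitInterval) (κ : (Fin k → ℕ) → unitInterval → Ω → ℝ) (v : Vertex k) (j : ℕ) :
    Ω → unitInterval → ℝ :=
  incr κ (extLeaf v j) (lvl k q (v.1 + 1)) (lvl k q (v.1 + 2))

lemma measurable_mark (hG : IsGREMWithField P k x q g ζ κ) (v : Vertex k) (j : ℕ) :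
    Measurable (mark q κ v j) := hG.measurable_incr _ _ _

lemma map_incr (hxq : IsAtomic k x q) (hG : IsGREMWithField P k x q g ζ κ) (α β : Fin k → ℕ)
    (a b : unitInterval) : P.map (incr κ α a b) = P.map (incr κ β a b) := by
  refine map_eq_of_covariance_eq (X := fun r ω => incr κ α a b ω r)
    (Y := fun r ω => incr κ β a b ω r)
    (isGaussianProcess_sub hG.gaussian (fun r => (α, r ⊓ b)) fun r => (α, r ⊓ a))
    (isGaussianProcess_sub hG.gaussian (fun r => (β, r ⊓ b)) fun r => (β, r ⊓ a))
    (fun r => (measurable_pi_apply r).comp (hG.measurable_incr _ _ _))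
    (fun r => (measurable_pi_apply r).comp (hG.measurable_incr _ _ _))
    (fun r => hG.integral_sub_eq_zero _ _ _ _) (fun r => hG.integral_sub_eq_zero _ _ _ _)
    fun r s => ?_
  unfold incr
  rw [hG.cov_sub_sub, hG.cov_sub_sub, hxq.overlap_self_eq, hxq.overlap_self_eq]

lemma map_mark (hxq : IsAtomic k x q) (hG : IsGREMWithField P k x q g ζ κ) (v : Vertex k) (j : ℕ) :
    P.map (mark q κ v j) = incrLaw P κ q v.1 := hG.map_incr hxq _ _ _ _

/-- The increment at the smaller depth ends no later than the other one begins, so the four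
covariances cancel in pairs. -/
lemma cov_mark_of_lt (hxq : IsAtomic k x q) (hG : IsGREMWithField P k x q g ζ κ) {u v : Vertex k}
    (huv : u.1 < v.1) (i j : ℕ) (r s : unitInterval) :
    cov[fun ω => mark q κ u i ω r, fun ω => mark q κ v j ω s; P] = 0 := by
  have hm := hxq.monotone_lvl
  have huv' : (u.1 : ℕ) < v.1 := huv
  unfold mark incr
  rw [hG.cov_sub_sub, inf_inf_eq_of_le (hm (by omega : (u.1 : ℕ) + 2 ≤ v.1 + 2))
    (hm (by omega : (u.1 : ℕ) + 2 ≤ v.1 + 1)),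
    inf_inf_eq_of_le (hm (by omega : (u.1 : ℕ) + 1 ≤ v.1 + 2))
    (hm (by omega : (u.1 : ℕ) + 1 ≤ v.1 + 1))]
  ring

/-- At equal depth, distinct edges have leaves whose overlap is at most the level at which both
increments start. All four covariances are then `g` at `r ⊓ s ⊓ overlap`, and they cancel. -/
lemma cov_mark (hxq : IsAtomic k x q) (hG : IsGREMWithField P k x q g ζ κ)
    {p p' : Vertex k × ℕ} (h : p ≠ p') (r s : unitInterval) :
    cov[fun ω => mark q κ p.1 p.2 ω r, fun ω => mark q κ p'.1 p'.2 ω s; P] = 0 := by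
  obtain ⟨⟨l, u⟩, i⟩ := p
  obtain ⟨⟨m, v⟩, j⟩ := p'
  rcases lt_trichotomy l m with hlm | rfl | hlm
  · exact hG.cov_mark_of_lt hxq hlm _ _ _ _
  · have hA : ¬ Agree ((l : ℕ) + 1) (extLeaf ⟨l, u⟩ i) (extLeaf ⟨l, v⟩ j) := fun hA => by
      obtain ⟨rfl, rfl⟩ := extLeaf_eq hA
      exact h rfl
    have h1 := hxq.overlap_le l.2 hA
    rw [← lvl_of_le (k := k) (q := q) (by omega)] at h1
    have h2 := h1.trans (hxq.monotone_lvl (by omega : (l : ℕ) + 1 ≤ l + 2))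
    unfold mark incr
    simp only []
    rw [hG.cov_sub_sub, inf_inf_eq_of_ge h2 h2, inf_inf_eq_of_ge h2 h1, inf_inf_eq_of_ge h1 h2,
      inf_inf_eq_of_ge h1 h1]
    ring
  · rw [covariance_comm]
    exact hG.cov_mark_of_lt hxq hlm _ _ _ _

lemma isGaussianProcess_mark (hG : IsGREMWithField P k x q g ζ κ) :
    IsGaussianProcess (fun (s : (_ : Vertex k × ℕ) × unitInterval) ω =>
      mark q κ s.1.1 s.1.2 ω s.2) P :=
  isGaussianProcess_sub hG.gaussian
    (fun s : (_ : Vertex k × ℕ) × unitInterval =>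
      (extLeaf s.1.1 s.1.2, s.2 ⊓ lvl k q (s.1.1.1 + 2)))
    (fun s => (extLeaf s.1.1 s.1.2, s.2 ⊓ lvl k q (s.1.1.1 + 1)))

lemma iIndepFun_mark (hxq : IsAtomic k x q) (hG : IsGREMWithField P k x q g ζ κ) :
    iIndepFun (fun (p : Vertex k × ℕ) ω (r : unitInterval) => mark q κ p.1 p.2 ω r) P := by
  have hmeas : ∀ (p : Vertex k × ℕ) (r : unitInterval),
      AEMeasurable (fun ω => mark q κ p.1 p.2 ω r) P := fun p r =>
    ((measurable_pi_apply r).comp (hG.measurable_mark p.1 p.2)).aemeasurable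
  have hcov : ∀ p p' : Vertex k × ℕ, p ≠ p' → ∀ r s : unitInterval,
      cov[fun ω => mark q κ p.1 p.2 ω r, fun ω => mark q κ p'.1 p'.2 ω s; P] = 0 :=
    fun p p' hp r s => hG.cov_mark hxq hp r s
  exact IsGaussianProcess.iIndepFun_of_covariance_eq_zero
    (S := fun _ : Vertex k × ℕ => unitInterval)
    (X := fun (p : Vertex k × ℕ) (r : unitInterval) ω => mark q κ p.1 p.2 ω r)
    hG.isGaussianProcess_mark hmeas hcov

lemma map_marks (hxq : IsAtomic k x q) (hG : IsGREMWithField P k x q g ζ κ) :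
    P.map (fun ω (p : Vertex k × ℕ) => mark q κ p.1 p.2 ω) =
      Measure.infinitePi fun p : Vertex k × ℕ => incrLaw P κ q p.1.1 := by
  have hmeas : ∀ p : Vertex k × ℕ, Measurable fun ω => mark q κ p.1 p.2 ω :=
    fun p => hG.measurable_mark p.1 p.2
  refine ((hG.iIndepFun_mark hxq).map_fun_eq_infinitePi_map hmeas).trans ?_
  congr 1
  funext p
  exact hG.map_mark hxq p.1 p.2

lemma indepFun_root_marks (hxq : IsAtomic k x q) (hG : IsGREMWithField P k x q g ζ κ) :
    IndepFun (fun ω r => κ (fun _ => 0) (r ⊓ lvl k q 1) ω)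
      (fun ω (p : (Vertex k × ℕ) × unitInterval) => mark q κ p.1.1 p.1.2 ω p.2) P := by
  classical
  refine IsGaussianProcess.indepFun_of_covariance_eq_zero
    (X := fun r ω => κ (fun _ => 0) (r ⊓ lvl k q 1) ω)
    (Y := fun (p : (Vertex k × ℕ) × unitInterval) ω => mark q κ p.1.1 p.1.2 ω p.2) ?_
    (fun r => (hG.measurable_field _ _).aemeasurable)
    (fun p => ((measurable_pi_apply p.2).comp (hG.measurable_mark p.1.1 p.1.2)).aemeasurable)
    fun r p => ?_
  · refine hG.gaussian.of_isGaussianProcess fun s => ?_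
    rcases s with r | p
    · exact ⟨{((fun _ => 0), r ⊓ lvl k q 1)},
        { toFun := fun y => y ⟨((fun _ => 0), r ⊓ lvl k q 1), by simp⟩
          map_add' := by simp
          map_smul' := by simp }, by simp⟩
    · let f : (Fin k → ℕ) × unitInterval := (extLeaf p.1.1 p.1.2, p.2 ⊓ lvl k q (p.1.1.1 + 2))
      let g : (Fin k → ℕ) × unitInterval := (extLeaf p.1.1 p.1.2, p.2 ⊓ lvl k q (p.1.1.1 + 1))
      exact ⟨{f, g},
        { toFun := fun y => y ⟨f, by simp⟩ - y ⟨g, by simp⟩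
          map_add' := fun y z => by simp; abel
          map_smul' := fun c y => by simp; ring }, by simp [mark, incr, f, g]⟩
  · have hm := hxq.monotone_lvl
    unfold mark incr
    rw [covariance_fun_sub_right (hG.memLp _ _) (hG.memLp _ _) (hG.memLp _ _), hG.covariance,
      hG.covariance, inf_inf_eq_of_le (hm (by omega : 1 ≤ (p.1.1.1 : ℕ) + 2))
      (hm (by omega : 1 ≤ (p.1.1.1 : ℕ) + 1)), sub_self]

lemma map_root_marks (hxq : IsAtomic k x q) (hG : IsGREMWithField P k x q g ζ κ) :
    P.map (fun ω => ((fun r => κ (fun _ => 0) (r ⊓ lvl k q 1) ω, fun v j => mark q κ v j ω) :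
      (unitInterval → ℝ) × (Vertex k → ℕ → unitInterval → ℝ))) =
      (rootLaw P κ q).prod
        (treeMeas (fun l => Measure.infinitePi fun _ : ℕ => incrLaw P κ q l) k) := by
  have := hG.isProbabilityMeasure_incrLaw
  have hc : Measurable fun (m : (Vertex k × ℕ) × unitInterval → ℝ) (v : Vertex k) (j : ℕ)
      (r : unitInterval) => m ((v, j), r) := by fun_prop
  have h1 := (hG.indepFun_root_marks hxq).comp measurable_id hc
  have hmk : Measurable fun ω (v : Vertex k) (j : ℕ) => mark q κ v j ω :=
    measurable_pi_lambda _ fun v => measurable_pi_lambda _ fun j => hG.measurable_mark v j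
  have h2 := h1.map_prod_eq_prod_map_map hG.measurable_root.aemeasurable
    (by exact hmk.aemeasurable)
  refine h2.trans ?_
  congr 1
  have hmp : Measurable fun ω (p : Vertex k × ℕ) => mark q κ p.1 p.2 ω :=
    measurable_pi_lambda _ fun p => hG.measurable_mark p.1 p.2
  rw [treeMeas, ← Measure.infinitePi_map_curry (fun (v : Vertex k) (_ : ℕ) => incrLaw P κ q v.1),
    ← hG.map_marks hxq, Measure.map_map (MeasurableEquiv.measurable _) hmp]
  rfl

/-- The increments along the branch of `α` telescope. The leaf `extLeaf` that defines an increment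
agrees with `α` far enough for their paths to coincide over the levels concerned. -/
lemma ae_eq_buildPath (hxq : IsAtomic k x q) (hG : IsGREMWithField P k x q g ζ κ)
    (α : Fin k → ℕ) (r : unitInterval) : ∀ᵐ ω ∂P, κ α r ω =
      buildPath k (fun l => lvl k q (l + 1)) (fun r => κ (fun _ => 0) (r ⊓ lvl k q 1) ω)
        (fun v j => mark q κ v j ω) α r := by
  have hm := hxq.monotone_lvl
  have h0 : ∀ᵐ ω ∂P, κ (fun _ => 0) (r ⊓ lvl k q 1) ω = κ α (r ⊓ lvl k q 1) ω :=
    hG.ae_eq hxq <| inf_le_right.trans <| by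
      rw [lvl_of_le (by omega)]
      exact hxq.le_overlap (Nat.zero_le k) (agree_zero _ _)
  have h1 : ∀ l : Fin k, ∀ᵐ ω ∂P, mark q κ (vertex α l) (α l) ω (r ⊓ lvl k q (l + 2)) =
      κ α (r ⊓ lvl k q (l + 2)) ω - κ α (r ⊓ lvl k q (l + 1)) ω := by
    intro l
    have ho : lvl k q (l + 2) ≤ overlap q (extLeaf (vertex α l) (α l)) α := by
      rw [lvl_of_le (by omega)]
      exact hxq.le_overlap (by omega) (agree_extLeaf α l)
    have h2 := hG.ae_eq hxq (r := r ⊓ lvl k q (l + 2)) (inf_le_right.trans ho)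
    have h3 := hG.ae_eq hxq (r := r ⊓ lvl k q (l + 1))
      (inf_le_right.trans ((hm (by omega)).trans ho))
    filter_upwards [h2, h3] with ω h2 h3
    change κ _ (r ⊓ lvl k q (l + 2) ⊓ lvl k q (l + 2)) ω -
      κ _ (r ⊓ lvl k q (l + 2) ⊓ lvl k q (l + 1)) ω = _
    rw [inf_assoc, inf_assoc, inf_idem, inf_eq_right.2 (hm (by omega : (l : ℕ) + 1 ≤ l + 2)), h2, h3]
  filter_upwards [h0, ae_all_iff.2 h1] with ω h0 h1
  rw [buildPath_apply k (fun l m hlm => hm (by omega))]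
  · rw [h0, Finset.sum_congr rfl fun l _ => h1 l,
      Fin.sum_univ_eq_sum_range (fun l => κ α (r ⊓ lvl k q (l + 2)) ω -
        κ α (r ⊓ lvl k q (l + 1)) ω), Finset.sum_range_sub fun l => κ α (r ⊓ lvl k q (l + 1)) ω,
      hxq.lvl_last le_rfl, inf_eq_left.2 unitInterval.le_one']
    ring
  · intro r
    rw [zero_add, inf_assoc, inf_idem]

/-- The field is a branching Markov chain. -/
theorem map_field (hxq : IsAtomic k x q) (hG : IsGREMWithField P k x q g ζ κ)
    [∀ l, IsMarkovKernel (fieldKernel P κ q l)] :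
    P.map (fun ω α r => κ α r ω) = treeKernel k (fieldKernel P κ q) ∘ₘ rootLaw P κ q := by
  have := hG.isProbabilityMeasure_incrLaw
  have hroot := hG.isProbabilityMeasure_rootLaw
  set a : ℕ → unitInterval := fun l => lvl k q (l + 1) with ha
  let R : Ω → (unitInterval → ℝ) × (Vertex k → ℕ → unitInterval → ℝ) := fun ω =>
    (fun r => κ (fun _ => 0) (r ⊓ lvl k q 1) ω, fun v j => mark q κ v j ω)
  have hR : Measurable R := hG.measurable_root.prodMk
    (measurable_pi_lambda _ fun v => measurable_pi_lambda _ fun j => hG.measurable_mark v j)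
  have hb := measurable_buildPath k a
  have hm1 : Measurable fun ω (p : (Fin k → ℕ) × unitInterval) => κ p.1 p.2 ω :=
    measurable_pi_lambda _ fun p => hG.measurable_field _ _
  have hm2 : Measurable fun ω (p : (Fin k → ℕ) × unitInterval) =>
      buildPath k a (R ω).1 (R ω).2 p.1 p.2 :=
    measurable_pi_lambda _ fun p => (measurable_pi_apply p.2).comp
      ((measurable_pi_apply p.1).comp (hb.comp hR))
  -- Equality at each fixed leaf and time suffices, although there are uncountably many times,
  -- because finite-dimensional laws determine the law on the product σ-algebra.
  have h1 : P.map (fun ω (p : (Fin k → ℕ) × unitInterval) => κ p.1 p.2 ω) =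
      P.map fun ω (p : (Fin k → ℕ) × unitInterval) => buildPath k a (R ω).1 (R ω).2 p.1 p.2 :=
    map_eq_of_forall_ae_eq (X := fun p : (Fin k → ℕ) × unitInterval => κ p.1 p.2)
      (Y := fun (p : (Fin k → ℕ) × unitInterval) ω => buildPath k a (R ω).1 (R ω).2 p.1 p.2)
      hm1.aemeasurable hm2.aemeasurable fun p => hG.ae_eq_buildPath hxq p.1 p.2
  have hc : Measurable fun (m : (Fin k → ℕ) × unitInterval → ℝ) (α : Fin k → ℕ)
      (r : unitInterval) => m (α, r) := by fun_prop
  have h2 := congrArg (Measure.map fun (m : (Fin k → ℕ) × unitInterval → ℝ) (α : Fin k → ℕ)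
      (r : unitInterval) => m (α, r)) h1
  rw [Measure.map_map hc hm1, Measure.map_map hc hm2] at h2
  refine h2.trans (Eq.trans (b := (P.map R).map fun p => buildPath k a p.1 p.2) ?_ ?_)
  · rw [Measure.map_map hb hR]
    rfl
  · rw [hG.map_root_marks hxq]
    ext A hA
    rw [Measure.map_apply hb hA, Measure.prod_apply (hb hA), Measure.bind_apply hA
      (Kernel.aemeasurable _)]
    refine lintegral_congr fun y => ?_
    have hby : Measurable (buildPath k a y) := hb.comp measurable_prodMk_left
    have h3 := treeLaw_stepKernel k a (incrLaw P κ q) y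
    rw [treeKernel_apply, show treeLaw k (fieldKernel P κ q) y = _ from h3,
      Measure.map_apply hby hA]
    rfl

end IsGREMWithField
end GREM

namespace GREM

/-! ### The functions `ψ_{q_l}` -/

section Psi

/-- A Lipschitz function grows at most linearly, so the integrand is dominated by a multiple of
`e^{tz} + e^{-tz}`. -/
lemma integrable_exp_lipschitz {f : ℝ → ℝ} {C : ℝ≥0} (hf : LipschitzWith C f) {m : ℝ} (hm : 0 < m)
    (y v : ℝ) : Integrable (fun z => Real.exp (m * f (y + z * v))) (gaussianReal 0 1) := by
  have hc := hf.continuous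
  set t : ℝ := m * (C * |v|) with ht
  have h1 : Integrable (fun z => Real.exp (m * f y) * (Real.exp (t * z) + Real.exp (-t * z)))
      (gaussianReal 0 1) :=
    ((integrable_exp_mul_gaussianReal t).add (integrable_exp_mul_gaussianReal (-t))).const_mul _
  refine h1.mono' (by fun_prop) (ae_of_all _ fun z => ?_)
  rw [Real.norm_eq_abs, abs_of_pos (Real.exp_pos _)]
  have h2 : f (y + z * v) ≤ f y + C * |v| * |z| := by
    have h3 := hf.dist_le_mul (y + z * v) y
    rw [Real.dist_eq, Real.dist_eq, add_sub_cancel_left, abs_mul] at h3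
    have := le_abs_self (f (y + z * v) - f y)
    linarith
  have h4 : Real.exp (t * |z|) ≤ Real.exp (t * z) + Real.exp (-t * z) := by
    rcases abs_cases z with ⟨h, -⟩ | ⟨h, -⟩
    · rw [h]; linarith [Real.exp_pos (-t * z)]
    · rw [h, mul_neg, ← neg_mul]; linarith [Real.exp_pos (t * z)]
  calc Real.exp (m * f (y + z * v)) ≤ Real.exp (m * (f y + C * |v| * |z|)) := by gcongr
    _ = Real.exp (m * f y) * Real.exp (t * |z|) := by rw [← Real.exp_add, ht]; ring_nf
    _ ≤ _ := by gcongr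

/-- The transform taking `ψ_{q_{l+1}}` to `ψ_{q_l}`. -/
noncomputable def logExp (m v : ℝ) (f : ℝ → ℝ) (y : ℝ) : ℝ :=
  (1 / m) * Real.log (∫ z, Real.exp (m * f (y + z * v)) ∂gaussianReal 0 1)

lemma integral_exp_lipschitz_pos {f : ℝ → ℝ} {C : ℝ≥0} (hf : LipschitzWith C f) {m : ℝ} (hm : 0 < m)
    (y v : ℝ) : 0 < ∫ z, Real.exp (m * f (y + z * v)) ∂gaussianReal 0 1 :=
  integral_exp_pos (integrable_exp_lipschitz hf hm y v)

lemma exp_logExp {f : ℝ → ℝ} {C : ℝ≥0} (hf : LipschitzWith C f) {m : ℝ} (hm : 0 < m) (y v : ℝ) :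
    Real.exp (m * logExp m v f y) = ∫ z, Real.exp (m * f (y + z * v)) ∂gaussianReal 0 1 := by
  rw [logExp, ← mul_assoc, mul_one_div_cancel hm.ne', one_mul,
    Real.exp_log (integral_exp_lipschitz_pos hf hm y v)]

/-- A translation from `y'` to `y` changes the integrand by at most the factor `e^{m C |y - y'|}`,
so the Lipschitz constant survives the transform and the whole recursion. -/
lemma lipschitzWith_logExp {f : ℝ → ℝ} {C : ℝ≥0} (hf : LipschitzWith C f) {m : ℝ} (hm : 0 < m)
    (v : ℝ) : LipschitzWith C (logExp m v f) := by
  refine LipschitzWith.of_le_add_mul C fun y y' => ?_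
  have h1 : Real.exp (m * logExp m v f y) ≤
      Real.exp (m * (logExp m v f y' + C * dist y y')) := by
    rw [mul_add, Real.exp_add, exp_logExp hf hm, exp_logExp hf hm, ← integral_mul_const]
    refine integral_mono (integrable_exp_lipschitz hf hm y v)
      ((integrable_exp_lipschitz hf hm y' v).mul_const _) fun z => ?_
    simp only [← Real.exp_add, ← mul_add]
    have h2 := hf.le_add_mul (y + z * v) (y' + z * v)
    rw [dist_add_right] at h2
    gcongr
  exact le_of_mul_le_mul_left (Real.exp_le_exp.1 h1) hm

variable {k : ℕ} {x : ℕ → ℝ} {q : ℕ → unitInterval} {g ψ : ℝ → ℝ}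

lemma IsShiftFun.exists_lipschitzWith (hψ : IsShiftFun ψ) : ∃ C, LipschitzWith C ψ := by
  obtain ⟨C, hC⟩ := hψ.deriv_bdd
  refine ⟨C.toNNReal, lipschitzWith_of_nnnorm_deriv_le (hψ.contDiff.differentiable (by norm_num))
    fun y => ?_⟩
  rw [← NNReal.coe_le_coe, coe_nnnorm, Real.norm_eq_abs]
  exact (hC y).trans (Real.le_coe_toNNReal C)

lemma psiDown_succ {j : ℕ} (hj : j < k) :
    psiDown k x q g ψ (j + 1) = logExp (x (k - j))
      (Real.sqrt (g (q (k - j + 1)) - g (q (k - j)))) (psiDown k x q g ψ j) := by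
  funext y
  rw [psiDown, logExp]
  simp only [if_neg (by omega : ¬ k - j = 0)]

lemma exists_lipschitzWith_psiDown (hxq : IsAtomic k x q) (hψ : IsShiftFun ψ) {j : ℕ}
    (hj : j ≤ k) : ∃ C, LipschitzWith C (psiDown k x q g ψ j) := by
  induction j with
  | zero => exact hψ.exists_lipschitzWith
  | succ j ih =>
    obtain ⟨C, hC⟩ := ih (by omega)
    rw [psiDown_succ (by omega)]
    refine ⟨C, lipschitzWith_logExp hC ?_ _⟩
    rw [← hxq.x_zero]
    exact hxq.x_strictMono (by omega) (by omega)

lemma exists_lipschitzWith_psiLevel (hxq : IsAtomic k x q) (hψ : IsShiftFun ψ) (l : ℕ) :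
    ∃ C, LipschitzWith C (psiLevel k x q g ψ (l + 1)) :=
  exists_lipschitzWith_psiDown hxq hψ (by omega)

lemma continuous_psiLevel (hxq : IsAtomic k x q) (hψ : IsShiftFun ψ) (l : ℕ) :
    Continuous (psiLevel k x q g ψ (l + 1)) := by
  obtain ⟨C, hC⟩ := exists_lipschitzWith_psiLevel (g := g) hxq hψ l
  exact hC.continuous

lemma psiLevel_last {l : ℕ} (hl : k + 1 ≤ l) : psiLevel k x q g ψ l = ψ := by
  rw [psiLevel, Nat.sub_eq_zero_of_le hl]; rfl

/-- The recursion in the form that normalizes the tilt. Beyond the last level both values of `lvl`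
are `1`, the Gaussian increment vanishes and both functions are `ψ`, so the identity holds for every
`l`. -/
lemma exp_psiLevel (hxq : IsAtomic k x q) (hψ : IsShiftFun ψ) (l : ℕ) (y : ℝ) :
    Real.exp (par k x l * psiLevel k x q g ψ (l + 1) y) =
      ∫ z, Real.exp (par k x l * psiLevel k x q g ψ (l + 2)
        (y + z * Real.sqrt (g (lvl k q (l + 2)) - g (lvl k q (l + 1))))) ∂gaussianReal 0 1 := by
  rcases lt_or_ge l k with hl | hl
  · obtain ⟨C, hC⟩ := exists_lipschitzWith_psiLevel (g := g) hxq hψ (l + 1)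
    rw [← exp_logExp hC (hxq.par_pos l)]
    congr 2
    have h1 := congrFun (psiDown_succ (x := x) (q := q) (g := g) (ψ := ψ) (by omega : k - 1 - l < k)) y
    rw [show k - (k - 1 - l) = l + 1 by omega] at h1
    rw [psiLevel, psiLevel, show k + 1 - (l + 1) = k - 1 - l + 1 by omega, h1, par,
      min_eq_left (by omega), lvl_of_le (by omega), lvl_of_le (by omega),
      show k + 1 - (l + 1 + 1) = k - 1 - l by omega]
  · rw [psiLevel_last (by omega), psiLevel_last (by omega), hxq.lvl_last (by omega),
      hxq.lvl_last (by omega)]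
    simp

end Psi

/-! ### The tilting weights of the field -/

section Weights

variable {Ω : Type*} [MeasurableSpace Ω] {P : Measure Ω} [IsProbabilityMeasure P] {k : ℕ}
  {x : ℕ → ℝ} {q : ℕ → unitInterval} {g ψ : ℝ → ℝ} {ζ : Vertex k → ℕ → Ω → ℝ}
  {κ : (Fin k → ℕ) → unitInterval → Ω → ℝ}

/-- The factor of the shift at depth `l`. -/
noncomputable def shiftWt (k : ℕ) (x : ℕ → ℝ) (q : ℕ → unitInterval) (g ψ : ℝ → ℝ) (l : ℕ)
    (p : unitInterval → ℝ) : ℝ :=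
  Real.exp (psiLevel k x q g ψ (l + 2) (p (lvl k q (l + 2))) -
    psiLevel k x q g ψ (l + 1) (p (lvl k q (l + 1))))

lemma measurable_shiftWt (hxq : IsAtomic k x q) (hψ : IsShiftFun ψ) (l : ℕ) :
    Measurable (shiftWt k x q g ψ l) := by
  have h1 := (continuous_psiLevel (g := g) hxq hψ (l + 1)).measurable
  have h2 := (continuous_psiLevel (g := g) hxq hψ l).measurable
  unfold shiftWt
  exact ((h1.comp (measurable_pi_apply _)).sub (h2.comp (measurable_pi_apply _))).exp

namespace IsGREMWithField

lemma ae_incrLaw (hG : IsGREMWithField P k x q g ζ κ) (l : ℕ) {r : unitInterval}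
    (hr : r ≤ lvl k q (l + 1)) (h : lvl k q (l + 1) ≤ lvl k q (l + 2)) :
    ∀ᵐ u ∂incrLaw P κ q l, u r = 0 := by
  rw [incrLaw, ae_map_iff (hG.measurable_incr _ _ _).aemeasurable
    (measurableSet_eq_fun (measurable_pi_apply r) measurable_const)]
  refine ae_of_all _ fun ω => ?_
  rw [incr, inf_eq_left.2 hr, inf_eq_left.2 (hr.trans h), sub_self]

lemma ae_fieldKernel (hxq : IsAtomic k x q) (hG : IsGREMWithField P k x q g ζ κ) (l : ℕ)
    {r : unitInterval} (hr : r ≤ lvl k q (l + 1)) (y : unitInterval → ℝ) :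
    ∀ᵐ p ∂fieldKernel P κ q l y, p r = y r := by
  have := hG.isProbabilityMeasure_incrLaw l
  have hab := hxq.monotone_lvl (by omega : l + 1 ≤ l + 2)
  have hs : Measurable (step (lvl k q (l + 1)) (lvl k q (l + 2)) y) :=
    (measurable_step _ _).comp measurable_prodMk_left
  rw [fieldKernel, stepKernel_apply, ae_map_iff hs.aemeasurable
    (measurableSet_eq_fun (measurable_pi_apply r) measurable_const)]
  filter_upwards [hG.ae_incrLaw l hr hab] with u hu
  rw [step, inf_eq_left.2 hr, inf_eq_left.2 (hr.trans hab), hu, add_zero]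

lemma map_eval_incrLaw (hxq : IsAtomic k x q) (hg : IsCovFun g)
    (hG : IsGREMWithField P k x q g ζ κ) (l : ℕ) :
    (incrLaw P κ q l).map (fun u => u (lvl k q (l + 2))) = (gaussianReal 0 1).map
      fun z => z * Real.sqrt (g (lvl k q (l + 2)) - g (lvl k q (l + 1))) := by
  set a := lvl k q (l + 1) with ha
  set b := lvl k q (l + 2) with hb
  have hab : a ≤ b := hxq.monotone_lvl (by omega)
  have hgab : g a ≤ g b := hg.strictMonoOn.monotoneOn a.2 b.2 hab
  have h1 := (isGaussianProcess_sub hG.gaussian (fun _ : Unit => ((fun _ => 0 : Fin k → ℕ), b))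
    fun _ => ((fun _ => 0 : Fin k → ℕ), a)).hasGaussianLaw_eval ()
  have hm : Measurable fun ω => κ (fun _ => 0) b ω - κ (fun _ => 0) a ω :=
    (hG.measurable_field _ _).sub (hG.measurable_field _ _)
  have hv := hG.cov_sub_sub (fun _ => 0) (fun _ => 0) (fun _ => 0) (fun _ => 0) b a b a
  rw [covariance_self hm.aemeasurable, hxq.overlap_self_eq] at hv
  simp only [inf_idem, inf_eq_left.2 hab, inf_eq_right.2 hab,
    inf_eq_left.2 (unitInterval.le_one' (t := a)), inf_eq_left.2 (unitInterval.le_one' (t := b))] at hv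
  rw [incrLaw, Measure.map_map (measurable_pi_apply _) (hG.measurable_incr _ _ _)]
  have h2 : (fun u : unitInterval → ℝ => u b) ∘ incr κ (fun _ => 0) a b =
      fun ω => κ (fun _ => 0) b ω - κ (fun _ => 0) a ω := by
    funext ω
    simp only [Function.comp_apply, incr, inf_idem, inf_eq_right.2 hab]
  rw [h2]
  refine h1.map_eq_gaussianReal.trans ?_
  rw [hG.integral_sub_eq_zero, hv, gaussianReal_map_mul_const, mul_zero]
  congr 1
  apply NNReal.eq
  rw [Real.coe_toNNReal _ (by linarith)]
  simp only [mul_one, NNReal.coe_mk]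
  rw [Real.sq_sqrt (by linarith)]
  ring

/-- The weights of the shift tilt the field. -/
theorem tiltData (hxq : IsAtomic k x q) (hg : IsCovFun g) (hψ : IsShiftFun ψ)
    (hG : IsGREMWithField P k x q g ζ κ) :
    TiltData (par k x) (fieldKernel P κ q) (shiftWt k x q g ψ) where
  measurable := measurable_shiftWt hxq hψ
  pos l p := Real.exp_pos _
  preserved l m hlm y := by
    have hm := hxq.monotone_lvl
    filter_upwards [hG.ae_fieldKernel hxq m (hm (by omega : l + 2 ≤ m + 1)) y,
      hG.ae_fieldKernel hxq m (hm (by omega : l + 1 ≤ m + 1)) y] with p h1 h2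
    rw [shiftWt, h1, h2]
    rfl
  lintegral l y := by
    have := hG.isProbabilityMeasure_incrLaw l
    set a := lvl k q (l + 1) with ha
    set b := lvl k q (l + 2) with hb
    have hab : a ≤ b := hxq.monotone_lvl (by omega)
    have hs : Measurable (step a b y) := (measurable_step _ _).comp measurable_prodMk_left
    have hw : Measurable fun p => ENNReal.ofReal (shiftWt k x q g ψ l p ^ par k x l) :=
      ((measurable_shiftWt hxq hψ l).pow_const _).ennreal_ofReal
    have hc := (continuous_psiLevel (g := g) hxq hψ (l + 1)).measurable
    set σ := Real.sqrt (g b - g a) with hσ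
    set F : ℝ → ℝ≥0∞ := fun t => ENNReal.ofReal (Real.exp (par k x l *
      psiLevel k x q g ψ (l + 2) (y a + t)) * Real.exp (-(par k x l *
        psiLevel k x q g ψ (l + 1) (y a)))) with hF
    have hFm : Measurable F := by
      refine Measurable.ennreal_ofReal (Measurable.mul_const (Measurable.exp ?_) _)
      exact (hc.comp (measurable_const_add _)).const_mul _
    rw [fieldKernel, stepKernel_apply, lintegral_map hw hs]
    -- The increment vanishes up to `a`, so the new path has the value `y a` at `a` and `y a + u b`
    -- at `b`.
    have h1 : ∫⁻ u, ENNReal.ofReal (shiftWt k x q g ψ l (step a b y u) ^ par k x l)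
        ∂incrLaw P κ q l = ∫⁻ u, F (u b) ∂incrLaw P κ q l := by
      refine lintegral_congr_ae ?_
      filter_upwards [hG.ae_incrLaw l le_rfl hab] with u hu
      rw [hF]
      simp only
      rw [shiftWt, ← ha, ← hb, step, step, inf_idem, inf_idem, inf_eq_left.2 hab, inf_eq_right.2 hab,
        hu, add_zero, ← Real.exp_mul, ← Real.exp_add]
      congr 2
      ring
    rw [h1, ← lintegral_map (f := F) (g := fun u : unitInterval → ℝ => u b) hFm
      (measurable_pi_apply b), hG.map_eval_incrLaw hxq hg l,
      lintegral_map hFm (by fun_prop)]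
    obtain ⟨C, hC⟩ := exists_lipschitzWith_psiLevel (g := g) hxq hψ (l + 1)
    simp only [hF]
    rw [← ofReal_integral_eq_lintegral_ofReal
      ((integrable_exp_lipschitz hC (hxq.par_pos l) _ _).mul_const _)
      (ae_of_all _ fun z => by positivity), integral_mul_const, ← exp_psiLevel hxq hψ l (y a),
      ← Real.exp_add, add_neg_cancel, Real.exp_zero, ENNReal.ofReal_one]

end IsGREMWithField

end Weights
end GREM

namespace GREM

/-! ### A field at the points of an independent cascade -/

section OrderedField

variable {E : Type*} [MeasurableSpace E] {k : ℕ} (q : ℕ → unitInterval)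

open Classical in
/-- Leaves with the overlaps `m`, if there are any. -/
noncomputable def realize (n : ℕ) (m : Fin n → Fin n → unitInterval) : Fin n → Fin k → ℕ :=
  if h : ∃ a : Fin n → Fin k → ℕ, (fun i j => overlap q (a i) (a j)) = m then h.choose
  else fun _ _ => 0

lemma overlap_realize {n : ℕ} (a : Fin n → Fin k → ℕ) {m : Fin n → Fin n → unitInterval}
    (hm : ∀ i j, m i j = overlap q (a i) (a j)) (i j : Fin n) :
    overlap q (realize (k := k) q n m i) (realize q n m j) = overlap q (a i) (a j) := by
  have h : ∃ b : Fin n → Fin k → ℕ, (fun i j => overlap q (b i) (b j)) = m :=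
    ⟨a, funext fun i => funext fun j => (hm i j).symm⟩
  have h1 := congrFun (congrFun h.choose_spec i) j
  rw [← hm, realize, dif_pos h]
  exact h1

/-- Only countably many matrices are overlap matrices of `n` leaves; elsewhere the function is
constant. -/
lemma measurable_realize (n : ℕ) : Measurable (realize (k := k) q n) := by
  have h : Measurable fun _ : Fin n → Fin n → unitInterval => (fun _ _ => 0 : Fin n → Fin k → ℕ) :=
    measurable_const
  refine h.measurable_of_countable_ne ((countable_range
    fun (a : Fin n → Fin k → ℕ) i j => overlap q (a i) (a j)).mono fun m hm => ?_)
  by_contra hc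
  refine hm ?_
  rw [realize, dif_neg]
  rintro ⟨a, ha⟩
  exact hc ⟨a, ha⟩

/-- The law of the field `F` at `n` leaves with given overlaps. -/
noncomputable def overlapKernel (n : ℕ) (F : Measure ((Fin k → ℕ) → E)) :
    Kernel (ℕ → ℕ → unitInterval) (Fin n → E) :=
  (Kernel.ofFunOfCountable fun a : Fin n → Fin k → ℕ => F.map fun f i => f (a i)).comap
    (fun M : ℕ → ℕ → unitInterval => realize q n fun i j => M i j)
    ((measurable_realize q n).comp (by fun_prop))

lemma overlapKernel_apply (n : ℕ) (F : Measure ((Fin k → ℕ) → E)) (M : ℕ → ℕ → unitInterval) :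
    overlapKernel q n F M = F.map fun f i => f (realize q n (fun i j => M i j) i) := rfl

instance (n : ℕ) (F : Measure ((Fin k → ℕ) → E)) [IsProbabilityMeasure F] :
    IsMarkovKernel (overlapKernel q n F) := ⟨fun M => by
  rw [overlapKernel_apply]
  exact Measure.isProbabilityMeasure_map
    (measurable_pi_lambda _ fun i => measurable_pi_apply _).aemeasurable⟩

/-- The law of the field at finitely many leaves depends only on the overlaps of the leaves. -/
def OverlapInvariant (F : Measure ((Fin k → ℕ) → E)) : Prop :=
  ∀ (n : ℕ) (a b : Fin n → Fin k → ℕ), (∀ i j, overlap q (a i) (a j) = overlap q (b i) (b j)) →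
    F.map (fun f i => f (a i)) = F.map fun f i => f (b i)

variable {q}

lemma OverlapInvariant.overlapKernel_eq {F : Measure ((Fin k → ℕ) → E)} (h : OverlapInvariant q F)
    {n : ℕ} {M : ℕ → ℕ → unitInterval} (a : Fin n → Fin k → ℕ)
    (hM : ∀ i j : Fin n, M i j = overlap q (a i) (a j)) :
    overlapKernel q n F M = F.map fun f i => f (a i) :=
  h n _ _ fun i j => overlap_realize q a hM i j

lemma measurable_apply_leaf {X : Type*} [MeasurableSpace X] {e : X → Fin k → ℕ}
    (he : Measurable e) : Measurable fun p : X × ((Fin k → ℕ) → E) => p.2 (e p.1) :=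
  measurable_comp_countable (z := fun α (p : X × ((Fin k → ℕ) → E)) => p.2 α)
    (fun α => (measurable_pi_apply α).comp measurable_snd)
    fun α => (he.comp measurable_fst) (measurableSet_singleton α)

/-- For a fixed cascade `z` the chosen leaves are fixed and the independent field still has law `F`.
By hypothesis the resulting law depends on `z` through `G z` only, so it is the conditional law
given `G`. -/
lemma map_prod_leaf {X Y : Type*} [MeasurableSpace X] [MeasurableSpace Y] (R : Measure X)
    [IsProbabilityMeasure R] (F : Measure ((Fin k → ℕ) → E)) [IsProbabilityMeasure F] {n : ℕ}
    {a : X → Fin n → Fin k → ℕ} (ha : ∀ i, Measurable fun z => a z i) {G : X → Y}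
    (hG : Measurable G) (μ : Kernel Y (Fin n → E)) [IsMarkovKernel μ]
    (h : ∀ z, μ (G z) = F.map fun f i => f (a z i)) :
    (R.prod F).map (fun p => (G p.1, fun i => p.2 (a p.1 i))) = R.map G ⊗ₘ μ := by
  have hm : Measurable fun p : X × ((Fin k → ℕ) → E) => (G p.1, fun i => p.2 (a p.1 i)) :=
    (hG.comp measurable_fst).prodMk (measurable_pi_lambda _ fun i => measurable_apply_leaf (ha i))
  have := Measure.isProbabilityMeasure_map (μ := R) hG.aemeasurable
  ext s hs
  rw [Measure.map_apply hm hs, Measure.prod_apply (hm hs), Measure.compProd_apply hs,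
    lintegral_map (Kernel.measurable_kernel_prodMk_left hs) hG]
  refine lintegral_congr fun z => ?_
  rw [h z, Measure.map_apply (by fun_prop) (measurable_prodMk_left hs)]
  rfl

/-- After integration over the field, the joint probability is the expectation of a function of `G`
times a function of `N`, and it factorizes. -/
lemma indepFun_leaf {X Y W : Type*} [MeasurableSpace X] [MeasurableSpace Y] [MeasurableSpace W]
    (R : Measure X) [IsProbabilityMeasure R] (F : Measure ((Fin k → ℕ) → E))
    [IsProbabilityMeasure F] {n : ℕ} {a : X → Fin n → Fin k → ℕ}
    (ha : ∀ i, Measurable fun z => a z i) {G : X → Y} (hG : Measurable G) {N : X → W}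
    (hN : Measurable N) (hi : IndepFun G N R) (μ : Kernel Y (Fin n → E)) [IsMarkovKernel μ]
    (h : ∀ z, μ (G z) = F.map fun f i => f (a z i)) :
    IndepFun (fun p : X × ((Fin k → ℕ) → E) => (G p.1, fun i => p.2 (a p.1 i))) (fun p => N p.1)
      (R.prod F) := by
  have hm : Measurable fun p : X × ((Fin k → ℕ) → E) => (G p.1, fun i => p.2 (a p.1 i)) :=
    (hG.comp measurable_fst).prodMk (measurable_pi_lambda _ fun i => measurable_apply_leaf (ha i))
  have hN' : Measurable fun p : X × ((Fin k → ℕ) → E) => N p.1 := hN.comp measurable_fst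
  have hstep : ∀ s t, MeasurableSet s → MeasurableSet t →
      (R.prod F) ((fun p => (G p.1, fun i => p.2 (a p.1 i))) ⁻¹' s ∩ (fun p => N p.1) ⁻¹' t) =
        (∫⁻ z, μ (G z) (Prod.mk (G z) ⁻¹' s) ∂(R)) * R (N ⁻¹' t) := by
    intro s t hs ht
    have hs' : Measurable fun y => μ y (Prod.mk y ⁻¹' s) := Kernel.measurable_kernel_prodMk_left hs
    have ht' : Measurable (t.indicator (1 : W → ℝ≥0∞)) := measurable_one.indicator ht
    have h1 := lintegral_mul_eq_lintegral_mul_lintegral_of_indepFun (hs'.comp hG) (ht'.comp hN)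
      (hi.comp hs' ht')
    have h2 : ∫⁻ z, (t.indicator (1 : W → ℝ≥0∞) ∘ N) z ∂(R) = R (N ⁻¹' t) := by
      rw [← lintegral_indicator_one (hN ht)]; rfl
    rw [h2] at h1
    refine Eq.trans ?_ h1
    rw [Measure.prod_apply ((hm hs).inter (hN' ht))]
    refine lintegral_congr fun z => ?_
    simp only [Pi.mul_apply, Function.comp_apply]
    rw [h z, Measure.map_apply (by fun_prop) (measurable_prodMk_left hs)]
    by_cases hz : N z ∈ t
    · rw [indicator_of_mem hz, Pi.one_apply, mul_one]
      congr 1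
      ext f
      simp [hz]
    · rw [indicator_of_notMem hz, mul_zero]
      convert measure_empty (μ := F)
      ext f
      simp [hz]
  rw [indepFun_iff_measure_inter_preimage_eq_mul]
  intro s t hs ht
  have h1 := hstep univ t .univ ht
  have h2 := hstep s univ hs .univ
  simp only [preimage_univ, univ_inter, inter_univ, measure_univ, lintegral_const, mul_one,
    one_mul] at h1 h2
  rw [hstep s t hs ht, h1, h2]

end OrderedField

/-! ### The field at the ordered points of a cascade -/

section Cascade

variable {E : Type*} [MeasurableSpace E] {d : ℕ} {q : ℕ → unitInterval}
  {R : Measure (Vertex (d + 1) → ℕ → ℝ)} [IsProbabilityMeasure R]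
  {F : Measure ((Fin (d + 1) → ℕ) → E)} [IsProbabilityMeasure F]

/-- The `i`-th leaf in the decreasing order of the weights. -/
noncomputable def sortedLeaf (Z : Vertex (d + 1) → ℕ → ℝ) (i : ℕ) : Fin (d + 1) → ℕ :=
  decEnum (treeWt Z) i

/-- The overlaps of the leaves in the decreasing order of the weights. -/
noncomputable def treeOverlap (q : ℕ → unitInterval) (Z : Vertex (d + 1) → ℕ → ℝ) :
    ℕ → ℕ → unitInterval := orderedOverlap q (treeWt Z)

lemma measurable_sortedLeaf (i : ℕ) :
    Measurable fun Z : Vertex (d + 1) → ℕ → ℝ => sortedLeaf Z i :=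
  (measurable_decEnum i).comp measurable_treeWt

lemma measurable_treeOverlap (q : ℕ → unitInterval) : Measurable (treeOverlap (d := d) q) :=
  (measurable_orderedOverlap q).comp measurable_treeWt

lemma measurable_field_sortedLeaf (i : ℕ) :
    Measurable fun p : TreeSpace (d + 1) E => p.2 (sortedLeaf p.1 i) :=
  measurable_apply_leaf (measurable_sortedLeaf i)

theorem map_overlap_field (h : OverlapInvariant q F) (n : ℕ) :
    (R.prod F).map (fun p => (treeOverlap q p.1, fun i : Fin n => p.2 (sortedLeaf p.1 i))) =
      R.map (treeOverlap q) ⊗ₘ overlapKernel q n F :=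
  map_prod_leaf R F (a := fun Z (i : Fin n) => sortedLeaf Z i) (fun i => measurable_sortedLeaf i)
    (measurable_treeOverlap q) _ fun Z => h.overlapKernel_eq (fun i => sortedLeaf Z i) fun _ _ => rfl

theorem map_overlap_weights_field (h : OverlapInvariant q F) (n : ℕ) :
    (R.prod F).map (fun p => ((treeOverlap q p.1, fun i : ℕ => treeWt p.1 (sortedLeaf p.1 i)),
      fun i : Fin n => p.2 (sortedLeaf p.1 i))) =
      R.map (fun Z => (treeOverlap q Z, fun i : ℕ => treeWt Z (sortedLeaf Z i))) ⊗ₘ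
        (overlapKernel q n F).prodMkRight (ℕ → ℝ) := by
  have hw : Measurable fun (Z : Vertex (d + 1) → ℕ → ℝ) (i : ℕ) => treeWt Z (sortedLeaf Z i) :=
    measurable_pi_lambda _ fun i => (measurable_apply_decEnum i).comp measurable_treeWt
  exact map_prod_leaf R F (a := fun Z (i : Fin n) => sortedLeaf Z i)
    (fun i => measurable_sortedLeaf i) ((measurable_treeOverlap q).prodMk hw) _
    fun Z => h.overlapKernel_eq (fun i => sortedLeaf Z i) fun _ _ => rfl

/-- Reduces infinitely many points to the first `n`. The overlap matrix is attached to every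
coordinate so that it remains present for each finite set of indices; at the end it is recovered
from coordinate `0`. -/
theorem indepFun_field_normWt (h : OverlapInvariant q F)
    (hi : IndepFun (treeOverlap q) (fun Z => normWt (treeWt Z)) R) :
    IndepFun (fun p : TreeSpace (d + 1) E =>
      ((fun i : ℕ => p.2 (sortedLeaf p.1 i), treeOverlap q p.1) :
        (ℕ → E) × (ℕ → ℕ → unitInterval))) (fun p => normWt (treeWt p.1)) (R.prod F) := by
  have hQ := measurable_treeOverlap (d := d) q
  have hN : Measurable fun Z : Vertex (d + 1) → ℕ → ℝ => normWt (treeWt Z) :=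
    measurable_normWt.comp measurable_treeWt
  have h1 : IndepFun (fun (p : TreeSpace (d + 1) E) (i : ℕ) =>
      ((p.2 (sortedLeaf p.1 i), treeOverlap q p.1) : E × (ℕ → ℕ → unitInterval)))
      (fun p => normWt (treeWt p.1)) (R.prod F) := by
    refine IndepFun.process_indepFun (X := fun (i : ℕ) (p : TreeSpace (d + 1) E) =>
      ((p.2 (sortedLeaf p.1 i), treeOverlap q p.1) : E × (ℕ → ℕ → unitInterval)))
      (fun i => (measurable_field_sortedLeaf i).prodMk (hQ.comp measurable_fst))
      (hN.comp measurable_fst) fun I => ?_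
    obtain ⟨n, hn⟩ : ∃ n, ∀ i ∈ I, i < n :=
      ⟨I.sup id + 1, fun i hi => Nat.lt_succ_of_le (Finset.le_sup (f := id) hi)⟩
    have h2 := indepFun_leaf R F (a := fun Z (i : Fin n) => sortedLeaf Z i)
      (fun i => measurable_sortedLeaf i) hQ hN hi (overlapKernel q n F)
      fun Z => h.overlapKernel_eq (fun i => sortedLeaf Z i) fun _ _ => rfl
    have hc : Measurable fun (m : (ℕ → ℕ → unitInterval) × (Fin n → E)) (i : I) =>
        (m.2 ⟨i, hn i i.2⟩, m.1) := by fun_prop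
    exact h2.comp hc measurable_id
  have hc : Measurable fun m : ℕ → E × (ℕ → ℕ → unitInterval) =>
      ((fun i => (m i).1, (m 0).2) : (ℕ → E) × (ℕ → ℕ → unitInterval)) := by fun_prop
  exact h1.comp hc measurable_id

end Cascade
end GREM

namespace GREM

/-! ### The density of the shifted field -/

section Density

/-- Each class has exactly one least element, and `f` is constant on classes, so the arbitrary
representatives can be replaced by the least ones. -/
lemma finprod_quot_out {n : ℕ} {r : Fin n → Fin n → Prop} (hr : Equivalence r) {f : Fin n → ℝ}
    (hf : ∀ i j, r i j → f i = f j) [DecidablePred fun i => ∀ i' < i, ¬ r i' i] :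
    ∏ᶠ c : Quot r, f (Quot.out c) = ∏ i, if ∀ i' < i, ¬ r i' i then f i else 1 := by
  classical
  have : Fintype (Quot r) := Fintype.ofFinite _
  have hmk : ∀ i j, Quot.mk r i = Quot.mk r j → r i j := fun i j h =>
    (hr.eqvGen_iff).1 (Quot.eqvGen_exact h)
  rw [finprod_eq_prod_of_fintype, ← Finset.prod_filter]
  symm
  refine Finset.prod_bij (fun i _ => Quot.mk r i) (fun _ _ => Finset.mem_univ _) ?_ ?_ ?_
  · intro i hi j hj hij
    simp only [Finset.mem_filter, Finset.mem_univ, true_and] at hi hj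
    have h1 := hmk i j hij
    rcases lt_trichotomy i j with h | h | h
    · exact absurd h1 (hj i h)
    · exact h
    · exact absurd (hr.symm h1) (hi j h)
  · intro c _
    have hne : (Finset.univ.filter fun i => Quot.mk r i = c).Nonempty :=
      ⟨c.out, by simp⟩
    have hmem := Finset.min'_mem _ hne
    simp only [Finset.mem_filter, Finset.mem_univ, true_and] at hmem
    refine ⟨_, ?_, hmem⟩
    simp only [Finset.mem_filter, Finset.mem_univ, true_and]
    intro i' hi' hrel
    refine absurd (Finset.min'_le _ i' ?_) (not_le.2 hi')
    simp only [Finset.mem_filter, Finset.mem_univ, true_and]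
    rw [← hmem]
    exact Quot.sound hrel
  · intro i _
    exact hf _ _ (hmk _ _ (Quot.out_eq _).symm)

variable {k : ℕ} {x : ℕ → ℝ} {q : ℕ → unitInterval} {g ψ : ℝ → ℝ}

lemma IsAtomic.le_overlap_iff (h : IsAtomic k x q) {l : ℕ} (hl : l ≤ k) (α β : Fin k → ℕ) :
    q (l + 1) ≤ overlap q α β ↔ Agree l α β := by
  simpa [levelRel] using levelRel_overlap_iff h (fun n => if n = 0 then α else β) hl 0 1

lemma IsAtomic.agree_iff (h : IsAtomic k x q) {l : ℕ} (hl : l ≤ k) {α β α' β' : Fin k → ℕ}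
    (ho : overlap q α β = overlap q α' β') : Agree l α β ↔ Agree l α' β' := by
  rw [← h.le_overlap_iff hl, ho, h.le_overlap_iff hl]

lemma IsAtomic.q_le (h : IsAtomic k x q) {l : ℕ} (hl : l ≤ k) : q l ≤ q (l + 1) := by
  have := h.monotone_lvl (Nat.le_succ l)
  rwa [lvl_of_le (by omega), lvl_of_le (by omega)] at this

lemma factorV_zero (h : IsAtomic k x q) (p : unitInterval → ℝ) : factorV k x q g ψ 0 p = 1 := by
  rw [factorV, h.x_zero, zero_mul, zero_mul, div_self (Real.exp_ne_zero _)]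

lemma factorV_succ {l : ℕ} (hl : l < k) (p : unitInterval → ℝ) :
    factorV k x q g ψ (l + 1) p = shiftWt k x q g ψ l p ^ par k x l := by
  rw [factorV, shiftWt, ← Real.exp_sub, ← Real.exp_mul, lvl_of_le (by omega), lvl_of_le (by omega),
    par, min_eq_left (by omega)]
  ring_nf

lemma factorV_congr {l : ℕ} {p p' : unitInterval → ℝ} (h1 : p (q (l + 1)) = p' (q (l + 1)))
    (h2 : p (q l) = p' (q l)) : factorV k x q g ψ l p = factorV k x q g ψ l p' := by
  rw [factorV, factorV, h1, h2]

lemma equivalence_agree (l : ℕ) : Equivalence (Agree (k := k) l) :=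
  ⟨fun _ _ _ => rfl, fun h i hi => (h i hi).symm, fun h h' i hi => (h i hi).trans (h' i hi)⟩

/-- Matches the product over classes with the density produced by the tilt. Level `0` contributes
`1` because `x 0 = 0`, and level `l + 1` corresponds to the weight at depth `l`. Independence from
the representatives needs the paths of equivalent points to agree at both ends of the level, which
is `hp`. -/
theorem ofReal_density (hxq : IsAtomic k x q) {n : ℕ} {M : ℕ → ℕ → unitInterval}
    {a : Fin n → Fin k → ℕ} (hM : ∀ i j : Fin n, M i j = overlap q (a i) (a j))
    {p : Fin n → unitInterval → ℝ} (hp : ∀ l ≤ k, ∀ i j, Agree l (a i) (a j) →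
      p i (q (l + 1)) = p j (q (l + 1)) ∧ p i (q l) = p j (q l)) :
    ENNReal.ofReal (density k x q g ψ n M p) = leafDensity (par k x) (shiftWt k x q g ψ) a p := by
  classical
  have h1 : ∀ l ≤ k, ∏ᶠ c : Quot (fun i j : Fin n => levelRel q M l i j),
      factorV k x q g ψ l (p (Quot.out c)) =
        ∏ i, if IsFirst Finset.univ a l i then factorV k x q g ψ l (p i) else 1 := by
    intro l hl
    have hrel : (fun i j : Fin n => levelRel q M l i j) = fun i j => Agree l (a i) (a j) := by
      funext i j
      rw [levelRel, hM, hxq.le_overlap_iff hl]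
    rw [hrel, finprod_quot_out (r := fun i j => Agree l (a i) (a j))
      (f := fun i => factorV k x q g ψ l (p i))
      ⟨fun _ => (equivalence_agree l).refl _, (equivalence_agree l).symm,
        (equivalence_agree l).trans⟩
      fun i j hij => factorV_congr (hp l hl i j hij).1 (hp l hl i j hij).2]
    simp [IsFirst]
  rw [density, Finset.prod_congr rfl fun l hl => h1 l (by
    rw [Finset.mem_range] at hl; omega), Finset.prod_range_succ']
  simp only [factorV_zero hxq, ite_self, Finset.prod_const_one, mul_one]
  have hpos : ∀ l i, 0 ≤ if IsFirst Finset.univ a (l + 1) i then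
      factorV k x q g ψ (l + 1) (p i) else 1 := fun l i => by
    unfold factorV; split_ifs <;> positivity
  rw [ENNReal.ofReal_prod_of_nonneg fun l _ => Finset.prod_nonneg fun i _ => hpos l i, leafDensity,
    Finset.prod_comm]
  refine Finset.prod_congr rfl fun l hl => ?_
  rw [ENNReal.ofReal_prod_of_nonneg fun i _ => hpos l i]
  refine Finset.prod_congr rfl fun i _ => ?_
  rw [firstFactor, ← factorV_succ (Finset.mem_range.1 hl)]
  split_ifs <;> simp

end Density

/-! ### The law of the shifted field -/

section Shifted

variable {E : Type*} [MeasurableSpace E] {x : ℕ → ℝ} {K : ℕ → Kernel E E}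
  [∀ l, IsMarkovKernel (K l)] {w : ℕ → E → ℝ}

theorem TiltData.map_comp_tilt (h : TiltData x K w) [∀ l, IsMarkovKernel (tilt x K w l)] {n d : ℕ}
    (a : Fin n → Fin d → ℕ) (ν : Measure E) [IsProbabilityMeasure ν] :
    (treeKernel d (tilt x K w) ∘ₘ ν).map (fun f i => f (a i)) =
      ((treeKernel d K ∘ₘ ν).map fun f i => f (a i)).withDensity (leafDensity x w a) := by
  have hm : Measurable fun (f : (Fin d → ℕ) → E) (i : Fin n) => f (a i) := by fun_prop
  have hd := measurable_leafDensity h a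
  ext s hs
  have hi : Measurable fun f : (Fin d → ℕ) → E =>
      s.indicator (leafDensity x w a) fun i => f (a i) := (hd.indicator hs).comp hm
  rw [Measure.map_apply hm hs, Measure.bind_apply (hm hs) (Kernel.aemeasurable _),
    withDensity_apply _ hs, ← lintegral_indicator hs, lintegral_map (hd.indicator hs) hm,
    Measure.lintegral_bind (Kernel.aemeasurable _) hi.aemeasurable]
  refine lintegral_congr fun y => ?_
  have h1 := congrArg (fun μ => μ s) (map_treeLaw_tilt h a y)
  rw [Measure.map_apply hm hs, withDensity_apply _ hs, ← lintegral_indicator hs,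
    lintegral_map (hd.indicator hs) hm] at h1
  exact h1

variable {k : ℕ} {x₀ : ℕ → ℝ} {q : ℕ → unitInterval}

lemma leafDensity_congr (hxq : IsAtomic k x₀ q) {n : ℕ} {a b : Fin n → Fin k → ℕ}
    (hab : ∀ i j, overlap q (a i) (a j) = overlap q (b i) (b j)) :
    leafDensity x w a = leafDensity x w b := by
  funext p
  unfold leafDensity
  refine Finset.prod_congr rfl fun i _ => Finset.prod_congr rfl fun l hl => ?_
  have h1 : IsFirst Finset.univ a (l + 1) i ↔ IsFirst Finset.univ b (l + 1) i := by
    have hl' := Finset.mem_range.1 hl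
    simp only [IsFirst, hxq.agree_iff (by omega : l + 1 ≤ k) (hab _ i)]
  unfold firstFactor
  split_ifs with h2 h3 h3
  exacts [rfl, absurd (h1.1 h2) h3, absurd (h1.2 h3) h2, rfl]

/-- Both the untilted law and the density at given leaves depend only on the overlaps. -/
lemma OverlapInvariant.tilt (hxq : IsAtomic k x₀ q) (h : TiltData x K w)
    [∀ l, IsMarkovKernel (tilt x K w l)] {ν : Measure E} [IsProbabilityMeasure ν]
    (hF : OverlapInvariant q (treeKernel k K ∘ₘ ν)) :
    OverlapInvariant q (treeKernel k (GREM.tilt x K w) ∘ₘ ν) := fun n a b hab => by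
  rw [h.map_comp_tilt, h.map_comp_tilt, hF n a b hab, leafDensity_congr hxq hab]

end Shifted

namespace IsGREMWithField

variable {Ω : Type*} [MeasurableSpace Ω] {P : Measure Ω} [IsProbabilityMeasure P] {k : ℕ}
  {x : ℕ → ℝ} {q : ℕ → unitInterval} {g ψ : ℝ → ℝ} {ζ : Vertex k → ℕ → Ω → ℝ}
  {κ : (Fin k → ℕ) → unitInterval → Ω → ℝ}

lemma measurable_paths (hG : IsGREMWithField P k x q g ζ κ) : Measurable fun ω α r => κ α r ω :=
  measurable_pi_lambda _ fun α => measurable_pi_lambda _ fun r => hG.measurable_field α r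

lemma gaussian_leaves (hG : IsGREMWithField P k x q g ζ κ) {n : ℕ} (a : Fin n → Fin k → ℕ) :
    IsGaussianProcess (fun p : Fin n × unitInterval => κ (a p.1) p.2) P :=
  hG.gaussian.comp_right fun p : Fin n × unitInterval => (a p.1, p.2)

/-- The covariances at the chosen leaves involve only their overlaps, and they determine a centered
Gaussian law. -/
lemma overlapInvariant (hG : IsGREMWithField P k x q g ζ κ) :
    OverlapInvariant q (P.map fun ω α r => κ α r ω) := fun n a b hab => by
  have hc : ∀ a : Fin n → Fin k → ℕ, Measurable
      fun (f : (Fin k → ℕ) → unitInterval → ℝ) (i : Fin n) => f (a i) := fun a => by fun_prop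
  have h1 := map_eq_of_covariance_eq (P := P)
    (X := fun (p : Fin n × unitInterval) ω => κ (a p.1) p.2 ω)
    (Y := fun (p : Fin n × unitInterval) ω => κ (b p.1) p.2 ω) (hG.gaussian_leaves a)
    (hG.gaussian_leaves b) (fun p => hG.measurable_field _ _) (fun p => hG.measurable_field _ _)
    (fun p => hG.centered _ _) (fun p => hG.centered _ _) fun s t => by
      rw [hG.covariance, hG.covariance, hab]
  have hu : Measurable fun (m : Fin n × unitInterval → ℝ) (i : Fin n) (r : unitInterval) =>
    m (i, r) := by fun_prop
  have hm : ∀ a : Fin n → Fin k → ℕ, Measurable fun ω (p : Fin n × unitInterval) =>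
      κ (a p.1) p.2 ω := fun a => measurable_pi_lambda _ fun p => hG.measurable_field _ _
  have h2 := congrArg (Measure.map fun (m : Fin n × unitInterval → ℝ) (i : Fin n)
    (r : unitInterval) => m (i, r)) h1
  rw [Measure.map_map hu (hm a), Measure.map_map hu (hm b)] at h2
  rw [Measure.map_map (hc a) hG.measurable_paths, Measure.map_map (hc b) hG.measurable_paths]
  exact h2

lemma ae_paths_eq (hxq : IsAtomic k x q) (hG : IsGREMWithField P k x q g ζ κ) {n : ℕ}
    (a : Fin n → Fin k → ℕ) :
    ∀ᵐ p ∂(P.map fun ω α r => κ α r ω).map fun f i => f (a i), ∀ l ≤ k, ∀ i j,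
      Agree l (a i) (a j) → p i (q (l + 1)) = p j (q (l + 1)) ∧ p i (q l) = p j (q l) := by
  have hc : Measurable fun (f : (Fin k → ℕ) → unitInterval → ℝ) (i : Fin n) => f (a i) := by
    fun_prop
  rw [Measure.map_map hc hG.measurable_paths]
  simp only [ae_all_iff]
  intro l hl i j hA
  refine (ae_map_iff (hc.comp hG.measurable_paths).aemeasurable ?_).2 ?_
  · exact (measurableSet_eq_fun (by fun_prop) (by fun_prop)).inter
      (measurableSet_eq_fun (by fun_prop) (by fun_prop))
  · have ho := hxq.le_overlap hl hA
    filter_upwards [hG.ae_eq hxq ho, hG.ae_eq hxq ((hxq.q_le hl).trans ho)] with ω h1 h2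
    exact ⟨h1, h2⟩

/-- The law of the shifted field at the leaves `a` with respect to that of the field. -/
theorem rnDeriv_tilt (hxq : IsAtomic k x q) (hg : IsCovFun g) (hψ : IsShiftFun ψ)
    (hG : IsGREMWithField P k x q g ζ κ) [∀ l, IsMarkovKernel (fieldKernel P κ q l)]
    [∀ l, IsMarkovKernel (tilt (par k x) (fieldKernel P κ q) (shiftWt k x q g ψ) l)]
    {n : ℕ} {M : ℕ → ℕ → unitInterval} (a : Fin n → Fin k → ℕ)
    (hM : ∀ i j : Fin n, M i j = overlap q (a i) (a j)) {μ μt : Measure (Fin n → unitInterval → ℝ)}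
    (hμ : μ = (P.map fun ω α r => κ α r ω).map fun f i => f (a i))
    (hμt : μt = (treeKernel k (tilt (par k x) (fieldKernel P κ q) (shiftWt k x q g ψ)) ∘ₘ
      rootLaw P κ q).map fun f i => f (a i)) :
    μt ≪ μ ∧ μt.rnDeriv μ =ᵐ[μ] fun p => ENNReal.ofReal (density k x q g ψ n M p) := by
  have hroot := hG.isProbabilityMeasure_rootLaw
  have h := hG.tiltData hxq hg hψ
  have h1 : μt = μ.withDensity (leafDensity (par k x) (shiftWt k x q g ψ) a) := by
    rw [hμt, hμ, h.map_comp_tilt, hG.map_field hxq]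
  have hc : Measurable fun (f : (Fin k → ℕ) → unitInterval → ℝ) (i : Fin n) => f (a i) := by
    fun_prop
  have hp1 := Measure.isProbabilityMeasure_map (μ := P) hG.measurable_paths.aemeasurable
  have hp2 : IsProbabilityMeasure μ := by
    rw [hμ]; exact Measure.isProbabilityMeasure_map hc.aemeasurable
  rw [h1]
  refine ⟨withDensity_absolutelyContinuous _ _,
    (Measure.rnDeriv_withDensity _ (measurable_leafDensity h a)).trans ?_⟩
  have h2 := hG.ae_paths_eq hxq a
  rw [← hμ] at h2
  filter_upwards [h2] with p hp
  exact (ofReal_density hxq hM hp).symm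

end IsGREMWithField
end GREM

namespace GREM

/-! ### Sorting weights that differ by a tree automorphism and a constant -/

section Sorting

variable {A : Type*}

lemma IsDecEnum.comp_of_mul {w w' : A → ℝ} {e : ℕ → A} (h : IsDecEnum w' e) {σ : A → A}
    (hσ : Function.Bijective σ) {C : ℝ} (hC : 0 < C) (hw : ∀ a, w (σ a) = w' a * C) :
    IsDecEnum w fun i => σ (e i) :=
  ⟨hσ.comp h.1, fun i j hij => by
    change w (σ (e j)) < w (σ (e i))
    rw [hw, hw]
    exact mul_lt_mul_of_pos_right (h.2 hij) hC⟩

lemma overlap_of_isTreeAut {k : ℕ} (q : ℕ → unitInterval) {σ : (Fin k → ℕ) → Fin k → ℕ}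
    (hσ : IsTreeAut σ) (α β : Fin k → ℕ) : overlap q (σ α) (σ β) = overlap q α β := by
  classical
  unfold overlap
  congr 1
  exact Finset.filter_congr fun l _ => hσ.2 l α β

/-- The exponents telescope from `ψ_{q_{k+1}} = ψ` at time `1` down to `ψ_{q_1}` at time `q 1`. -/
lemma prod_shiftWt {k : ℕ} {x : ℕ → ℝ} {q : ℕ → unitInterval} (hxq : IsAtomic k x q) (g ψ : ℝ → ℝ)
    (p : unitInterval → ℝ) : ∏ l ∈ Finset.range k, shiftWt k x q g ψ l p =
      Real.exp (ψ (p 1)) * Real.exp (-psiLevel k x q g ψ 1 (p (q 1))) := by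
  unfold shiftWt
  rw [← Real.exp_sum, Finset.sum_range_sub fun l => psiLevel k x q g ψ (l + 1) (p (lvl k q (l + 1))),
    psiLevel_last le_rfl, hxq.lvl_last le_rfl, zero_add, lvl_of_le (by omega), ← Real.exp_add,
    sub_eq_add_neg]

/-- The effect of a shift of the weights of the leaves which amounts to a change of the tree. -/
theorem ordered_of_isTreeAut {k : ℕ} [Infinite (Fin k → ℕ)] (q : ℕ → unitInterval)
    {w w' : (Fin k → ℕ) → ℝ} {σ : (Fin k → ℕ) → Fin k → ℕ} (hσ : IsTreeAut σ) {C : ℝ} (hC : 0 < C)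
    (hw : ∀ α, w (σ α) = w' α * C) (hs : Sortable w') (hpos : ∀ α, 0 < w' α)
    (hsum : ∑' α, ENNReal.ofReal (w' α) ≠ ∞) :
    IsDecEnum w (decEnum w) ∧ Summable w ∧ (∀ i, decEnum w i = σ (decEnum w' i)) ∧
      orderedOverlap q w = orderedOverlap q w' ∧
      ∀ i, w (decEnum w i) / ∑' α, w α = normWt w' i := by
  have hbij : Function.Bijective σ := ⟨hσ.injective, hσ.1⟩
  have h1 := (decEnum_isDecEnum hs).comp_of_mul hbij hC hw
  have h2 := h1.eq_decEnum
  have h3 : Summable w' := by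
    have := ENNReal.summable_toReal hsum
    simpa only [ENNReal.toReal_ofReal (hpos _).le] using this
  have h4 : w = fun α => w' ((Equiv.ofBijective σ hbij).symm α) * C := by
    funext α
    obtain ⟨β, rfl⟩ := hbij.2 α
    rw [hw, show σ β = Equiv.ofBijective σ hbij β from rfl, Equiv.symm_apply_apply]
  refine ⟨h2 ▸ h1, ?_, fun i => congrFun h2 i, ?_, fun i => ?_⟩
  · rw [h4]
    exact ((Equiv.ofBijective σ hbij).symm.summable_iff.2 h3).mul_right C
  · funext i j
    simp only [orderedOverlap, h2]
    exact overlap_of_isTreeAut q hσ _ _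
  · have h5 : ∑' α, w α = (∑' α, w' α) * C := by
      conv_lhs => rw [h4]
      rw [tsum_mul_right, (Equiv.ofBijective σ hbij).symm.tsum_eq w']
    have h6 : (∑' α, ENNReal.ofReal (w' α)).toReal = ∑' α, w' α := by
      rw [ENNReal.tsum_toReal_eq fun _ => ENNReal.ofReal_ne_top]
      simp only [ENNReal.toReal_ofReal (hpos _).le]
    rw [h5, congrFun h2 i, hw, normWt, h6, mul_div_mul_right _ _ hC.ne']

end Sorting

/-! ### The shifted cascade as a cascade with a tilted field -/

section Coupling

variable {Ω : Type*} [MeasurableSpace Ω] {P : Measure Ω} [IsProbabilityMeasure P] {d : ℕ}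
  {x : ℕ → ℝ} {q : ℕ → unitInterval} {g ψ : ℝ → ℝ} {ζ : Vertex (d + 1) → ℕ → Ω → ℝ}
  {κ : (Fin (d + 1) → ℕ) → unitInterval → Ω → ℝ}

/-- The law of the processes at depth `l`, continued by the last one. -/
noncomputable def remLaw (P : Measure Ω) (ζ : Vertex (d + 1) → ℕ → Ω → ℝ) (l : ℕ) :
    Measure (ℕ → ℝ) :=
  P.map fun ω j => ζ ⟨⟨min l d, by omega⟩, fun _ => 0⟩ j ω

/-- The processes on the tree together with the field. -/
def treeField (ζ : Vertex (d + 1) → ℕ → Ω → ℝ) (κ : (Fin (d + 1) → ℕ) → unitInterval → Ω → ℝ)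
    (ω : Ω) : TreeSpace (d + 1) (unitInterval → ℝ) :=
  (fun v j => ζ v j ω, fun α r => κ α r ω)

namespace IsGREMWithField

lemma isREMLaw_remLaw (hxq : IsAtomic (d + 1) x q) (hG : IsGREMWithField P (d + 1) x q g ζ κ)
    (l : ℕ) : IsREMLaw (par (d + 1) x l) (remLaw P ζ l) := by
  have h1 := hG.rem ⟨⟨min l d, by omega⟩, fun _ => 0⟩
  have h2 : par (d + 1) x l = x (min l d + 1) := by rw [par, Nat.add_min_add_right]
  have h3 := hxq.par_pos l
  rw [h2] at h3 ⊢
  exact h1.isREMLaw h3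

lemma measurable_processes (hG : IsGREMWithField P (d + 1) x q g ζ κ) :
    Measurable fun ω v j => ζ v j ω :=
  measurable_pi_lambda _ fun v => measurable_pi_lambda _ fun j => (hG.rem v).measurable j

lemma measurable_treeField (hG : IsGREMWithField P (d + 1) x q g ζ κ) :
    Measurable (treeField ζ κ) := hG.measurable_processes.prodMk hG.measurable_paths

lemma map_processes (hxq : IsAtomic (d + 1) x q) (hG : IsGREMWithField P (d + 1) x q g ζ κ) :
    P.map (fun ω v j => ζ v j ω) = treeMeas (remLaw P ζ) (d + 1) := by
  have hm : ∀ v : Vertex (d + 1), Measurable fun ω j => ζ v j ω := fun v =>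
    measurable_pi_lambda _ (hG.rem v).measurable
  refine (hG.indep_rem.map_fun_eq_infinitePi_map hm).trans ?_
  rw [treeMeas]
  congr 1
  funext v
  have h1 : par (d + 1) x v.1 = x (v.1 + 1) := by rw [par, min_eq_left (by omega)]
  have h2 := hxq.par_pos v.1
  have h3 := hxq.par_lt_one v.1
  have h4 := hG.isREMLaw_remLaw hxq v.1
  rw [h1] at h2 h3 h4
  exact (hG.rem v).map_eq h2 h3 h4

lemma map_treeField (hxq : IsAtomic (d + 1) x q) (hG : IsGREMWithField P (d + 1) x q g ζ κ) :
    P.map (treeField ζ κ) =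
      (treeMeas (remLaw P ζ) (d + 1)).prod (P.map fun ω α r => κ α r ω) := by
  rw [← hG.map_processes hxq]
  exact hG.indep_field.map_prod_eq_prod_map_map hG.measurable_processes.aemeasurable
    hG.measurable_paths.aemeasurable

lemma isProbabilityMeasure_remLaw (hxq : IsAtomic (d + 1) x q)
    (hG : IsGREMWithField P (d + 1) x q g ζ κ) (l : ℕ) : IsProbabilityMeasure (remLaw P ζ l) :=
  (hG.isREMLaw_remLaw hxq l).isProbabilityMeasure

lemma ae_treeMeas (hxq : IsAtomic (d + 1) x q) (hG : IsGREMWithField P (d + 1) x q g ζ κ) :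
    ∀ᵐ Z ∂treeMeas (remLaw P ζ) (d + 1), Sortable (treeWt Z) ∧ (∀ α, 0 < treeWt Z α) ∧
      ∑' α, ENNReal.ofReal (treeWt Z α) ≠ ∞ := by
  have hρ := hG.isREMLaw_remLaw hxq
  have hmono : ∀ l m, l < m → m < d + 1 → par (d + 1) x l < par (d + 1) x m :=
    fun l m => hxq.par_lt
  filter_upwards [ae_sortable_treeWt hxq.par_pos hxq.par_lt_one hρ d
    (fun l m h1 h2 => hmono l m h1 (by omega)), ae_treeWt_pos hρ (d + 1),
    ae_tsum_treeWt hxq.par_pos hρ (d + 1) hmono (y := 1) fun l _ => hxq.par_lt_one l]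
    with Z h1 h2 h3
  simp only [Real.rpow_one] at h3
  exact ⟨h1, h2, h3⟩

/-- The shift turns the cascade and its field into a cascade with the same law, together with an
independent tilted field. -/
theorem exists_shift (hxq : IsAtomic (d + 1) x q) (hg : IsCovFun g) (hψ : IsShiftFun ψ)
    (hG : IsGREMWithField P (d + 1) x q g ζ κ)
    [∀ l, IsMarkovKernel (fieldKernel P κ q l)]
    [∀ l, IsMarkovKernel (tilt (par (d + 1) x) (fieldKernel P κ q) (shiftWt (d + 1) x q g ψ) l)] :
    ∃ Φ : Ω → TreeSpace (d + 1) (unitInterval → ℝ), Measurable Φ ∧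
      P.map Φ = (treeMeas (remLaw P ζ) (d + 1)).prod (treeKernel (d + 1)
        (tilt (par (d + 1) x) (fieldKernel P κ q) (shiftWt (d + 1) x q g ψ)) ∘ₘ rootLaw P κ q) ∧
      ∀ᵐ ω ∂P, IsDecEnum (shiftedWeight ζ κ ψ ω) (decEnum (shiftedWeight ζ κ ψ ω)) ∧
        Summable (shiftedWeight ζ κ ψ ω) ∧
        (∀ i, orderedField κ (shiftedWeight ζ κ ψ ω) ω i = (Φ ω).2 (sortedLeaf (Φ ω).1 i)) ∧
        orderedOverlap q (shiftedWeight ζ κ ψ ω) = treeOverlap q (Φ ω).1 ∧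
        (∀ i, shiftedWeight ζ κ ψ ω (decEnum (shiftedWeight ζ κ ψ ω) i) *
          Real.exp (-psiLevel (d + 1) x q g ψ 1
            (orderedField κ (shiftedWeight ζ κ ψ ω) ω i (q 1))) =
              treeWt (Φ ω).1 (sortedLeaf (Φ ω).1 i)) ∧
        ∀ i, shiftedWeight ζ κ ψ ω (decEnum (shiftedWeight ζ κ ψ ω) i) /
          ∑' α, shiftedWeight ζ κ ψ ω α = normWt (treeWt (Φ ω).1) i := by
  have hroot := hG.isProbabilityMeasure_rootLaw
  have hρ := hG.isREMLaw_remLaw hxq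
  have hρp := hG.isProbabilityMeasure_remLaw hxq
  obtain ⟨S, hS, hSmap, G, hGm, hGae, hGσ⟩ := exists_reorder (d + 1) hxq.par_pos hxq.par_lt_one hρ
    (hG.tiltData hxq hg hψ)
  have hT := hG.measurable_treeField
  have hTmap := hG.map_treeField hxq
  rw [hG.map_field hxq] at hTmap
  have hΦ : P.map (S ∘ treeField ζ κ) = (treeMeas (remLaw P ζ) (d + 1)).prod (treeKernel (d + 1)
      (tilt (par (d + 1) x) (fieldKernel P κ q) (shiftWt (d + 1) x q g ψ)) ∘ₘ rootLaw P κ q) := by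
    rw [← Measure.map_map hS hT, hTmap]
    exact map_prod_comp _ _ _ _ hS hSmap
  refine ⟨S ∘ treeField ζ κ, hS.comp hT, hΦ, ?_⟩
  have h1 : ∀ᵐ ω ∂P, treeField ζ κ ω ∈ G := by
    refine ae_of_ae_map hT.aemeasurable ?_
    rw [hTmap]
    exact ae_prod_comp _ _ _ hGm hGae
  have h2 := hG.ae_treeMeas hxq
  have h3 : ∀ᵐ p ∂P.map (S ∘ treeField ζ κ), Sortable (treeWt p.1) ∧ (∀ α, 0 < treeWt p.1 α) ∧
      ∑' α, ENNReal.ofReal (treeWt p.1 α) ≠ ∞ := by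
    rw [hΦ]
    exact Measure.quasiMeasurePreserving_fst.ae h2
  have h4 : ∀ᵐ ω ∂P, ∀ α, κ α (q 1) ω = κ (fun _ => 0) (q 1) ω :=
    ae_all_iff.2 fun α => hG.ae_eq hxq (hxq.le_overlap (Nat.zero_le _) (agree_zero _ _))
  filter_upwards [h1, ae_of_ae_map (hS.comp hT).aemeasurable h3, h4] with ω hω1 hω2 hω3
  obtain ⟨σ, hσ, hf, hw⟩ := hGσ _ hω1
  -- The factor `e^{ψ_{q_1}(κ(q_1))}` not covered by the tilt. It is random but common to all
  -- leaves, so it leaves the order unchanged and cancels in the normalized weights.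
  set C := Real.exp (psiLevel (d + 1) x q g ψ 1 (κ (fun _ => 0) (q 1) ω)) with hC
  have hC0 : 0 < C := Real.exp_pos _
  have hwC : ∀ α, shiftedWeight ζ κ ψ ω (σ α) = treeWt (S (treeField ζ κ ω)).1 α * C := fun α => by
    rw [← hw, prod_shiftWt hxq]
    change weight ζ ω (σ α) * _ = weight ζ ω (σ α) * (Real.exp (ψ (κ (σ α) 1 ω)) *
      Real.exp (-psiLevel (d + 1) x q g ψ 1 (κ (σ α) (q 1) ω))) * C
    rw [hω3, Real.exp_neg, ← hC, mul_assoc, mul_assoc, inv_mul_cancel₀ hC0.ne', mul_one]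
  obtain ⟨r1, r2, r3, r4, r5⟩ := ordered_of_isTreeAut q hσ hC0 hwC hω2.1 hω2.2.1 hω2.2.2
  have r3' : ∀ i, decEnum (shiftedWeight ζ κ ψ ω) i =
      σ (sortedLeaf (S (treeField ζ κ ω)).1 i) := r3
  refine ⟨r1, r2, fun i => ?_, r4, fun i => ?_, r5⟩
  · rw [Function.comp_apply, hf, ← r3']
    rfl
  · rw [orderedField, hω3, r3', hwC, Real.exp_neg, ← hC, mul_assoc, mul_inv_cancel₀ hC0.ne', mul_one]
    rfl

end IsGREMWithField

end Coupling
end GREM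
namespace GREM

/-! ### Transfer of conditional laws and independence along a map -/

section CondDistrib

variable {Ω T X Y : Type*} [MeasurableSpace Ω] [MeasurableSpace T] [MeasurableSpace X]
  [MeasurableSpace Y] {P : Measure Ω}

lemma hasCondDistrib_of_map {Φ : Ω → T} (hΦ : Measurable Φ) {G : T → X} (hG : Measurable G)
    {H : T → Y} (hH : Measurable H) {f : Ω → X} {h : Ω → Y} (hf : f =ᵐ[P] fun ω => G (Φ ω))
    (hh : h =ᵐ[P] fun ω => H (Φ ω)) {κ : Kernel X Y}
    (hmap : (P.map Φ).map (fun t => (G t, H t)) = (P.map Φ).map G ⊗ₘ κ) :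
    HasCondDistrib h f κ P := by
  have hGH : Measurable fun t => (G t, H t) := hG.prodMk hH
  have h1 : (fun ω => (f ω, h ω)) =ᵐ[P] (fun t => (G t, H t)) ∘ Φ := by
    filter_upwards [hf, hh] with ω h1 h2
    rw [h1, h2]
    rfl
  refine ⟨(hGH.comp hΦ).aemeasurable.congr h1.symm, ?_⟩
  rw [Measure.map_congr h1, ← Measure.map_map hGH hΦ, hmap, Measure.map_congr hf,
    Measure.map_map hG hΦ]
  rfl

lemma indepFun_of_map {Φ : Ω → T} (hΦ : Measurable Φ) {G : T → X} (hG : Measurable G)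
    {H : T → Y} (hH : Measurable H) {f : Ω → X} {h : Ω → Y} (hf : f =ᵐ[P] fun ω => G (Φ ω))
    (hh : h =ᵐ[P] fun ω => H (Φ ω)) (hi : IndepFun G H (P.map Φ)) : IndepFun f h P := by
  refine IndepFun.congr ?_ hf.symm hh.symm
  rw [indepFun_iff_measure_inter_preimage_eq_mul] at hi ⊢
  intro s t hs ht
  have h1 := hi s t hs ht
  rw [Measure.map_apply hΦ ((hG hs).inter (hH ht)), Measure.map_apply hΦ (hG hs),
    Measure.map_apply hΦ (hH ht)] at h1
  exact h1

end CondDistrib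

/-- Identifies almost every matrix with the overlaps of actual leaves, where `overlapKernel` takes
its intended value. -/
lemma ae_map_orderedOverlap {Ω : Type*} [MeasurableSpace Ω] {P : Measure Ω} {d : ℕ}
    (q : ℕ → unitInterval) {w : Ω → (Fin (d + 1) → ℕ) → ℝ} (hw : Measurable w) (n : ℕ) :
    ∀ᵐ M ∂P.map fun ω => orderedOverlap q (w ω), ∃ a : Fin n → Fin (d + 1) → ℕ,
      ∀ i j : Fin n, M i j = overlap q (a i) (a j) := by
  have hm : Measurable fun ω => orderedOverlap q (w ω) := (measurable_orderedOverlap q).comp hw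
  refine (ae_map_iff hm.aemeasurable ?_).2 (ae_of_all _ fun ω => ⟨fun i => decEnum (w ω) i,
    fun i j => rfl⟩)
  have : {M : ℕ → ℕ → unitInterval | ∃ a : Fin n → Fin (d + 1) → ℕ,
      ∀ i j : Fin n, M i j = overlap q (a i) (a j)} = ⋃ a : Fin n → Fin (d + 1) → ℕ,
      ⋂ i : Fin n, ⋂ j : Fin n, {M | M i j = overlap q (a i) (a j)} := by
    ext M
    simp [mem_ofPred_eq]
  rw [this]
  exact .iUnion fun a => .iInter fun i => .iInter fun j =>
    measurableSet_eq_fun (by fun_prop) measurable_const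

end GREM

/-! ### Assembly of the proposition -/

theorem mainTheorem6 {Ω : Type*} [MeasurableSpace Ω] (P : Measure Ω) [IsProbabilityMeasure P]
    (k : ℕ) (x : ℕ → ℝ) (q : ℕ → unitInterval) (hxq : GREM.IsAtomic k x q)
    (g : ℝ → ℝ) (hg : GREM.IsCovFun g) (ψ : ℝ → ℝ) (hψ : GREM.IsShiftFun ψ)
    (ζ : GREM.Vertex k → ℕ → Ω → ℝ) (κ : (Fin k → ℕ) → unitInterval → Ω → ℝ)
    (hG : GREM.IsGREMWithField P k x q g ζ κ)
    -- the weights and the shifted weights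
    (ξ ξt : Ω → (Fin k → ℕ) → ℝ)
    (hξ : ∀ ω, ξ ω = GREM.weight ζ ω) (hξt : ∀ ω, ξt ω = GREM.shiftedWeight ζ κ ψ ω)
    -- the overlap matrices of the ordered points, before and after the shift
    (Q Qt : Ω → ℕ → ℕ → unitInterval)
    (hQ : ∀ ω, Q ω = GREM.orderedOverlap q (ξ ω))
    (hQt : ∀ ω, Qt ω = GREM.orderedOverlap q (ξt ω))
    -- the fields of the ordered points, before and after the shift
    (κo κt : Ω → ℕ → unitInterval → ℝ)
    (hκo : ∀ ω, κo ω = GREM.orderedField κ (ξ ω) ω)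
    (hκt : ∀ ω, κt ω = GREM.orderedField κ (ξt ω) ω) :
    -- the orderings exist
    (∀ᵐ ω ∂P, GREM.IsDecEnum (ξ ω) (GREM.decEnum (ξ ω)) ∧
      GREM.IsDecEnum (ξt ω) (GREM.decEnum (ξt ω)) ∧ Summable (ξt ω)) ∧
    -- the overlaps have the same law before and after the shift
    P.map Qt = P.map Q ∧
    -- the conditional laws of the first `n` fields given the overlaps
    (∀ n : ℕ, ∃ μ μt : Kernel (ℕ → ℕ → unitInterval) (Fin n → unitInterval → ℝ),
      IsMarkovKernel μ ∧ IsMarkovKernel μt ∧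
      HasCondDistrib (fun ω (i : Fin n) => κo ω i) Q μ P ∧
      HasCondDistrib (fun ω (i : Fin n) => κt ω i) Qt μt P ∧
      (∀ᵐ M ∂(P.map Q), μt M ≪ μ M ∧
        (μt M).rnDeriv (μ M) =ᵐ[μ M]
          fun p => ENNReal.ofReal (GREM.density k x q g ψ n M p)) ∧
      -- given the overlaps, the fields after the shift are independent of the shifted weights
      -- divided by the common factor
      HasCondDistrib (fun ω (i : Fin n) => κt ω i)
        (fun ω => (Qt ω, fun i : ℕ => ξt ω (GREM.decEnum (ξt ω) i) *
          Real.exp (-GREM.psiLevel k x q g ψ 1 (κt ω i (q 1)))))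
        (μt.prodMkRight (ℕ → ℝ)) P) ∧
    -- the fields after the shift and their overlaps are independent of the normalized weights
    IndepFun (fun ω => (κt ω, Qt ω))
      (fun ω (i : ℕ) => ξt ω (GREM.decEnum (ξt ω) i) / ∑' α, ξt ω α) P := by

  obtain ⟨d, rfl⟩ : ∃ d, k = d + 1 := ⟨k - 1, by have := hxq.one_le; omega⟩
  obtain rfl : ξ = GREM.weight ζ := funext hξ
  obtain rfl : ξt = GREM.shiftedWeight ζ κ ψ := funext hξt
  obtain rfl : Q = fun ω => GREM.orderedOverlap q (GREM.weight ζ ω) := funext hQ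
  obtain rfl : Qt = fun ω => GREM.orderedOverlap q (GREM.shiftedWeight ζ κ ψ ω) := funext hQt
  obtain rfl : κo = fun ω => GREM.orderedField κ (GREM.weight ζ ω) ω := funext hκo
  obtain rfl : κt = fun ω => GREM.orderedField κ (GREM.shiftedWeight ζ κ ψ ω) ω := funext hκt
  have hK := hG.isMarkovKernel_fieldKernel
  have hKt := (hG.tiltData hxq hg hψ).isMarkovKernel_tilt
  have hroot := hG.isProbabilityMeasure_rootLaw
  have hρ := hG.isProbabilityMeasure_remLaw hxq
  have hTm := hG.measurable_treeField
  have hTmap := hG.map_treeField hxq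
  obtain ⟨Φ, hΦ, hΦmap, hΦae⟩ := hG.exists_shift hxq hg hψ
  have hF := hG.overlapInvariant
  have hF' := hF
  rw [hG.map_field hxq] at hF'
  have hFt := hF'.tilt hxq (hG.tiltData hxq hg hψ)
  have hFp := Measure.isProbabilityMeasure_map (μ := P) hG.measurable_paths.aemeasurable
  set F := P.map fun ω α r => κ α r ω with hFdef
  set Ft := GREM.treeKernel (d + 1) (GREM.tilt (GREM.par (d + 1) x) (GREM.fieldKernel P κ q)
    (GREM.shiftWt (d + 1) x q g ψ)) ∘ₘ GREM.rootLaw P κ q with hFtdef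
  set R := GREM.treeMeas (GREM.remLaw P ζ) (d + 1) with hR
  have hQm := GREM.measurable_treeOverlap (d := d) q
  have hQp : Measurable fun p : GREM.TreeSpace (d + 1) (unitInterval → ℝ) =>
      GREM.treeOverlap q p.1 := hQm.comp measurable_fst
  have hWp : Measurable fun (p : GREM.TreeSpace (d + 1) (unitInterval → ℝ)) (i : ℕ) =>
      GREM.treeWt p.1 (GREM.sortedLeaf p.1 i) := measurable_pi_lambda _ fun i =>
    ((GREM.measurable_apply_decEnum i).comp GREM.measurable_treeWt).comp measurable_fst
  have hfp : ∀ n, Measurable fun (p : GREM.TreeSpace (d + 1) (unitInterval → ℝ)) (i : Fin n) =>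
      p.2 (GREM.sortedLeaf p.1 i) := fun n =>
    measurable_pi_lambda _ fun i => GREM.measurable_field_sortedLeaf i
  -- The overlaps are a function of the cascade alone, whatever the field. The cascade law `R` is
  -- the same before and after the shift, whence the equality of the laws of the overlap matrices.
  have hmapQ : ∀ F' : Measure ((Fin (d + 1) → ℕ) → unitInterval → ℝ), IsProbabilityMeasure F' →
      (R.prod F').map (fun p => GREM.treeOverlap q p.1) = R.map (GREM.treeOverlap q) := by
    intro F' hF'
    have h1 := Measure.map_map (μ := R.prod F') hQm measurable_fst
    rw [measurePreserving_fst.map_eq] at h1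
    exact h1.symm
  have hmapQW : (R.prod Ft).map (fun p => (GREM.treeOverlap q p.1,
      fun i : ℕ => GREM.treeWt p.1 (GREM.sortedLeaf p.1 i))) =
      R.map fun Z => (GREM.treeOverlap q Z, fun i : ℕ => GREM.treeWt Z (GREM.sortedLeaf Z i)) := by
    have hW : Measurable fun Z : GREM.Vertex (d + 1) → ℕ → ℝ =>
        (GREM.treeOverlap q Z, fun i : ℕ => GREM.treeWt Z (GREM.sortedLeaf Z i)) :=
      hQm.prodMk (measurable_pi_lambda _ fun i =>
        (GREM.measurable_apply_decEnum i).comp GREM.measurable_treeWt)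
    have h1 := Measure.map_map (μ := R.prod Ft) hW measurable_fst
    rw [measurePreserving_fst.map_eq] at h1
    exact h1.symm
  have hQt : (fun ω => GREM.orderedOverlap q (GREM.shiftedWeight ζ κ ψ ω)) =ᵐ[P]
      fun ω => GREM.treeOverlap q (Φ ω).1 := hΦae.mono fun ω h => h.2.2.2.1
  have hκt : (fun ω => GREM.orderedField κ (GREM.shiftedWeight ζ κ ψ ω) ω) =ᵐ[P]
      fun ω i => (Φ ω).2 (GREM.sortedLeaf (Φ ω).1 i) := hΦae.mono fun ω h => funext h.2.2.1
  have hκtn : ∀ n, (fun ω (i : Fin n) => GREM.orderedField κ (GREM.shiftedWeight ζ κ ψ ω) ω i) =ᵐ[P]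
      fun ω i => (Φ ω).2 (GREM.sortedLeaf (Φ ω).1 i) := fun n =>
    hκt.mono fun ω h => funext fun i => congrFun h i
  -- The conditional laws are those of the original field `F` and of the tilted field `Ft` at any
  -- `n` leaves with the prescribed overlaps.
  refine ⟨?_, ?_, fun n => ⟨GREM.overlapKernel q n F, GREM.overlapKernel q n Ft, inferInstance,
    inferInstance, ?_, ?_, ?_, ?_⟩, ?_⟩
  · have h1 : ∀ᵐ ω ∂P, GREM.Sortable (GREM.weight ζ ω) := by
      have h2 := hG.ae_treeMeas hxq
      rw [← hG.map_processes hxq] at h2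
      exact (ae_of_ae_map hG.measurable_processes.aemeasurable h2).mono fun ω h => h.1
    filter_upwards [h1, hΦae] with ω h1 h2
    exact ⟨GREM.decEnum_isDecEnum h1, h2.1, h2.2.1⟩
  · rw [Measure.map_congr hQt]
    have h1 := Measure.map_map (μ := P) hQp hΦ
    have h2 := Measure.map_map (μ := P) hQp hTm
    rw [hΦmap, hmapQ _ inferInstance] at h1
    rw [hTmap, hmapQ _ inferInstance] at h2
    exact h1.symm.trans h2
  · refine GREM.hasCondDistrib_of_map hTm hQp (hfp n) (ae_of_all _ fun ω => rfl)
      (ae_of_all _ fun ω => rfl) ?_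
    rw [hTmap, hmapQ _ inferInstance]
    exact GREM.map_overlap_field hF n
  · refine GREM.hasCondDistrib_of_map hΦ hQp (hfp n) hQt (hκtn n) ?_
    rw [hΦmap, hmapQ _ inferInstance]
    exact GREM.map_overlap_field hFt n
  · have hw : Measurable fun ω => GREM.weight ζ ω :=
      GREM.measurable_treeWt.comp hG.measurable_processes
    filter_upwards [GREM.ae_map_orderedOverlap (P := P) q hw n] with M hM
    obtain ⟨a, ha⟩ := hM
    exact hG.rnDeriv_tilt hxq hg hψ a ha (hF.overlapKernel_eq a ha) (hFt.overlapKernel_eq a ha)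
  · refine GREM.hasCondDistrib_of_map hΦ (hQp.prodMk hWp) (hfp n) ?_ (hκtn n) ?_
    · filter_upwards [hΦae] with ω h
      exact Prod.ext h.2.2.2.1 (funext h.2.2.2.2.1)
    · rw [hΦmap, hmapQW]
      exact GREM.map_overlap_weights_field hFt n
  · have hN : Measurable fun p : GREM.TreeSpace (d + 1) (unitInterval → ℝ) =>
        GREM.normWt (GREM.treeWt p.1) :=
      (GREM.measurable_normWt.comp GREM.measurable_treeWt).comp measurable_fst
    have hf : Measurable fun (p : GREM.TreeSpace (d + 1) (unitInterval → ℝ)) (i : ℕ) =>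
        p.2 (GREM.sortedLeaf p.1 i) :=
      measurable_pi_lambda _ fun i => GREM.measurable_field_sortedLeaf i
    refine GREM.indepFun_of_map hΦ (hf.prodMk hQp) hN ?_ (hΦae.mono fun ω h => funext h.2.2.2.2.2) ?_
    · filter_upwards [hκt, hQt] with ω h1 h2
      exact Prod.ext h1 h2
    · rw [hΦmap]
      exact GREM.indepFun_field_normWt hFt (GREM.indepFun_overlap_normWt q hxq.par_pos
        hxq.par_lt_one (hG.isREMLaw_remLaw hxq) d fun l m h1 h2 => hxq.par_lt h1 (by omega))
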